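/- Let $n\ge 2$, let $M$ be a smooth (Hausdorff, second countable) $n$-manifold without boundary, and let $(q_A)_{A\in I}$ be a finite family of integers with $0\le q_A\le n$ such that $\sum_{A}\binom{n-1}{q_A}\ge 2$ (that is, there is at least one field of degree $<n$, and the fields of degree $<n$ do not reduce to one single real field of degree $0$ or $n-1$). Let $Y\subset\bigoplus_A\Lambda^{q_A}T^*M$ be an open subset that is a smooth fibre bundle over $M$ whose typical fibre is an open subset of the typical fibre of $\bigoplus_A\Lambda^{q_A}T^*M$; its points are written $(x,y)$ with $y=(y^A)$, $y^A\in\Lambda^{q_A}T^*_xM$. Let $F\to M$ be the kinematical multisymplectic bundle over $Y$ (the dual of the d-jet bundle): its points are $(x,y,p,h)$ with $(x,y)\in Y$, $p_A\in\Lambda^{n-q_A-1}T_x^*M$ for each $A$ with $q_A<n$, and $h\in\Lambda^nT^*_xM$. Denote by $y^A,p_A,h$ also the tautological $M$-horizontal forms on $F$, and put $$\theta=\sum_{q_A<n}(-1)^{n-q_A}\,p_A\wedge dy^A+h,\qquad \omega=-d\theta .$$ A smooth $(n-1)$-form $f$ on $F$ is an observable (hamiltonian $(n-1)$-form) if $i_v\omega=df$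 for some smooth vector field $v$ on $F$. For a smooth vector field $\xi$ on $M$, the Noether current of $\xi$ is the $(n-1)$-form $$J(\xi)=\sum_{q_A<n}\Big((-1)^{n-q_A}\,(i_\xi p_A)\wedge dy^A+p_A\wedge d(i_\xi y^A)\Big)+i_\xi h .$$ An $M$-horizontal $m$-form $Q$ on an open subset of $F$, seen as a map to $\Lambda^mT^*M$ over $M$, is simply differentiable if at every point its variation under vertical changes $\delta z=(\delta y^A,\delta p_A,\delta h)$ has the form $\delta Q=\sum_k\delta z^k\wedge L_k$, where $L_k\in\Lambda^{m-\deg z^k}T_x^*M$ (terms with $\deg z^k>m$ being absent). Then for every observable $f$ on $F$, each point of $F$ has an open neighbourhood $U\subset F$ on which $$f=J(\xi)+Q+d\alpha ,$$ where $\xi$ is a smooth vector field on $M$, $Q$ is a smooth $M$-horizontal, simply differentiable $(n-1)$-form on $U$ that depends only on $(x,y,p)$, and $\alpha$ is a smooth $(n-2)$-form on $U$. If every fibre $F_x$, $x\in M$, is contractible, then such a decomposition holds on all of $F$ (with $U=F$). -/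

import Mathlib

open Bundle Set
open scoped Manifold ContDiff Topology Nat

noncomputable section

namespace DJet

/-! ### Exterior algebra of a topological vector space -/

section Algebra

variable {V : Type*} [AddCommGroup V] [Module ℝ V] [TopologicalSpace V]

/-- Interior product `i_v α` of a `(k+1)`-form: `(i_v α)(w₁, …, w_k) = α(v, w₁, …, w_k)`. -/
def interior {k : ℕ} (v : V) (α : V [⋀^Fin (k + 1)]→L[ℝ] ℝ) : V [⋀^Fin k]→L[ℝ] ℝ :=
  { (AlternatingMap.curryLeft α.toAlternatingMap v : V [⋀^Fin k]→ₗ[ℝ] ℝ) with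
    cont := by
      change Continuous fun w : Fin k → V => α (Matrix.vecCons v w)
      exact α.cont.comp (Continuous.matrixVecCons continuous_const continuous_id) }

theorem interior_apply {k : ℕ} (v : V) (α : V [⋀^Fin (k + 1)]→L[ℝ] ℝ) (w : Fin k → V) :
    interior v α w = α (Matrix.vecCons v w) := rfl

/-- Interior product in every degree; `i_v` of a `0`-form is `0`. -/
def contract (v : V) : {k : ℕ} → (V [⋀^Fin k]→L[ℝ] ℝ) → V [⋀^Fin (k - 1)]→L[ℝ] ℝ
  | 0, _ => 0
  | _ + 1, α => interior v α

/-- The tensor product `α ⊗ β` as a multilinear form in `m = k + l` vectors. -/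
def tensor {k l m : ℕ} (h : k + l = m) (α : V [⋀^Fin k]→L[ℝ] ℝ) (β : V [⋀^Fin l]→L[ℝ] ℝ) :
    ContinuousMultilinearMap ℝ (fun _ : Fin m => V) ℝ :=
  { (LinearMap.mul' ℝ ℝ).compMultilinearMap
      ((MultilinearMap.domCoprod α.toMultilinearMap β.toMultilinearMap).domDomCongr
        (finSumFinEquiv.trans (finCongr h))) with
    cont := by
      change Continuous fun w : Fin m → V =>
        α (fun i => w (finCongr h (finSumFinEquiv (Sum.inl i)))) *
        β (fun j => w (finCongr h (finSumFinEquiv (Sum.inr j))))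
      exact (α.cont.comp (by fun_prop)).mul (β.cont.comp (by fun_prop)) }

theorem tensor_apply {k l m : ℕ} (h : k + l = m) (α : V [⋀^Fin k]→L[ℝ] ℝ)
    (β : V [⋀^Fin l]→L[ℝ] ℝ) (w : Fin m → V) :
    tensor h α β w =
      α (fun i => w (Fin.cast h (Fin.castAdd l i))) *
      β (fun j => w (Fin.cast h (Fin.natAdd k j))) := rfl

open Classical in
/-- The component in degree `m` of the wedge product `α ∧ β` of a `k`-form and an `l`-form, with
the normalisation `(α ∧ β)(w) = (k! l!)⁻¹ ∑_σ sign(σ) (α ⊗ β)(w ∘ σ)`.  It is the wedge product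
if `m = k + l`, and `0` in all the other degrees. -/
def wedge {k l : ℕ} (m : ℕ) (α : V [⋀^Fin k]→L[ℝ] ℝ) (β : V [⋀^Fin l]→L[ℝ] ℝ) :
    V [⋀^Fin m]→L[ℝ] ℝ :=
  if h : k + l = m then
    ((k ! * l ! : ℕ) : ℝ)⁻¹ • ContinuousMultilinearMap.alternatization (tensor h α β)
  else 0

end Algebra

/-! ### Differential forms and vector fields on a manifold without boundary -/

section Forms

variable {E : Type*} [NormedAddCommGroup E] [NormedSpace ℝ E] {H : Type*} [TopologicalSpace H]
  (I : ModelWithCorners ℝ E H) {N : Type*} [TopologicalSpace N] [ChartedSpace H N]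

variable (N) in
/-- Differential `k`-forms (families of alternating forms on the tangent spaces). -/
abbrev DForm (k : ℕ) := (P : N) → TangentSpace I P [⋀^Fin k]→L[ℝ] ℝ

variable {I} in
/-- The coordinate expression of a form in the chart around `P₀`: its pullback under the inverse
of the chart. -/
def localRep {k : ℕ} (η : DForm I N k) (P₀ : N) (u : E) : E [⋀^Fin k]→L[ℝ] ℝ :=
  (η ((extChartAt I P₀).symm u)).compContinuousLinearMap
    (mfderiv 𝓘(ℝ, E) I (extChartAt I P₀).symm u)

variable {I} in
/-- Smoothness of a form on an open set: its coordinate expressions are smooth. -/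
def SmoothFormOn {k : ℕ} (η : DForm I N k) (U : Set N) : Prop :=
  ∀ P₀ : N, ContDiffOn ℝ ∞ (localRep η P₀)
    ((extChartAt I P₀).target ∩ (extChartAt I P₀).symm ⁻¹' U)

variable {I} in
/-- The exterior derivative of a form, computed at `P` in the chart around `P`. -/
def extD {k : ℕ} (η : DForm I N k) : DForm I N (k + 1) := fun P =>
  (extDeriv (localRep η P) (extChartAt I P P)).compContinuousLinearMap
    (mfderiv I 𝓘(ℝ, E) (extChartAt I P) P)

variable {I} in
/-- Smoothness of a vector field on an open set. -/
def SmoothFieldOn [IsManifold I 1 N] (v : (P : N) → TangentSpace I P) (U : Set N) : Prop :=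
  ContMDiffOn I I.tangent ∞ (fun P => (⟨P, v P⟩ : TangentBundle I N)) U

end Forms

section Smoothness

variable {E : Type*} [NormedAddCommGroup E] [NormedSpace ℝ E]

/-- The pullback of alternating forms depends smoothly on the linear map. -/
theorem contDiff_compCLM (k : ℕ) : ContDiff ℝ ∞
    (ContinuousAlternatingMap.compContinuousLinearMapCLM :
      (E →L[ℝ] E) → (E [⋀^Fin k]→L[ℝ] ℝ) →L[ℝ] (E [⋀^Fin k]→L[ℝ] ℝ)) := by
  let A : ContinuousMultilinearMap ℝ (fun _ : Fin k => E) ℝ →L[ℝ] (E [⋀^Fin k]→L[ℝ] ℝ) :=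
    LinearMap.mkContinuous
      { toFun := fun f => ContinuousMultilinearMap.alternatization f
        map_add' := fun f g => map_add _ f g
        map_smul' := fun c f => by
          ext v
          simp [ContinuousMultilinearMap.alternatization_apply_apply, Finset.mul_sum,
            mul_left_comm, Units.smul_def] }
      (k ! : ℝ) fun f => by
        refine ContinuousAlternatingMap.opNorm_le_bound _ (by positivity) fun v => ?_
        simp only [LinearMap.coe_mk, AddHom.coe_mk,
          ContinuousMultilinearMap.alternatization_apply_apply]
        refine (norm_sum_le _ _).trans ?_
        have : ∀ σ ∈ (Finset.univ : Finset (Equiv.Perm (Fin k))),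
            ‖Equiv.Perm.sign σ • f (v ∘ σ)‖ ≤ ‖f‖ * ∏ i, ‖v i‖ := fun σ _ => by
          have h1 : ‖Equiv.Perm.sign σ • f (v ∘ σ)‖ = ‖f (v ∘ σ)‖ := by
            rcases Int.units_eq_one_or (Equiv.Perm.sign σ) with h | h <;> simp [h]
          rw [h1]
          refine (f.le_opNorm _).trans_eq ?_
          congr 1
          exact Equiv.prod_comp σ fun i => ‖v i‖
        refine (Finset.sum_le_sum this).trans_eq ?_
        simp [Fintype.card_perm, mul_assoc]
  have key : (ContinuousAlternatingMap.compContinuousLinearMapCLM :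
      (E →L[ℝ] E) → (E [⋀^Fin k]→L[ℝ] ℝ) →L[ℝ] (E [⋀^Fin k]→L[ℝ] ℝ)) = fun L =>
      ((k ! : ℝ)⁻¹ • A).comp
        ((ContinuousMultilinearMap.compContinuousLinearMapContinuousMultilinear ℝ
          (fun _ : Fin k => E) (fun _ => E) ℝ (fun _ => L)).comp
          (ContinuousAlternatingMap.toContinuousMultilinearMapCLM ℝ)) := by
    funext L
    ext f v
    have h2 : ∀ σ : Equiv.Perm (Fin k),
        Equiv.Perm.sign σ • f (fun i => L (v (σ i))) = f (fun i => L (v i)) := fun σ => by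
      have := f.toAlternatingMap.map_perm (fun i => L (v i)) σ
      have h3 : f (fun i => L (v (σ i))) = Equiv.Perm.sign σ • f (fun i => L (v i)) := this
      rw [h3, smul_smul, Int.units_mul_self, one_smul]
    have h4 : A (f.toContinuousMultilinearMap.compContinuousLinearMap fun _ => L) v =
        (k ! : ℝ) * f (fun i => L (v i)) := by
      change ContinuousMultilinearMap.alternatization _ v = _
      rw [ContinuousMultilinearMap.alternatization_apply_apply]
      refine (Finset.sum_congr rfl fun σ _ => h2 σ).trans ?_
      simp [Fintype.card_perm]
    change f (fun i => L (v i)) = (k ! : ℝ)⁻¹ *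
      A (f.toContinuousMultilinearMap.compContinuousLinearMap fun _ => L) v
    rw [h4, inv_mul_cancel_left₀ (by positivity)]
  rw [key]
  refine contDiff_const.clm_comp (ContDiff.clm_comp ?_ contDiff_const)
  exact (ContinuousMultilinearMap.contDiff _).comp (contDiff_pi.2 fun _ => contDiff_id)

end Smoothness

/-! ### The bundle `⊕_k Λ^{q k} T*M` -/

section FormBundle

variable (n : ℕ) {κ : Type*} [Fintype κ] (q : κ → ℕ)

/-- Model fibre of `⊕_k Λ^{q k} T*M`, where `dim M = n`. -/
abbrev FormModel := ∀ k : κ, EuclideanSpace ℝ (Fin n) [⋀^Fin (q k)]→L[ℝ] ℝ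

variable (M : Type*) [TopologicalSpace M] [ChartedSpace (EuclideanSpace ℝ (Fin n)) M]

variable {M} in
/-- The fibre of `⊕_k Λ^{q k} T*M` over `x`: families of `q k`-forms on `T_x M`. -/
def FormFiber (x : M) : Type _ := ∀ k : κ, TangentSpace (𝓡 n) x [⋀^Fin (q k)]→L[ℝ] ℝ

/-- The total space of `⊕_k Λ^{q k} T*M`. -/
abbrev FormBundle := TotalSpace (FormModel n q) (FormFiber n q : M → Type _)

instance (x : M) : NormedAddCommGroup (FormFiber n q x) :=
  inferInstanceAs (NormedAddCommGroup (FormModel n q))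

instance (x : M) : NormedSpace ℝ (FormFiber n q x) :=
  inferInstanceAs (NormedSpace ℝ (FormModel n q))

/-- Pullback of families of forms under a linear map. -/
def pullModel (L : EuclideanSpace ℝ (Fin n) →L[ℝ] EuclideanSpace ℝ (Fin n)) :
    FormModel n q →L[ℝ] FormModel n q :=
  ContinuousLinearMap.pi fun k =>
    (ContinuousAlternatingMap.compContinuousLinearMapCLM L).comp (ContinuousLinearMap.proj k)

theorem contDiff_pullModel : ContDiff ℝ ∞ (pullModel n q) := by
  classical
  have key : pullModel n q = fun L => ∑ k : κ,
      (ContinuousLinearMap.single ℝ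
        (fun k : κ => EuclideanSpace ℝ (Fin n) [⋀^Fin (q k)]→L[ℝ] ℝ) k).comp
      ((ContinuousAlternatingMap.compContinuousLinearMapCLM L).comp
        (ContinuousLinearMap.proj k)) := by
    funext L
    refine ContinuousLinearMap.ext fun v => funext fun k => ?_
    simp [pullModel, Finset.sum_apply]
  rw [key]
  exact ContDiff.sum fun k _ => contDiff_const.clm_comp
    ((contDiff_compCLM (q k)).clm_comp contDiff_const)

variable [IsManifold (𝓡 n) ∞ M]

/-- The transition functions of `⊕_k Λ^{q k} T*M`: forms are pulled back along the inverse of the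
coordinate change of the tangent bundle. -/
def formBundleCore : VectorBundleCore ℝ M (FormModel n q)
    (atlas (EuclideanSpace ℝ (Fin n)) M) where
  baseSet i := i.1.source
  isOpen_baseSet i := i.1.open_source
  indexAt := achart _
  mem_baseSet_at := mem_chart_source _
  coordChange i j x := pullModel n q ((tangentBundleCore (𝓡 n) M).coordChange j i x)
  coordChange_self i x hx v := by
    funext k
    ext w
    change v k (fun a => (tangentBundleCore (𝓡 n) M).coordChange i i x (w a)) = v k w
    congr 1
    funext a
    exact (tangentBundleCore (𝓡 n) M).coordChange_self i x hx (w a)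
  continuousOn_coordChange i j :=
    (contDiff_pullModel n q).continuous.comp_continuousOn
      (((tangentBundleCore (𝓡 n) M).continuousOn_coordChange j i).mono
        (fun _ hx => ⟨hx.2, hx.1⟩))
  coordChange_comp i j k x hx v := by
    funext a
    ext w
    change v a (fun b => (tangentBundleCore (𝓡 n) M).coordChange j i x
      ((tangentBundleCore (𝓡 n) M).coordChange k j x (w b))) =
      v a (fun b => (tangentBundleCore (𝓡 n) M).coordChange k i x (w b))
    congr 1
    funext b
    exact (tangentBundleCore (𝓡 n) M).coordChange_comp k j i x ⟨⟨hx.2, hx.1.2⟩, hx.1.1⟩ (w b)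

instance : TopologicalSpace (FormBundle n q M) :=
  (formBundleCore n q M).toTopologicalSpace

instance : FiberBundle (FormModel n q) (FormFiber n q : M → Type _) :=
  (formBundleCore n q M).fiberBundle

instance : VectorBundle ℝ (FormModel n q) (FormFiber n q : M → Type _) :=
  (formBundleCore n q M).vectorBundle

instance : (formBundleCore n q M).IsContMDiff (𝓡 n) ∞ := ⟨fun i j => by
  have : IsManifold (𝓡 n) (∞ + 1) M := by simpa
  have : (tangentBundleCore (𝓡 n) M).IsContMDiff (𝓡 n) ∞ := tangentBundleCore.isContMDiff
  have h := (VectorBundleCore.contMDiffOn_coordChange (n := ∞)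
    (tangentBundleCore (𝓡 n) M) (𝓡 n) j i)
  exact (contDiff_pullModel n q).contMDiff.comp_contMDiffOn
    (h.mono (fun _ hx => ⟨hx.2, hx.1⟩))⟩

instance : ContMDiffVectorBundle ∞ (FormModel n q) (FormFiber n q : M → Type _) (𝓡 n) :=
  inferInstanceAs (ContMDiffVectorBundle ∞ (FormModel n q) (formBundleCore n q M).Fiber (𝓡 n))

/-- The model of the manifold `⊕_k Λ^{q k} T*M`. -/
abbrev bundleModel := (𝓡 n).prod 𝓘(ℝ, FormModel n q)

/-! ### Horizontal forms and simple differentiability -/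

variable {n q M}

/-- The projection `⊕_k Λ^{q k} T*M → M`. -/
def proj (P : FormBundle n q M) : M := P.proj

/-- An `M`-horizontal `m`-form on `⊕_k Λ^{q k} T*M` is the same thing as a map to `Λ^m T*M` over
`M`, i.e. a family of `m`-forms on `T_{π P} M` indexed by `P`. -/
abbrev HorizontalForm (n : ℕ) {κ : Type*} [Fintype κ] (q : κ → ℕ) (M : Type*) [TopologicalSpace M]
    [ChartedSpace (EuclideanSpace ℝ (Fin n)) M] (m : ℕ) :=
  (P : FormBundle n q M) → TangentSpace (𝓡 n) P.proj [⋀^Fin m]→L[ℝ] ℝ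

/-- A horizontal form as a differential form on the total space: the value at `P` is pulled back
under the differential of the projection. -/
def HorizontalForm.toForm {m : ℕ} (Q : HorizontalForm n q M m) :
    DForm (bundleModel n q) (FormBundle n q M) m := fun P =>
  (Q P).compContinuousLinearMap (mfderiv (bundleModel n q) (𝓡 n) (proj (n := n) (q := q)) P)

theorem HorizontalForm.toForm_vertical {m : ℕ} (Q : HorizontalForm n q M m)
    (P : FormBundle n q M) (v : Fin m → TangentSpace (bundleModel n q) P) (i : Fin m)
    (hi : mfderiv (bundleModel n q) (𝓡 n) (proj (n := n) (q := q)) P (v i) = 0) :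
    Q.toForm P v = 0 :=
  (Q P).map_coord_zero i hi

/-- The tautological horizontal form, whose value at `P` is the `k`-th component of `P`. -/
def taut (k : κ) : HorizontalForm n q M (q k) := fun P => P.2 k

/-- `i_ξ Q` for a vector field `ξ` on `M` and a horizontal form `Q`. -/
def HorizontalForm.contract {m : ℕ} (ξ : (x : M) → TangentSpace (𝓡 n) x)
    (Q : HorizontalForm n q M m) : HorizontalForm n q M (m - 1) := fun P =>
  DJet.contract (ξ P.proj) (Q P)

/-- The restriction of a horizontal form to the fibre over `x`. -/
def HorizontalForm.onFiber {m : ℕ} (Q : HorizontalForm n q M m) (x : M) (z : FormModel n q) :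
    EuclideanSpace ℝ (Fin n) [⋀^Fin m]→L[ℝ] ℝ :=
  Q ⟨x, z⟩

/-- `Q` is simply differentiable on `U`: at every point of `U`, the vertical variation has the form
`δQ = ∑_k δz^k ∧ L_k` with `(m - q k)`-forms `L_k` at the base point (the left simple derivatives;
the terms with `q k > m` are absent). -/
def HorizontalForm.SimplyDifferentiableOn {m : ℕ} (Q : HorizontalForm n q M m)
    (U : Set (FormBundle n q M)) : Prop :=
  ∀ P ∈ U, DifferentiableAt ℝ (Q.onFiber P.proj) P.2 ∧
    ∃ L : ∀ k : κ, EuclideanSpace ℝ (Fin n) [⋀^Fin (m - q k)]→L[ℝ] ℝ,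
      ∀ δ : FormModel n q,
        fderiv ℝ (Q.onFiber P.proj) P.2 δ = ∑ k : κ, wedge m (δ k) (L k)

end FormBundle

/-! ### The dual of the d-jet bundle and its canonical forms -/

section Phase

variable (n : ℕ) {ι : Type*} [Fintype ι] (q : ι → ℕ)

/-- Degrees of the coordinates `(y^A, p_A, h)` on the dual of the d-jet bundle: `y^A` is a
`q_A`-form, `p_A` is an `(n - q_A - 1)`-form (there is none if `q_A = n`), `h` is an `n`-form. -/
def phaseDeg : ι ⊕ {A : ι // q A < n} ⊕ Unit → ℕ :=
  Sum.elim q (Sum.elim (fun A => n - q A - 1) (fun _ => n))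

variable (M : Type*) [TopologicalSpace M] [ChartedSpace (EuclideanSpace ℝ (Fin n)) M]

/-- The bundle of all `(x, y)`, with `y = (y^A)` a family of `q_A`-forms on `T_x M`. -/
abbrev FieldBundle := FormBundle n q M

/-- The bundle of all `(x, y, p, h)`. -/
abbrev PhaseBundle := FormBundle n (phaseDeg n q) M

variable {n q M}

/-- `(x, y, p, h) ↦ (x, y)`. -/
def toField (P : PhaseBundle n q M) : FieldBundle n q M := ⟨P.proj, fun A => P.2 (Sum.inl A)⟩

/-- The dual of the d-jet bundle of a set `Y` of fields: all `(x, y, p, h)` with `(x, y) ∈ Y`. -/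
def jetDual (Y : Set (FieldBundle n q M)) : Set (PhaseBundle n q M) := toField ⁻¹' Y

variable [IsManifold (𝓡 n) ∞ M]

/-- `Y` is an open subset of `⊕_A Λ^{q_A} T*M` which is a smooth fibre bundle over `M`, with typical
fibre an open subset `S` of the model fibre. -/
def IsGradedBundle (Y : Set (FieldBundle n q M)) : Prop :=
  IsOpen Y ∧ ∃ S : Set (FormModel n q), IsOpen S ∧ ∀ x₀ : M, ∃ W : Set M, IsOpen W ∧ x₀ ∈ W ∧
    ∃ (Φ : FieldBundle n q M → FormModel n q) (Ψ : M × FormModel n q → FieldBundle n q M),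
      ContMDiffOn (bundleModel n q) 𝓘(ℝ, FormModel n q) ∞ Φ (Y ∩ proj ⁻¹' W) ∧
      ContMDiffOn (bundleModel n q) (bundleModel n q) ∞ Ψ (W ×ˢ S) ∧
      (∀ y ∈ Y, proj y ∈ W → Φ y ∈ S ∧ Ψ (proj y, Φ y) = y) ∧
      ∀ z ∈ W ×ˢ S, Ψ z ∈ Y ∧ proj (Ψ z) = z.1 ∧ Φ (Ψ z) = z.2

/-- The horizontal forms `y^A`. -/
def yForm (A : ι) : HorizontalForm n (phaseDeg n q) M (q A) := taut (Sum.inl A)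

/-- The horizontal forms `p_A`. -/
def pForm (A : {A : ι // q A < n}) : HorizontalForm n (phaseDeg n q) M (n - q A - 1) :=
  taut (Sum.inr (Sum.inl A))

/-- The horizontal `n`-form `h`. -/
def hForm : HorizontalForm n (phaseDeg n q) M n := taut (Sum.inr (Sum.inr ()))

variable (n q M)

/-- The Cartan–Poincaré form `θ = (-1)^{n-q_A} p_A ∧ dy^A + h`. -/
def theta : DForm (bundleModel n (phaseDeg n q)) (PhaseBundle n q M) n := fun P =>
  (∑ A : {A : ι // q A < n},
    (-1 : ℝ) ^ (n - q A) • wedge n ((pForm A).toForm P) (extD (yForm A.1).toForm P))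
  + hForm.toForm P

/-- The kinematical multisymplectic form `ω = -dθ`. -/
def omega : DForm (bundleModel n (phaseDeg n q)) (PhaseBundle n q M) (n + 1) := fun P =>
  -extD (theta n q M) P

variable {n q M}

/-- `Q` depends on `(x, y, p)` only. -/
def IndependentOfH {m : ℕ} (Q : HorizontalForm n (phaseDeg n q) M m)
    (U : Set (PhaseBundle n q M)) : Prop :=
  ∀ (x : M) (z z' : FormModel n (phaseDeg n q)),
    (⟨x, z⟩ : PhaseBundle n q M) ∈ U → (⟨x, z'⟩ : PhaseBundle n q M) ∈ U →
    (∀ A, z (Sum.inl A) = z' (Sum.inl A)) →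
    (∀ A, z (Sum.inr (Sum.inl A)) = z' (Sum.inr (Sum.inl A))) →
    Q.onFiber x z = Q.onFiber x z'

end Phase

section Observables

variable {m : ℕ} {ι : Type*} [Fintype ι] {q : ι → ℕ} {M : Type*} [TopologicalSpace M]
  [ChartedSpace (EuclideanSpace ℝ (Fin (m + 2))) M] [IsManifold (𝓡 (m + 2)) ∞ M]

/-- The Noether current
`J(ξ) = (-1)^{n-q_A} i_ξ p_A ∧ dy^A + p_A ∧ d(i_ξ y^A) + i_ξ h` of a vector field `ξ` on `M`, an
`(n-1)`-form, for `n = m + 2`.  A summand with `i_ξ` applied to a `0`-form is zero. -/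
def noether (ξ : (x : M) → TangentSpace (𝓡 (m + 2)) x) :
    DForm (bundleModel (m + 2) (phaseDeg (m + 2) q)) (PhaseBundle (m + 2) q M) (m + 1) := fun P =>
  (∑ A : {A : ι // q A < m + 2},
    ((-1 : ℝ) ^ (m + 2 - q A) •
        wedge (m + 1) (((pForm A).contract ξ).toForm P) (extD (yForm A.1).toForm P)
      + wedge (m + 1) ((pForm A).toForm P) (extD ((yForm A.1).contract ξ).toForm P)))
  + HorizontalForm.toForm (m := m + 1) (hForm.contract ξ) P

/-- Observables on the open set `F`, for `n = m + 2`: smooth `(n-1)`-forms `f` such that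
`i_v ω = df` for some smooth vector field `v`. -/
def IsObservableOn (f : DForm (bundleModel (m + 2) (phaseDeg (m + 2) q))
      (PhaseBundle (m + 2) q M) (m + 1)) (F : Set (PhaseBundle (m + 2) q M)) : Prop :=
  SmoothFormOn f F ∧
  ∃ v : (P : PhaseBundle (m + 2) q M) →
      TangentSpace (bundleModel (m + 2) (phaseDeg (m + 2) q)) P,
    SmoothFieldOn v F ∧ ∀ P ∈ F, interior (v P) (omega (m + 2) q M P) = extD f P

/-- `f = J(ξ) + Q + dα` on the open set `U`, where `ξ` is a smooth vector field on `M`, `Q` is a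
smooth `M`-horizontal simply differentiable `(n-1)`-form on `U` which depends on `(x, y, p)` only,
and `α` is a smooth `(n-2)`-form on `U`. -/
def DecomposesOn (f : DForm (bundleModel (m + 2) (phaseDeg (m + 2) q))
      (PhaseBundle (m + 2) q M) (m + 1)) (U : Set (PhaseBundle (m + 2) q M)) : Prop :=
  ∃ (ξ : (x : M) → TangentSpace (𝓡 (m + 2)) x)
    (Q : HorizontalForm (m + 2) (phaseDeg (m + 2) q) M (m + 1))
    (α : DForm (bundleModel (m + 2) (phaseDeg (m + 2) q)) (PhaseBundle (m + 2) q M) m),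
    SmoothFieldOn ξ univ ∧
    SmoothFormOn Q.toForm U ∧ Q.SimplyDifferentiableOn U ∧ IndependentOfH Q U ∧
    SmoothFormOn α U ∧
    ∀ P ∈ U, f P = noether ξ P + Q.toForm P + extD α P

end Observables

end DJet

end

open Bundle Set
open scoped Manifold ContDiff Topology Nat

noncomputable section

namespace DJet


/-! ### Elementary forms and the wedge product -/

section WedgeAlgebra

variable {V : Type*} [AddCommGroup V] [Module ℝ V] [TopologicalSpace V]

/-! In a bundle chart induced by a chart of `M` the tautological forms are linear coordinates, and ω
is a constant form (`localRep_omega`). Contracting ω with two vertical vectors b, b' leaves the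
horizontal form Σ (p_A(b) ∧ y^A(b') − p_A(b') ∧ y^A(b)), called `pairing`. The decomposition rests
on four facts.

Projectability. From i_v ω = df one gets d(i_v ω) = 0. Because ω is constant, contracting this with
three vertical vectors gives an alternating three-term identity: the vertical derivatives of the
base component of v are contracted with values of the pairing
(`interior_vertical_extDeriv_omegaLoc`). Linear algebra (`eq_zero_of_pairing`) then forces these
derivatives to vanish. Only here does the assumption on the degrees matter. A second field of degree
< n provides a pairing that the given direction does not touch; a single field of degree strictly
between 0 and n − 1 leaves enough room to kill one side of the identity by repeating a covector.
Hence v projects to a field ξ on `M`: after a cut-off in the local case (`exists_field_of_mem`), by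
connectedness of the fibres in the global case (`exists_field_of_preconnected`).

Noether current. The canonical lift of ξ preserves all tautological forms, so Cartan's formula gives
dJ(ξ) = i_ω-contraction with that lift (`extDeriv_noetherLoc`). Therefore d(f − J(ξ)) = i_b ω with b
vertical, a form killed by any two vertical contractions.

Relative Poincaré lemma. Let H contract the fibres. Integrating the dt-component of the pullback
H^*β gives a form α, and β − dα is the integral of the dt-component of H^*dβ plus the pullback under
the end map. If dβ has at most one vertical argument, the first term is horizontal since the
velocity of H uses that argument up; the second is horizontal since the end map is constant on
fibres (`IsFibreContraction.exists_primitive`). Locally H is a contraction of balls. Globally,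
contractible fibres make the typical fibre a contractible open set
(`contractibleSpace_typicalFibre`), its contraction can be smoothed
(`exists_contDiffOn_contraction`), and the momenta are scaled to 0 (`exists_isFibreContraction`).
Gluing local primitives by a partition of unity ρ_i on `M` creates errors dρ_i ∧ α_i. They are not
horizontal, but they have fewer vertical arguments than the original form, so finitely many
repetitions suffice (`exists_primitive_step`, `exists_primitive_of_contraction`).

The remainder. For Q = f − J(ξ) − dα, which is horizontal with dQ = i_b ω, the derivative in a
vertical direction δ is the pairing of b and δ (`fderiv_vertical_of_extDeriv`). This has exactly the
shape required by simple differentiability, and δh does not occur in it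
(`decomposesOn_of_vertFilt`). -/

theorem tensor_wedge_apply {k l m : ℕ} (h : k + l = m) (α : V [⋀^Fin k]→L[ℝ] ℝ)
    (β : V [⋀^Fin l]→L[ℝ] ℝ) (w : Fin m → V) :
    wedge m α β w = ((k ! * l ! : ℕ) : ℝ)⁻¹ * ∑ σ : Equiv.Perm (Fin m),
      (Equiv.Perm.sign σ : ℝ) *
        (α (fun i => w (σ (Fin.cast h (Fin.castAdd l i)))) *
        β (fun j => w (σ (Fin.cast h (Fin.natAdd k j))))) := by
  classical
  rw [wedge, dif_pos h, ContinuousAlternatingMap.smul_apply,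
    ContinuousMultilinearMap.alternatization_apply_apply, smul_eq_mul]
  congr 1
  refine Finset.sum_congr rfl fun σ _ => ?_
  rw [tensor_apply, Units.smul_def, zsmul_eq_mul]
  rfl

theorem wedge_of_ne {k l m : ℕ} (h : k + l ≠ m) (α : V [⋀^Fin k]→L[ℝ] ℝ)
    (β : V [⋀^Fin l]→L[ℝ] ℝ) : wedge m α β = 0 := dif_neg h

theorem wedge_add_left {k l : ℕ} (m : ℕ) (α α' : V [⋀^Fin k]→L[ℝ] ℝ)
    (β : V [⋀^Fin l]→L[ℝ] ℝ) : wedge m (α + α') β = wedge m α β + wedge m α' β := by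
  by_cases h : k + l = m
  · ext w
    simp only [ContinuousAlternatingMap.add_apply, tensor_wedge_apply h, add_mul, mul_add,
      Finset.sum_add_distrib]
  · simp [wedge_of_ne h]

theorem wedge_smul_left {k l : ℕ} (m : ℕ) (c : ℝ) (α : V [⋀^Fin k]→L[ℝ] ℝ)
    (β : V [⋀^Fin l]→L[ℝ] ℝ) : wedge m (c • α) β = c • wedge m α β := by
  by_cases h : k + l = m
  · ext w
    simp only [ContinuousAlternatingMap.smul_apply, tensor_wedge_apply h, smul_eq_mul,
      Finset.mul_sum]
    exact Finset.sum_congr rfl fun σ _ => by ring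
  · simp [wedge_of_ne h]

theorem wedge_add_right {k l : ℕ} (m : ℕ) (α : V [⋀^Fin k]→L[ℝ] ℝ)
    (β β' : V [⋀^Fin l]→L[ℝ] ℝ) : wedge m α (β + β') = wedge m α β + wedge m α β' := by
  by_cases h : k + l = m
  · ext w
    simp only [ContinuousAlternatingMap.add_apply, tensor_wedge_apply h, mul_add,
      Finset.sum_add_distrib]
  · simp [wedge_of_ne h]

theorem wedge_smul_right {k l : ℕ} (m : ℕ) (c : ℝ) (α : V [⋀^Fin k]→L[ℝ] ℝ)
    (β : V [⋀^Fin l]→L[ℝ] ℝ) : wedge m α (c • β) = c • wedge m α β := by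
  by_cases h : k + l = m
  · ext w
    simp only [ContinuousAlternatingMap.smul_apply, tensor_wedge_apply h, smul_eq_mul,
      Finset.mul_sum]
    exact Finset.sum_congr rfl fun σ _ => by ring
  · simp [wedge_of_ne h]

/-- The wedge product as a bilinear map. -/
def wedgeₗ (V : Type*) [AddCommGroup V] [Module ℝ V] [TopologicalSpace V] (k l m : ℕ) :
    (V [⋀^Fin k]→L[ℝ] ℝ) →ₗ[ℝ] (V [⋀^Fin l]→L[ℝ] ℝ) →ₗ[ℝ] (V [⋀^Fin m]→L[ℝ] ℝ) :=
  LinearMap.mk₂ ℝ (wedge m) (wedge_add_left m) (wedge_smul_left m) (wedge_add_right m)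
    (wedge_smul_right m)

@[simp] theorem wedgeₗ_apply {k l m : ℕ} (α : V [⋀^Fin k]→L[ℝ] ℝ) (β : V [⋀^Fin l]→L[ℝ] ℝ) :
    wedgeₗ V k l m α β = wedge m α β := rfl

theorem wedge_zero_left {k l : ℕ} (m : ℕ) (β : V [⋀^Fin l]→L[ℝ] ℝ) :
    wedge m (0 : V [⋀^Fin k]→L[ℝ] ℝ) β = 0 := by
  rw [← wedgeₗ_apply, map_zero, LinearMap.zero_apply]

theorem wedge_zero_right {k l : ℕ} (m : ℕ) (α : V [⋀^Fin k]→L[ℝ] ℝ) :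
    wedge m α (0 : V [⋀^Fin l]→L[ℝ] ℝ) = 0 := by
  rw [← wedgeₗ_apply, map_zero]

theorem wedge_neg_left {k l : ℕ} (m : ℕ) (α : V [⋀^Fin k]→L[ℝ] ℝ) (β : V [⋀^Fin l]→L[ℝ] ℝ) :
    wedge m (-α) β = -wedge m α β := by
  rw [← wedgeₗ_apply, map_neg, LinearMap.neg_apply, wedgeₗ_apply]

theorem wedge_neg_right {k l : ℕ} (m : ℕ) (α : V [⋀^Fin k]→L[ℝ] ℝ) (β : V [⋀^Fin l]→L[ℝ] ℝ) :
    wedge m α (-β) = -wedge m α β := by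
  rw [← wedgeₗ_apply, map_neg, wedgeₗ_apply]

theorem wedge_comp {V' : Type*} [AddCommGroup V'] [Module ℝ V'] [TopologicalSpace V'] {k l : ℕ}
    (m : ℕ) (α : V [⋀^Fin k]→L[ℝ] ℝ) (β : V [⋀^Fin l]→L[ℝ] ℝ) (L : V' →L[ℝ] V) :
    (wedge m α β).compContinuousLinearMap L =
      wedge m (α.compContinuousLinearMap L) (β.compContinuousLinearMap L) := by
  by_cases h : k + l = m
  · ext w
    rw [ContinuousAlternatingMap.compContinuousLinearMap_apply, tensor_wedge_apply h,
      tensor_wedge_apply h]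
    rfl
  · simp [wedge_of_ne h]; rfl

/-- Up to a sign the wedge product is commutative. -/
theorem exists_wedge_comm (k l m : ℕ) : ∃ c : ℝ, ∀ (α : V [⋀^Fin k]→L[ℝ] ℝ)
    (β : V [⋀^Fin l]→L[ℝ] ℝ), wedge m α β = c • wedge m β α := by
  by_cases h : k + l = m
  · have h' : l + k = m := by omega
    -- τ exchanges the two blocks of arguments; reindexing by σ ↦ στ turns one sum into the other,
    -- and the constant is the sign of τ.
    let τ : Equiv.Perm (Fin m) := (finCongr h').symm.trans ((finAddFlip).trans (finCongr h))
    refine ⟨((Equiv.Perm.sign τ : ℤ) : ℝ), fun α β => ?_⟩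
    have hs : ((Equiv.Perm.sign τ : ℤ) : ℝ) * ((Equiv.Perm.sign τ : ℤ) : ℝ) = 1 := by
      rcases Int.units_eq_one_or (Equiv.Perm.sign τ) with h | h <;> simp [h]
    have h1 : ∀ i : Fin l, τ (Fin.cast h' (Fin.castAdd k i)) = Fin.cast h (Fin.natAdd k i) := by
      intro i; simp [τ]
    have h2 : ∀ i : Fin k, τ (Fin.cast h' (Fin.natAdd l i)) = Fin.cast h (Fin.castAdd l i) := by
      intro i; simp [τ]
    ext w
    rw [ContinuousAlternatingMap.smul_apply, tensor_wedge_apply h, tensor_wedge_apply h',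
      smul_eq_mul, mul_left_comm, mul_comm (k !)]
    congr 1
    rw [Finset.mul_sum]
    refine Eq.trans ?_ (Equiv.sum_comp (Equiv.mulRight τ) _)
    refine Finset.sum_congr rfl fun σ _ => ?_
    simp only [Equiv.coe_mulRight, Equiv.Perm.sign_mul, Units.val_mul, Int.cast_mul,
      Equiv.Perm.coe_mul, Function.comp_apply, h1, h2]
    linear_combination (-((Equiv.Perm.sign σ : ℤ) : ℝ) *
      (α fun i => w (σ (Fin.cast h (Fin.castAdd l i)))) *
      (β fun i => w (σ (Fin.cast h (Fin.natAdd k i))))) * hs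
  · exact ⟨0, fun α β => by simp [wedge_of_ne h]⟩

/-- The wedge product of `k` covectors. -/
def elem {k : ℕ} (a : Fin k → V →L[ℝ] ℝ) : V [⋀^Fin k]→L[ℝ] ℝ :=
  ContinuousMultilinearMap.alternatization
    ((ContinuousMultilinearMap.mkPiAlgebra ℝ (Fin k) ℝ).compContinuousLinearMap a)

theorem elem_apply_sum {k : ℕ} (a : Fin k → V →L[ℝ] ℝ) (w : Fin k → V) :
    elem a w = ∑ σ : Equiv.Perm (Fin k), ((Equiv.Perm.sign σ : ℤ) : ℝ) * ∏ i, a i (w (σ i)) := by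
  rw [elem, ContinuousMultilinearMap.alternatization_apply_apply]
  refine Finset.sum_congr rfl fun σ _ => ?_
  rw [Units.smul_def, zsmul_eq_mul]
  rfl

theorem elem_apply {k : ℕ} (a : Fin k → V →L[ℝ] ℝ) (w : Fin k → V) :
    elem a w = (Matrix.of fun i j => a i (w j)).det := by
  rw [← Matrix.det_transpose, Matrix.det_apply, elem,
    ContinuousMultilinearMap.alternatization_apply_apply]
  rfl

theorem elem_eq_zero {k : ℕ} (a : Fin k → V →L[ℝ] ℝ) {i j : Fin k} (hij : i ≠ j)
    (h : a i = a j) : elem a = 0 := by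
  ext w
  rw [elem_apply, Matrix.det_zero_of_row_eq hij]
  · rfl
  · ext t; simp [h]

theorem elem_insertNth {k : ℕ} (p : Fin (k + 1)) (c : V →L[ℝ] ℝ) (a : Fin k → V →L[ℝ] ℝ) :
    elem (p.insertNth c a : Fin (k + 1) → V →L[ℝ] ℝ) = (-1 : ℝ) ^ (p : ℕ) • elem (Fin.cons c a) := by
  ext w
  rw [ContinuousAlternatingMap.smul_apply, elem_apply, elem_apply]
  have := (Matrix.detRowAlternating (R := ℝ) (n := Fin (k + 1))).map_insertNth p
    (fun j => c (w j)) (fun i j => a i (w j))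
  have e1 : (Matrix.of fun i j => (p.insertNth c a : Fin (k + 1) → V →L[ℝ] ℝ) i (w j)) =
      p.insertNth (α := fun _ => Fin (k + 1) → ℝ) (fun j => c (w j)) (fun i j => a i (w j)) := by
    ext i j
    cases i using p.succAboveCases <;> simp
  have e2 : (Matrix.of fun i j => (Fin.cons c a : Fin (k + 1) → V →L[ℝ] ℝ) i (w j)) =
      Matrix.vecCons (fun j => c (w j)) (fun i j => a i (w j)) := by
    ext i j
    cases i using Fin.cases <;> simp
  rw [e1, e2]
  rw [zsmul_eq_mul] at this
  push_cast at this
  exact this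

/-- After both factors are expanded, the inner permutations τ, ρ can be absorbed into the outer one.
All k! l! pairs then contribute equally, which is what the normalisation divides out. -/
theorem wedge_elem {k l : ℕ} (a : Fin k → V →L[ℝ] ℝ) (b : Fin l → V →L[ℝ] ℝ) :
    wedge (k + l) (elem a) (elem b) = elem (Fin.append a b) := by
  ext w
  have hc : ((k ! * l ! : ℕ) : ℝ) ≠ 0 := by positivity
  rw [tensor_wedge_apply rfl, inv_mul_eq_iff_eq_mul₀ hc]
  have key : ∀ (τ : Equiv.Perm (Fin k)) (ρ : Equiv.Perm (Fin l)),
      ∑ σ : Equiv.Perm (Fin (k + l)), ((Equiv.Perm.sign σ : ℤ) : ℝ) *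
        ((((Equiv.Perm.sign τ : ℤ) : ℝ) * ∏ i, a i (w (σ (Fin.castAdd l (τ i))))) *
        (((Equiv.Perm.sign ρ : ℤ) : ℝ) * ∏ i, b i (w (σ (Fin.natAdd k (ρ i)))))) =
      elem (Fin.append a b) w := by
    intro τ ρ
    let θ : Equiv.Perm (Fin (k + l)) := finSumFinEquiv.permCongr (Equiv.Perm.sumCongr τ ρ)
    rw [elem_apply_sum]
    refine Eq.trans ?_ (Equiv.sum_comp (Equiv.mulRight θ) _)
    refine Finset.sum_congr rfl fun σ _ => ?_
    have h1 : ∀ i, θ (Fin.castAdd l i) = Fin.castAdd l (τ i) := by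
      intro i; simp [θ, Equiv.permCongr_apply]
    have h2 : ∀ i, θ (Fin.natAdd k i) = Fin.natAdd k (ρ i) := by
      intro i; simp [θ, Equiv.permCongr_apply]
    have h3 : Equiv.Perm.sign θ = Equiv.Perm.sign τ * Equiv.Perm.sign ρ := by
      rw [Equiv.Perm.sign_permCongr, Equiv.Perm.sign_sumCongr]
    simp only [Equiv.coe_mulRight, Equiv.Perm.sign_mul, Units.val_mul, Int.cast_mul,
      Equiv.Perm.coe_mul, Function.comp_apply, h3, Fin.prod_univ_add, Fin.append_left,
      Fin.append_right, h1, h2]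
    ring
  have e0 : ∀ σ ∈ (Finset.univ : Finset (Equiv.Perm (Fin (k + l)))),
      ((Equiv.Perm.sign σ : ℤ) : ℝ) * (elem a (fun i => w (σ (Fin.castAdd l i))) *
        elem b (fun j => w (σ (Fin.natAdd k j)))) = ∑ τ : Equiv.Perm (Fin k),
      ∑ ρ : Equiv.Perm (Fin l), ((Equiv.Perm.sign σ : ℤ) : ℝ) *
        ((((Equiv.Perm.sign τ : ℤ) : ℝ) * ∏ i, a i (w (σ (Fin.castAdd l (τ i))))) *
        (((Equiv.Perm.sign ρ : ℤ) : ℝ) * ∏ i, b i (w (σ (Fin.natAdd k (ρ i)))))) := by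
    intro σ _
    rw [elem_apply_sum, elem_apply_sum, Finset.sum_mul_sum, Finset.mul_sum]
    exact Finset.sum_congr rfl fun τ _ => Finset.mul_sum _ _ _
  simp only [Fin.cast_eq_self]
  rw [Finset.sum_congr rfl e0, Finset.sum_comm]
  have e : ∀ τ ∈ (Finset.univ : Finset (Equiv.Perm (Fin k))),
      ∑ σ : Equiv.Perm (Fin (k + l)), ∑ ρ : Equiv.Perm (Fin l), ((Equiv.Perm.sign σ : ℤ) : ℝ) *
        ((((Equiv.Perm.sign τ : ℤ) : ℝ) * ∏ i, a i (w (σ (Fin.castAdd l (τ i))))) *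
        (((Equiv.Perm.sign ρ : ℤ) : ℝ) * ∏ i, b i (w (σ (Fin.natAdd k (ρ i)))))) =
      (l ! : ℝ) * elem (Fin.append a b) w := by
    intro τ _
    rw [Finset.sum_comm, Finset.sum_congr rfl fun ρ _ => key τ ρ]
    simp [Fintype.card_perm]
  rw [Finset.sum_congr rfl e]
  simp [Fintype.card_perm, mul_assoc]

/-- The elementary forms in the coordinate covectors of a basis span. -/
theorem span_elem_basis {κ : Type*} [Fintype κ] (b : Module.Basis κ ℝ V) (c : κ → V →L[ℝ] ℝ)
    (hc : ∀ i v, c i v = b.repr v i) {k : ℕ} (α : V [⋀^Fin k]→L[ℝ] ℝ) :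
    α ∈ Submodule.span ℝ (Set.range fun I : Fin k → κ => elem fun i => c (I i)) := by
  classical
  -- The sum runs over all multi-indices, ordered or not. Expanding α in the basis gives one copy of
  -- α for each permutation, hence the factor 1 / k!.
  have key : α = (k ! : ℝ)⁻¹ • ∑ I : Fin k → κ,
      α (fun i => b (I i)) • elem (fun i => c (I i)) := by
    ext w
    rw [ContinuousAlternatingMap.smul_apply, smul_eq_mul, eq_inv_mul_iff_mul_eq₀ (by positivity),
      ContinuousAlternatingMap.sum_apply]
    simp only [ContinuousAlternatingMap.smul_apply, elem_apply_sum, smul_eq_mul, Finset.mul_sum]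
    rw [Finset.sum_comm]
    have e : ∀ σ ∈ (Finset.univ : Finset (Equiv.Perm (Fin k))),
        ∑ I : Fin k → κ, α (fun i => b (I i)) *
          (((Equiv.Perm.sign σ : ℤ) : ℝ) * ∏ i, c (I i) (w (σ i))) = α w := by
      intro σ _
      have h1 : α (fun i => w (σ i)) = ((Equiv.Perm.sign σ : ℤ) : ℝ) * α w := by
        have := α.toAlternatingMap.map_perm w σ
        rw [Units.smul_def, zsmul_eq_mul] at this
        exact this
      have h2 : α (fun i => w (σ i)) = ∑ I : Fin k → κ,
          (∏ i, c (I i) (w (σ i))) * α (fun i => b (I i)) := by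
        have h3 : (fun i => w (σ i)) = fun i => ∑ j, (c j (w (σ i))) • b j := by
          funext i
          simp only [hc]
          exact (b.sum_repr (w (σ i))).symm
        conv_lhs => rw [h3]
        have := α.toMultilinearMap.map_sum (fun i j => (c j (w (σ i))) • b j)
        refine this.trans (Finset.sum_congr rfl fun I _ => ?_)
        exact (α.toMultilinearMap.map_smul_univ (fun i => c (I i) (w (σ i))) (fun i => b (I i)))
      have hs : ((Equiv.Perm.sign σ : ℤ) : ℝ) * ((Equiv.Perm.sign σ : ℤ) : ℝ) = 1 := by
        rcases Int.units_eq_one_or (Equiv.Perm.sign σ) with h | h <;> simp [h]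
      calc _ = ((Equiv.Perm.sign σ : ℤ) : ℝ) * α (fun i => w (σ i)) := by
            rw [h2, Finset.mul_sum]
            exact Finset.sum_congr rfl fun I _ => by ring
        _ = α w := by rw [h1, ← mul_assoc, hs, one_mul]
    rw [Finset.sum_congr rfl e]
    simp [Fintype.card_perm]
  rw [key]
  exact Submodule.smul_mem _ _ (Submodule.sum_mem _ fun I _ =>
    Submodule.smul_mem _ _ (Submodule.subset_span ⟨_, rfl⟩))

/-- The elementary forms span. -/
theorem span_elem [FiniteDimensional ℝ V] [IsTopologicalAddGroup V] [ContinuousSMul ℝ V] [T2Space V]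
    {k : ℕ} (α : V [⋀^Fin k]→L[ℝ] ℝ) :
    α ∈ Submodule.span ℝ (Set.range (elem : (Fin k → V →L[ℝ] ℝ) → _)) := by
  refine Submodule.span_mono ?_ (span_elem_basis (Module.finBasis ℝ V)
    (fun i => LinearMap.toContinuousLinearMap ((Module.finBasis ℝ V).coord i)) (fun _ _ => rfl) α)
  rintro _ ⟨I, rfl⟩
  exact ⟨_, rfl⟩

end WedgeAlgebra

/-! ### Antiderivation rules for the interior product and the exterior derivative. -/

section Leibniz

variable {V : Type*} [NormedAddCommGroup V] [NormedSpace ℝ V]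

instance [FiniteDimensional ℝ V] (k : ℕ) : FiniteDimensional ℝ (V [⋀^Fin k]→L[ℝ] ℝ) := by
  let T : (V [⋀^Fin k]→L[ℝ] ℝ) →ₗ[ℝ] MultilinearMap ℝ (fun _ : Fin k => V) ℝ :=
    { toFun := fun f => f.toMultilinearMap
      map_add' := fun _ _ => rfl
      map_smul' := fun _ _ => rfl }
  exact FiniteDimensional.of_injective T fun f g h => by
    ext w
    exact congrArg (fun F : MultilinearMap ℝ (fun _ : Fin k => V) ℝ => F w) h

/-- `i_v` as a linear map. -/
def contractₗ (v : V) (k : ℕ) : (V [⋀^Fin k]→L[ℝ] ℝ) →ₗ[ℝ] (V [⋀^Fin (k - 1)]→L[ℝ] ℝ) where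
  toFun := contract v
  map_add' := fun α β => by
    cases k
    · exact (add_zero _).symm
    · rfl
  map_smul' := fun c α => by
    cases k
    · exact (smul_zero _).symm
    · rfl

open ContinuousAlternatingMap (alternatizeUncurryFin alternatizeUncurryFinCLM)

/-- The wedge product of a covector and a form, as a linear map of the form. -/
def covWedge {k : ℕ} (c : V →L[ℝ] ℝ) : (V [⋀^Fin k]→L[ℝ] ℝ) →ₗ[ℝ] (V [⋀^Fin (k + 1)]→L[ℝ] ℝ) :=
  (alternatizeUncurryFinCLM ℝ V ℝ).toLinearMap ∘ₗ
    (ContinuousLinearMap.smulRightL ℝ V (V [⋀^Fin k]→L[ℝ] ℝ) c).toLinearMap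

theorem covWedge_apply {k : ℕ} (c : V →L[ℝ] ℝ) (α : V [⋀^Fin k]→L[ℝ] ℝ) :
    covWedge c α = alternatizeUncurryFin (c.smulRight α) := rfl

/-- Laplace expansion of the determinant along the row of c. -/
theorem covWedge_elem {k : ℕ} (c : V →L[ℝ] ℝ) (a : Fin k → V →L[ℝ] ℝ) :
    covWedge c (elem a) = elem (Fin.cons c a) := by
  ext w
  rw [covWedge_apply, ContinuousAlternatingMap.alternatizeUncurryFin_apply, elem_apply, Matrix.det_succ_row_zero]
  refine Finset.sum_congr rfl fun i _ => ?_
  rw [ContinuousLinearMap.smulRight_apply, ContinuousAlternatingMap.smul_apply, elem_apply]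
  simp only [zsmul_eq_mul, smul_eq_mul, Matrix.of_apply, Fin.cons_zero]
  push_cast
  rw [mul_assoc]
  congr 2

/-- Laplace expansion along the first column, which holds the values on u. -/
theorem interior_elem {k : ℕ} (u : V) (a : Fin (k + 1) → V →L[ℝ] ℝ) :
    interior u (elem a) = ∑ i : Fin (k + 1), ((-1 : ℝ) ^ (i : ℕ) * a i u) • elem (i.removeNth a) := by
  ext w
  rw [interior_apply, elem_apply, Matrix.det_succ_column_zero, ContinuousAlternatingMap.sum_apply]
  refine Finset.sum_congr rfl fun i _ => ?_
  rw [ContinuousAlternatingMap.smul_apply, elem_apply]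
  rfl

theorem wedge_elem' {k l m : ℕ} (h : k + l = m) (a : Fin k → V →L[ℝ] ℝ) (b : Fin l → V →L[ℝ] ℝ) :
    wedge m (elem a) (elem b) = elem (fun i => Fin.append a b (Fin.cast h.symm i)) := by
  subst h
  exact wedge_elem a b

theorem append_eq_dite {X : Type*} {k l : ℕ} (a : Fin k → X) (b : Fin l → X) (i : Fin (k + l)) :
    Fin.append a b i = if h : (i : ℕ) < k then a ⟨i, h⟩ else b ⟨i - k, by omega⟩ := by
  induction i using Fin.addCases <;> simp

/-- The covector evaluated on u comes either from a or from b. Cutting the sum of `interior_elem`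
after k terms gives the two summands, with sign exponents shifted by k in the second. -/
theorem contract_wedge_elem {k l m : ℕ} (h : k + l = m + 1) (u : V) (a : Fin k → V →L[ℝ] ℝ)
    (b : Fin l → V →L[ℝ] ℝ) :
    interior u (wedge (m + 1) (elem a) (elem b)) = wedge m (contract u (elem a)) (elem b) +
      (-1 : ℝ) ^ k • wedge m (elem a) (contract u (elem b)) := by
  rw [wedge_elem' h, interior_elem, ← Equiv.sum_comp (finCongr h), Fin.sum_univ_add]
  congr 1
  · cases k with
    | zero =>
      simp only [Finset.univ_eq_empty, Finset.sum_empty]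
      exact (wedge_zero_left _ _).symm
    | succ k =>
      change _ = wedge m (interior u (elem a)) (elem b)
      rw [interior_elem, ← wedgeₗ_apply, map_sum, LinearMap.sum_apply]
      refine Finset.sum_congr rfl fun i _ => ?_
      rw [map_smul, LinearMap.smul_apply, wedgeₗ_apply, wedge_elem' (by omega : k + l = m)]
      simp only [finCongr_apply, Fin.val_cast, Fin.val_castAdd, Fin.cast_cast, Fin.cast_eq_self,
        Fin.append_left]
      congr 2
      funext j
      simp only [Fin.removeNth, append_eq_dite, Fin.succAbove, Fin.lt_def, Fin.val_cast,
        Fin.val_castAdd, Fin.val_castSucc, apply_ite Fin.val, Fin.val_succ]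
      have := i.2
      repeat' split
      all_goals first
        | omega
        | (refine congrArg _ (Fin.ext ?_); simp)
  · cases l with
    | zero =>
      simp only [Finset.univ_eq_empty, Finset.sum_empty]
      change _ = (-1 : ℝ) ^ k • wedge m (elem a) 0
      rw [wedge_zero_right, smul_zero]
    | succ l =>
      change _ = (-1 : ℝ) ^ k • wedge m (elem a) (interior u (elem b))
      rw [interior_elem, ← wedgeₗ_apply, map_sum, Finset.smul_sum]
      refine Finset.sum_congr rfl fun i _ => ?_
      rw [map_smul, wedgeₗ_apply, wedge_elem' (by omega : k + l = m), smul_smul]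
      simp only [finCongr_apply, Fin.val_cast, Fin.val_natAdd, Fin.cast_cast, Fin.cast_eq_self,
        Fin.append_right, pow_add, mul_assoc]
      congr 2
      funext j
      simp only [Fin.removeNth, append_eq_dite, Fin.succAbove, Fin.lt_def, Fin.val_cast,
        Fin.val_natAdd, Fin.val_castSucc, apply_ite Fin.val, Fin.val_succ]
      have := i.2
      repeat' split
      all_goals first
        | omega
        | (refine congrArg _ (Fin.ext ?_); simp <;> omega)

theorem covWedge_wedge_elem_left {k l m : ℕ} (h : k + l = m) (c : V →L[ℝ] ℝ)
    (a : Fin k → V →L[ℝ] ℝ) (b : Fin l → V →L[ℝ] ℝ) :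
    covWedge c (wedge m (elem a) (elem b)) =
      wedge (m + 1) (elem (Fin.cons c a : Fin (k + 1) → V →L[ℝ] ℝ)) (elem b) := by
  rw [wedge_elem' h, covWedge_elem, wedge_elem' (by omega)]
  congr 1
  funext j
  cases j using Fin.cases with
  | zero => simp [append_eq_dite]
  | succ j =>
    simp only [Fin.cons_succ, append_eq_dite, Fin.val_cast, Fin.val_succ]
    split_ifs <;> first | omega | rfl | (congr 1; apply Fin.ext; simp)

/-- Here c has to pass the k factors of a: it is inserted at position k of the concatenated family,
and `elem_insertNth` supplies the sign. -/
theorem covWedge_wedge_elem_right {k l m : ℕ} (h : k + l = m) (c : V →L[ℝ] ℝ)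
    (a : Fin k → V →L[ℝ] ℝ) (b : Fin l → V →L[ℝ] ℝ) :
    covWedge c (wedge m (elem a) (elem b)) =
      (-1 : ℝ) ^ k • wedge (m + 1) (elem a) (elem (Fin.cons c b : Fin (l + 1) → V →L[ℝ] ℝ)) := by
  have e := elem_insertNth (⟨k, by omega⟩ : Fin (m + 1)) c
    (fun i => Fin.append a b (Fin.cast h.symm i))
  rw [wedge_elem' h, covWedge_elem, wedge_elem' (by omega)]
  have e2 : (fun i => Fin.append a (Fin.cons c b : Fin (l + 1) → V →L[ℝ] ℝ)
      (Fin.cast (by omega : m + 1 = k + (l + 1)) i)) =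
      (⟨k, by omega⟩ : Fin (m + 1)).insertNth c (fun i => Fin.append a b (Fin.cast h.symm i)) := by
    symm
    rw [Fin.insertNth_eq_iff]
    refine ⟨by simp [append_eq_dite], ?_⟩
    funext j
    simp only [Fin.removeNth, append_eq_dite, Fin.val_cast, Fin.succAbove, Fin.lt_def,
      Fin.val_castSucc]
    split_ifs with h1 h2 h2
    · rfl
    · simp at h2; omega
    · simp at h2; omega
    · have e3 : (⟨((Fin.succ j : Fin (m + 1)) : ℕ) - k, by simp; omega⟩ : Fin (l + 1)) =
          Fin.succ ⟨(j : ℕ) - k, by omega⟩ := by ext; simp; omega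
      rw [e3, Fin.cons_succ]
  rw [e2, e, smul_smul, ← mul_pow]
  simp

variable [FiniteDimensional ℝ V]

/-- `α ↦ α ∧ β` as a continuous linear map. -/
def wedgeRight {k l : ℕ} (m : ℕ) (β : V [⋀^Fin l]→L[ℝ] ℝ) :
    (V [⋀^Fin k]→L[ℝ] ℝ) →L[ℝ] (V [⋀^Fin m]→L[ℝ] ℝ) :=
  LinearMap.toContinuousLinearMap ((wedgeₗ V k l m).flip β)

/-- The wedge product as a continuous bilinear map. -/
def wedgeL (k l m : ℕ) : (V [⋀^Fin k]→L[ℝ] ℝ) →L[ℝ] (V [⋀^Fin l]→L[ℝ] ℝ) →L[ℝ]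
    (V [⋀^Fin m]→L[ℝ] ℝ) :=
  LinearMap.toContinuousLinearMap ((LinearMap.toContinuousLinearMap
    (E := (V [⋀^Fin l]→L[ℝ] ℝ)) (F' := (V [⋀^Fin m]→L[ℝ] ℝ))).toLinearMap ∘ₗ wedgeₗ V k l m)

@[simp] theorem wedgeRight_apply {k l : ℕ} (m : ℕ) (α : V [⋀^Fin k]→L[ℝ] ℝ)
    (β : V [⋀^Fin l]→L[ℝ] ℝ) : wedgeRight m β α = wedge m α β := rfl

@[simp] theorem wedgeL_apply {k l : ℕ} (m : ℕ) (α : V [⋀^Fin k]→L[ℝ] ℝ)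
    (β : V [⋀^Fin l]→L[ℝ] ℝ) : wedgeL k l m α β = wedge m α β := rfl

/-- Elementary forms span, so bilinear identities between forms reduce to statements about
determinants. -/
theorem ext_elem {k l : ℕ} {W : Type*} [AddCommGroup W] [Module ℝ W]
    {f g : (V [⋀^Fin k]→L[ℝ] ℝ) →ₗ[ℝ] (V [⋀^Fin l]→L[ℝ] ℝ) →ₗ[ℝ] W}
    (h : ∀ a b, f (elem a) (elem b) = g (elem a) (elem b)) : f = g := by
  have hs : ∀ k, Submodule.span ℝ (Set.range (elem : (Fin k → V →L[ℝ] ℝ) → _)) = ⊤ :=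
    fun k => eq_top_iff.2 fun α _ => span_elem α
  refine LinearMap.ext_on (hs k) ?_
  rintro _ ⟨a, rfl⟩
  refine LinearMap.ext_on (hs l) ?_
  rintro _ ⟨b, rfl⟩
  exact h a b

/-- In finite dimension every linear map is a sum of rank-one maps. For those, alternatization is
exterior multiplication by a covector, so identities for `covWedge` pass to `alternatizeUncurryFin`.
-/
theorem clm_induction {W : Type*} [NormedAddCommGroup W] [NormedSpace ℝ W]
    {p : (V →L[ℝ] W) → Prop} (he : ∀ (c : V →L[ℝ] ℝ) (w : W), p (c.smulRight w)) (h0 : p 0)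
    (hadd : ∀ A B, p A → p B → p (A + B)) (A : V →L[ℝ] W) : p A := by
  classical
  let b := Module.finBasis ℝ V
  have key : A = ∑ i, (LinearMap.toContinuousLinearMap (b.coord i)).smulRight (A (b i)) := by
    ext v
    conv_lhs => rw [← b.sum_repr v]
    simp only [map_sum, map_smul, sum_apply, ContinuousLinearMap.smulRight_apply]
    rfl
  rw [key]
  exact Finset.sum_induction _ p hadd h0 fun i _ => he _ _

/-- The antiderivation property of the interior product. -/
theorem interior_wedge {k l : ℕ} (m : ℕ) (u : V) (α : V [⋀^Fin k]→L[ℝ] ℝ)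
    (β : V [⋀^Fin l]→L[ℝ] ℝ) :
    interior u (wedge (m + 1) α β) = wedge m (contract u α) β +
      (-1 : ℝ) ^ k • wedge m α (contract u β) := by
  by_cases h : k + l = m + 1
  · have := ext_elem (f := (wedgeₗ V k l (m + 1)).compr₂ (contractₗ u (m + 1)))
      (g := (wedgeₗ V (k - 1) l m).comp (contractₗ u k) +
        (-1 : ℝ) ^ k • (wedgeₗ V k (l - 1) m).compl₂ (contractₗ u l))
      fun a b => contract_wedge_elem h u a b
    exact LinearMap.congr_fun₂ this α β
  · have h1 : wedge m α (contract u β) = 0 := by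
      cases l
      · exact wedge_zero_right _ _
      · exact wedge_of_ne (by omega) _ _
    have h2 : wedge m (contract u α) β = 0 := by
      cases k
      · exact wedge_zero_left _ _
      · exact wedge_of_ne (by omega) _ _
    rw [wedge_of_ne h, h1, h2, smul_zero, add_zero]
    rfl

theorem covWedge_wedge_left {k l : ℕ} (m : ℕ) (c : V →L[ℝ] ℝ) (α : V [⋀^Fin k]→L[ℝ] ℝ)
    (β : V [⋀^Fin l]→L[ℝ] ℝ) :
    covWedge c (wedge m α β) = wedge (m + 1) (covWedge c α) β := by
  by_cases h : k + l = m
  · have := ext_elem (f := (wedgeₗ V k l m).compr₂ (covWedge c))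
      (g := (wedgeₗ V (k + 1) l (m + 1)).comp (covWedge c)) fun a b => by
        refine (covWedge_wedge_elem_left h c a b).trans ?_
        rw [← covWedge_elem]
        rfl
    exact LinearMap.congr_fun₂ this α β
  · rw [wedge_of_ne h, wedge_of_ne (by omega), map_zero]

theorem covWedge_wedge_right {k l : ℕ} (m : ℕ) (c : V →L[ℝ] ℝ) (α : V [⋀^Fin k]→L[ℝ] ℝ)
    (β : V [⋀^Fin l]→L[ℝ] ℝ) :
    covWedge c (wedge m α β) = (-1 : ℝ) ^ k • wedge (m + 1) α (covWedge c β) := by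
  by_cases h : k + l = m
  · have := ext_elem (f := (wedgeₗ V k l m).compr₂ (covWedge c))
      (g := (-1 : ℝ) ^ k • (wedgeₗ V k (l + 1) (m + 1)).compl₂ (covWedge c)) fun a b => by
        refine (covWedge_wedge_elem_right h c a b).trans ?_
        rw [← covWedge_elem]
        rfl
    exact LinearMap.congr_fun₂ this α β
  · rw [wedge_of_ne h, wedge_of_ne (by omega), map_zero, smul_zero]

theorem alternatizeUncurryFin_wedge_left {k l : ℕ} (m : ℕ) (A : V →L[ℝ] V [⋀^Fin k]→L[ℝ] ℝ)
    (β : V [⋀^Fin l]→L[ℝ] ℝ) :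
    alternatizeUncurryFin ((wedgeRight m β).comp A) = wedge (m + 1) (alternatizeUncurryFin A) β := by
  induction A using clm_induction with
  | h0 =>
    rw [ContinuousLinearMap.comp_zero, ← ContinuousAlternatingMap.alternatizeUncurryFinCLM_apply,
      ← ContinuousAlternatingMap.alternatizeUncurryFinCLM_apply, map_zero, map_zero,
      wedge_zero_left]
  | hadd A B h1 h2 =>
    rw [ContinuousLinearMap.comp_add, ContinuousAlternatingMap.alternatizeUncurryFin_add,
      ContinuousAlternatingMap.alternatizeUncurryFin_add, h1, h2, wedge_add_left]
  | he c α =>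
    rw [← covWedge_apply, ← covWedge_wedge_left, covWedge_apply]
    congr 1
    ext v w
    simp

theorem alternatizeUncurryFin_wedge_right {k l : ℕ} (m : ℕ) (α : V [⋀^Fin k]→L[ℝ] ℝ)
    (A : V →L[ℝ] V [⋀^Fin l]→L[ℝ] ℝ) :
    alternatizeUncurryFin ((wedgeL k l m α).comp A) =
      (-1 : ℝ) ^ k • wedge (m + 1) α (alternatizeUncurryFin A) := by
  induction A using clm_induction with
  | h0 =>
    rw [ContinuousLinearMap.comp_zero, ← ContinuousAlternatingMap.alternatizeUncurryFinCLM_apply,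
      ← ContinuousAlternatingMap.alternatizeUncurryFinCLM_apply, map_zero, map_zero,
      wedge_zero_right, smul_zero]
  | hadd A B h1 h2 =>
    rw [ContinuousLinearMap.comp_add, ContinuousAlternatingMap.alternatizeUncurryFin_add,
      ContinuousAlternatingMap.alternatizeUncurryFin_add, h1, h2, wedge_add_right, smul_add]
  | he c α =>
    rw [← covWedge_apply, ← covWedge_wedge_right, covWedge_apply]
    congr 1
    ext v w
    simp

/-- The graded Leibniz rule for the exterior derivative. -/
theorem extDeriv_wedge {k l : ℕ} (m : ℕ) {α : V → V [⋀^Fin k]→L[ℝ] ℝ} {β : V → V [⋀^Fin l]→L[ℝ] ℝ}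
    {x : V} (hα : DifferentiableAt ℝ α x) (hβ : DifferentiableAt ℝ β x) :
    extDeriv (fun x => wedge m (α x) (β x)) x =
      wedge (m + 1) (extDeriv α x) (β x) + (-1 : ℝ) ^ k • wedge (m + 1) (α x) (extDeriv β x) := by
  have h1 : HasFDerivAt (fun x => wedge m (α x) (β x))
      ((wedgeL k l m (α x)).comp (fderiv ℝ β x) + (wedgeRight m (β x)).comp (fderiv ℝ α x)) x := by
    refine ((wedgeL k l m).hasFDerivAt_of_bilinear hα.hasFDerivAt hβ.hasFDerivAt).congr_fderiv ?_
    ext v w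
    rfl
  rw [extDeriv, h1.fderiv, ContinuousAlternatingMap.alternatizeUncurryFin_add,
    alternatizeUncurryFin_wedge_right, alternatizeUncurryFin_wedge_left,
    add_comm (_ • _)]
  rfl

end Leibniz


/-! ### The pairing of vertical vectors defined by the multisymplectic form -/

section Pairing

theorem alt_zero_apply {V : Type*} [AddCommGroup V] [Module ℝ V] [TopologicalSpace V] {k : ℕ}
    (w : Fin k → V) : (0 : V [⋀^Fin k]→L[ℝ] ℝ) w = 0 := rfl

/-- The matrix is the identity with column j replaced by coordinates of u, so Cramer's rule gives
its determinant. -/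
theorem elem_proj_update {n k : ℕ} {s : Fin k → Fin n} (hs : Function.Injective s) (j : Fin k)
    (u : EuclideanSpace ℝ (Fin n)) :
    elem (fun i => (EuclideanSpace.proj (s i) : EuclideanSpace ℝ (Fin n) →L[ℝ] ℝ))
      (Function.update (fun i => EuclideanSpace.single (s i) (1 : ℝ)) j u) = u (s j) := by
  rw [elem_apply]
  have : (Matrix.of fun i c => (EuclideanSpace.proj (s i) : EuclideanSpace ℝ (Fin n) →L[ℝ] ℝ)
      (Function.update (fun i => EuclideanSpace.single (s i) (1 : ℝ)) j u c)) =
      (1 : Matrix (Fin k) (Fin k) ℝ).updateCol j (fun i => u (s i)) := by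
    ext i c
    by_cases hc : c = j
    · subst hc; simp
    · simp [hc, Matrix.one_apply, hs.eq_iff]
  rw [this, ← Matrix.cramer_apply, Matrix.cramer_one]
  rfl

/-- Moving u from the first slot to slot j costs only a sign; coordinate vectors in the other slots
then read off the coordinate of u. -/
theorem elem_proj_interior_eq_zero {n k : ℕ} {s : Fin (k + 1) → Fin n} (hs : Function.Injective s)
    {u : EuclideanSpace ℝ (Fin n)} (h : ∀ a : Fin k → EuclideanSpace ℝ (Fin n),
      elem (fun i => (EuclideanSpace.proj (s i) : EuclideanSpace ℝ (Fin n) →L[ℝ] ℝ))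
        (Matrix.vecCons u a) = 0) (j : Fin (k + 1)) : u (s j) = 0 := by
  have := ContinuousAlternatingMap.map_insertNth
    (elem (fun i => (EuclideanSpace.proj (s i) : EuclideanSpace ℝ (Fin n) →L[ℝ] ℝ))) j u
    (j.removeNth (fun i => EuclideanSpace.single (s i) (1 : ℝ)))
  rw [h, smul_zero, Fin.insertNth_removeNth, elem_proj_update hs] at this
  exact this

/-- Since m ≥ 1 there is an index d different from i and c. Enumerating everything except d keeps
both, and a transposition moves c to the place j₀. -/
theorem exists_injective_fin {m : ℕ} (hm : 1 ≤ m) (i c : Fin (m + 2)) (j₀ : Fin (m + 1)) :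
    ∃ s : Fin (m + 1) → Fin (m + 2), Function.Injective s ∧ s j₀ = c ∧ ∃ j, s j = i := by
  obtain ⟨d, hd⟩ : ∃ d : Fin (m + 2), d ∉ ({i, c} : Finset (Fin (m + 2))) := by
    by_contra! h
    have h1 : (Finset.univ : Finset (Fin (m + 2))).card ≤ ({i, c} : Finset (Fin (m + 2))).card :=
      Finset.card_le_card fun x _ => h x
    have h2 := Finset.card_le_two (a := i) (b := c)
    simp at h1
    omega
  simp only [Finset.mem_insert, Finset.mem_singleton, not_or] at hd
  obtain ⟨jc, hjc⟩ := Fin.exists_succAbove_eq (Ne.symm hd.2)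
  obtain ⟨ji, hji⟩ := Fin.exists_succAbove_eq (Ne.symm hd.1)
  refine ⟨d.succAbove ∘ Equiv.swap j₀ jc,
    Fin.succAbove_right_injective.comp (Equiv.injective _), by simp [hjc],
    (Equiv.swap j₀ jc).symm ji, by simp [hji]⟩

variable {m : ℕ}

local notation "W" => EuclideanSpace ℝ (Fin (m + 2))

theorem span_elem_proj {k : ℕ} (α : W [⋀^Fin k]→L[ℝ] ℝ) :
    α ∈ Submodule.span ℝ (Set.range fun I : Fin k → Fin (m + 2) =>
      elem fun i => (EuclideanSpace.proj (I i) : W →L[ℝ] ℝ)) :=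
  span_elem_basis (EuclideanSpace.basisFun (Fin (m + 2)) ℝ).toBasis
    (fun i => EuclideanSpace.proj i) (fun i v => by simp) α

/-- ρ ∧ η can be any product of m + 1 distinct coordinate covectors, and every index i belongs to
such a product. -/
theorem eq_zero_of_wedge {k l : ℕ} (hkl : k + l = m + 1) {u : W}
    (h : ∀ (ρ : W [⋀^Fin k]→L[ℝ] ℝ) (η : W [⋀^Fin l]→L[ℝ] ℝ) (a : Fin m → W),
      wedge (m + 1) ρ η (Matrix.vecCons u a) = 0) : u = 0 := by
  ext i
  obtain ⟨s, hs, j, hj⟩ : ∃ s : Fin (m + 1) → Fin (m + 2), Function.Injective s ∧ ∃ j, s j = i := by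
    obtain ⟨d, hd⟩ := exists_ne i
    obtain ⟨j, hj⟩ := Fin.exists_succAbove_eq hd.symm
    exact ⟨_, Fin.succAbove_right_injective, j, hj⟩
  rw [← hj]
  refine elem_proj_interior_eq_zero hs (fun a => ?_) j
  have := h (elem fun i => EuclideanSpace.proj (s (Fin.cast hkl (Fin.castAdd l i))))
    (elem fun i => EuclideanSpace.proj (s (Fin.cast hkl (Fin.natAdd k i)))) a
  rw [wedge_elem' hkl] at this
  convert this using 2
  congr 1
  funext i
  obtain ⟨i, rfl⟩ := (finCongr hkl).surjective i
  induction i using Fin.addCases <;> simp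

/-- Take η' = dx^I and let ρ begin with the first covector of η'. Then ρ ∧ η' = 0, so the symmetry
makes the contraction of ρ ∧ η with f η' vanish for every η. Completing ρ ∧ η to a product of
distinct covectors containing dx^i kills the i-th coordinate of f η'. The bounds on k and l give
both forms a first covector and guarantee m ≥ 1. -/
theorem wedge_symm_right_eq_zero {k l : ℕ} (hkl : k + l = m + 1) (hk : 1 ≤ k) (hl : 1 ≤ l)
    (f : (W [⋀^Fin l]→L[ℝ] ℝ) →ₗ[ℝ] W)
    (h : ∀ (ρ : W [⋀^Fin k]→L[ℝ] ℝ) (η η' : W [⋀^Fin l]→L[ℝ] ℝ) (a : Fin m → W),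
      wedge (m + 1) ρ η (Matrix.vecCons (f η') a) = wedge (m + 1) ρ η' (Matrix.vecCons (f η) a)) :
    f = 0 := by
  refine LinearMap.ext_on (eq_top_iff.2 fun α _ => span_elem_proj α) ?_
  rintro _ ⟨I, rfl⟩
  ext i
  obtain ⟨s, hs, hs0, j, hj⟩ := exists_injective_fin (by omega) i (I ⟨0, hl⟩) ⟨0, by omega⟩
  rw [← hj]
  refine elem_proj_interior_eq_zero hs (fun a => ?_) j
  have := h (elem fun i => EuclideanSpace.proj (s (Fin.cast hkl (Fin.castAdd l i))))
    (elem fun i => EuclideanSpace.proj (s (Fin.cast hkl (Fin.natAdd k i))))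
    (elem fun i => EuclideanSpace.proj (I i)) a
  have hz : wedge (m + 1) (elem fun i => (EuclideanSpace.proj
      (s (Fin.cast hkl (Fin.castAdd l i))) : W →L[ℝ] ℝ))
      (elem fun i => (EuclideanSpace.proj (I i) : W →L[ℝ] ℝ)) = 0 := by
    rw [wedge_elem' hkl]
    refine elem_eq_zero _ (i := ⟨0, by omega⟩) (j := ⟨k, by omega⟩) ?_ ?_
    · simp; omega
    · have h0 : 0 < k := hk
      simp only [append_eq_dite, Fin.val_cast, h0, dif_pos, lt_irrefl, not_false_eq_true, dif_neg,
        Nat.sub_self]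
      rw [← hs0]
      rfl
  rw [hz, wedge_elem' hkl, alt_zero_apply] at this
  convert this using 2
  congr 1
  funext i
  obtain ⟨i, rfl⟩ := (finCongr hkl).surjective i
  induction i using Fin.addCases <;> simp

theorem wedge_symm_left_eq_zero {k l : ℕ} (hkl : k + l = m + 1) (hk : 1 ≤ k) (hl : 1 ≤ l)
    (f : (W [⋀^Fin k]→L[ℝ] ℝ) →ₗ[ℝ] W)
    (h : ∀ (ρ ρ' : W [⋀^Fin k]→L[ℝ] ℝ) (η : W [⋀^Fin l]→L[ℝ] ℝ) (a : Fin m → W),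
      wedge (m + 1) ρ η (Matrix.vecCons (f ρ') a) = wedge (m + 1) ρ' η (Matrix.vecCons (f ρ) a)) :
    f = 0 := by
  obtain ⟨c, hc⟩ := exists_wedge_comm (V := W) k l (m + 1)
  obtain ⟨c', hc'⟩ := exists_wedge_comm (V := W) l k (m + 1)
  refine wedge_symm_right_eq_zero (k := l) (l := k) (by omega) hl hk f fun η ρ ρ' a => ?_
  rw [hc', hc', ContinuousAlternatingMap.smul_apply, ContinuousAlternatingMap.smul_apply, h]

end Pairing

/-! ### The pairing on the model fibre and the algebra behind projectability. -/

section Fibre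

variable {m : ℕ} {ι : Type*} [Fintype ι] {q : ι → ℕ}

local notation "W" => EuclideanSpace ℝ (Fin (m + 2))

local notation "Ph" => FormModel (m + 2) (phaseDeg (m + 2) q)

/-- The component `y^A` of a point of the model fibre. -/
def yPart (b : FormModel (m + 2) (phaseDeg (m + 2) q)) (A : ι) : W [⋀^Fin (q A)]→L[ℝ] ℝ :=
  b (Sum.inl A)

/-- The component `p_A` of a point of the model fibre. -/
def pPart (b : FormModel (m + 2) (phaseDeg (m + 2) q)) (A : {A : ι // q A < m + 2}) :
    W [⋀^Fin (m + 2 - q A - 1)]→L[ℝ] ℝ :=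
  b (Sum.inr (Sum.inl A))

/-- The value `i_{b'} i_b ω` of the multisymplectic form on two vertical vectors. -/
def pairing (b b' : FormModel (m + 2) (phaseDeg (m + 2) q)) : W [⋀^Fin (m + 1)]→L[ℝ] ℝ :=
  ∑ A : {A : ι // q A < m + 2},
    (wedge (m + 1) (pPart b A) (yPart b' A) - wedge (m + 1) (pPart b' A) (yPart b A))

open Classical in
/-- The inclusion of the component with index `k` in the model fibre. -/
def inSlot (k : ι ⊕ {A : ι // q A < m + 2} ⊕ Unit) :
    (W [⋀^Fin (phaseDeg (m + 2) q k)]→L[ℝ] ℝ) →ₗ[ℝ] Ph :=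
  LinearMap.single ℝ (fun k => W [⋀^Fin (phaseDeg (m + 2) q k)]→L[ℝ] ℝ) k

omit [Fintype ι] in
theorem inSlot_same (k : ι ⊕ {A : ι // q A < m + 2} ⊕ Unit)
    (ζ : W [⋀^Fin (phaseDeg (m + 2) q k)]→L[ℝ] ℝ) : inSlot k ζ k = ζ := by
  simp [inSlot]

omit [Fintype ι] in
theorem inSlot_of_ne {k k' : ι ⊕ {A : ι // q A < m + 2} ⊕ Unit} (h : k' ≠ k)
    (ζ : W [⋀^Fin (phaseDeg (m + 2) q k)]→L[ℝ] ℝ) : inSlot k ζ k' = 0 := by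
  simp [inSlot, h]

theorem sum_inSlot (b : Ph) : ∑ k, inSlot k (b k) = b := by
  classical
  funext k
  rw [Finset.sum_apply, Finset.sum_eq_single k (fun k' _ hk => inSlot_of_ne hk.symm _)
    (by simp), inSlot_same]

/-- The inclusion of the component `y^A` in the model fibre. -/
def slotY (A : ι) : (W [⋀^Fin (q A)]→L[ℝ] ℝ) →ₗ[ℝ] Ph := inSlot (Sum.inl A)

/-- The inclusion of the component `p_A` in the model fibre. -/
def slotP (A : {A : ι // q A < m + 2}) : (W [⋀^Fin (m + 2 - q A - 1)]→L[ℝ] ℝ) →ₗ[ℝ] Ph :=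
  inSlot (Sum.inr (Sum.inl A))

omit [Fintype ι] in
theorem yPart_slotY (A : ι) (η : W [⋀^Fin (q A)]→L[ℝ] ℝ) : yPart (slotY (m := m) A η) A = η :=
  inSlot_same (q := q) (Sum.inl A) η

omit [Fintype ι] in
theorem yPart_slotY_of_ne {A A' : ι} (h : A' ≠ A) (η : W [⋀^Fin (q A)]→L[ℝ] ℝ) :
    yPart (slotY (m := m) A η) A' = 0 :=
  inSlot_of_ne (by simpa using h) _

omit [Fintype ι] in
theorem pPart_slotY (A : ι) (A' : {A : ι // q A < m + 2}) (η : W [⋀^Fin (q A)]→L[ℝ] ℝ) :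
    pPart (slotY (m := m) A η) A' = 0 :=
  inSlot_of_ne (by simp) _

omit [Fintype ι] in
theorem pPart_slotP (A : {A : ι // q A < m + 2}) (ρ : W [⋀^Fin (m + 2 - q A - 1)]→L[ℝ] ℝ) :
    pPart (slotP A ρ) A = ρ :=
  inSlot_same (q := q) (Sum.inr (Sum.inl A)) ρ

omit [Fintype ι] in
theorem pPart_slotP_of_ne {A A' : {A : ι // q A < m + 2}} (h : A' ≠ A)
    (ρ : W [⋀^Fin (m + 2 - q A - 1)]→L[ℝ] ℝ) : pPart (slotP A ρ) A' = 0 :=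
  inSlot_of_ne (by simpa using h) _

omit [Fintype ι] in
theorem yPart_slotP (A : {A : ι // q A < m + 2}) (A' : ι) (ρ : W [⋀^Fin (m + 2 - q A - 1)]→L[ℝ] ℝ) :
    yPart (slotP A ρ) A' = 0 :=
  inSlot_of_ne (by simp) _

theorem pairing_slotY (b : Ph) (A : {A : ι // q A < m + 2}) (η : W [⋀^Fin (q A)]→L[ℝ] ℝ) :
    pairing b (slotY A.1 η) = wedge (m + 1) (pPart b A) η := by
  rw [pairing, Finset.sum_eq_single A (fun A' _ h => by
    rw [pPart_slotY, yPart_slotY_of_ne (by simpa [Subtype.ext_iff] using h), wedge_zero_left,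
      wedge_zero_right, sub_zero]) (by simp), pPart_slotY, yPart_slotY, wedge_zero_left, sub_zero]

theorem pairing_slotP (b : Ph) (A : {A : ι // q A < m + 2})
    (ρ : W [⋀^Fin (m + 2 - q A - 1)]→L[ℝ] ℝ) :
    pairing b (slotP A ρ) = -wedge (m + 1) ρ (yPart b A) := by
  rw [pairing, Finset.sum_eq_single A (fun A' _ h => by
    rw [yPart_slotP, pPart_slotP_of_ne h, wedge_zero_left, wedge_zero_right, sub_zero]) (by simp),
    yPart_slotP, pPart_slotP, wedge_zero_right, zero_sub]

/-- If the horizontal derivative of the pairing along the vertical differential `f` of the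
projection of a vector field vanishes, then this differential is zero. -/
theorem eq_zero_of_pairing (hfields : 2 ≤ ∑ A, (m + 1).choose (q A))
    (f : Ph →ₗ[ℝ] W)
    (h : ∀ (b₁ b₂ b₃ : Ph) (a : Fin m → W),
      pairing b₂ b₃ (Matrix.vecCons (f b₁) a) - pairing b₁ b₃ (Matrix.vecCons (f b₂) a) +
        pairing b₁ b₂ (Matrix.vecCons (f b₃) a) = 0) : f = 0 := by
  classical
  have hdeg : ∀ A : {A : ι // q A < m + 2}, m + 2 - q A - 1 + q A = m + 1 := fun A => by
    have := A.2
    omega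
  -- fields with another index
  have key1 : ∀ (b : Ph) (A : {A : ι // q A < m + 2}), yPart b A = 0 → pPart b A = 0 →
      f b = 0 := by
    intro b A hy hp
    -- A direction b without components in the A-slots pairs to zero with both of them, so of the
    -- three terms only the one contracting ρ ∧ η with f b survives.
    refine eq_zero_of_wedge (hdeg A) fun ρ η a => ?_
    have := h b (slotP A ρ) (slotY A.1 η) a
    rw [pairing_slotY, pairing_slotY, pairing_slotP, hy, hp, wedge_zero_left, wedge_zero_right,
      pPart_slotP] at this
    simpa using this
  -- Two directions of the same kind (both y or both p) pair to zero. Adding one conjugate direction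
  -- as the third vector yields precisely the symmetry hypothesis of `wedge_symm_right_eq_zero` or
  -- `wedge_symm_left_eq_zero`.
  have key2 : ∀ A : {A : ι // q A < m + 2}, 1 ≤ q A → q A ≤ m →
      (∀ η, f (slotY A.1 η) = 0) ∧ ∀ ρ, f (slotP A ρ) = 0 := by
    intro A h1 h2
    constructor
    · refine fun η => LinearMap.congr_fun (wedge_symm_right_eq_zero (hdeg A) (by omega) h1
        (f ∘ₗ slotY A.1) fun ρ η η' a => ?_) η
      have := h (slotY A.1 η') (slotP A ρ) (slotY A.1 η) a
      rw [pairing_slotY, pairing_slotY, pairing_slotP, pPart_slotP, pPart_slotY, yPart_slotY,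
        wedge_zero_left] at this
      simp only [alt_zero_apply, ContinuousAlternatingMap.neg_apply] at this
      simp only [LinearMap.comp_apply]
      linarith
    · refine fun η => LinearMap.congr_fun (wedge_symm_left_eq_zero (hdeg A) (by omega) h1
        (f ∘ₗ slotP A) fun ρ ρ' η a => ?_) η
      have := h (slotP A ρ') (slotP A ρ) (slotY A.1 η) a
      rw [pairing_slotY, pairing_slotY, pairing_slotP, pPart_slotP, pPart_slotP, yPart_slotP,
        wedge_zero_right] at this
      simp only [alt_zero_apply, ContinuousAlternatingMap.neg_apply] at this
      simp only [LinearMap.comp_apply]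
      linarith
  -- A field of degree n contributes C(n−1, n) = 0 to the sum of binomials, and a lone field of
  -- degree 0 or n − 1 contributes 1; both together stay below the bound 2.
  have key3 : ∀ A : {A : ι // q A < m + 2}, (∃ A' : {A : ι // q A < m + 2}, A' ≠ A) ∨
      (1 ≤ q A ∧ q A ≤ m) := by
    intro A
    by_contra! hA
    have h1 : ∑ A, (m + 1).choose (q A) = (m + 1).choose (q A) :=
      Finset.sum_eq_single A.1 (fun A' _ hne => by
        by_cases hlt : q A' < m + 2
        · exact absurd (congrArg Subtype.val (hA.1 ⟨A', hlt⟩)) hne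
        · exact Nat.choose_eq_zero_of_lt (by omega)) (by simp)
    rw [h1] at hfields
    have hlt := A.2
    rcases Nat.eq_zero_or_pos (q A) with h0 | h0
    · rw [h0] at hfields
      simp at hfields
    · have h2 := hA.2 h0
      have h3 : q A = m + 1 := by omega
      rw [h3] at hfields
      simp at hfields
  -- Some pair of conjugate slots exists; it serves as the untouched field for the directions of h
  -- and of the fields of degree n, which have no momentum.
  have key4 : ∃ A : ι, q A < m + 2 := by
    by_contra! hA
    rw [Finset.sum_eq_zero fun A _ => Nat.choose_eq_zero_of_lt (by have := hA A; omega)] at hfields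
    omega
  refine LinearMap.ext fun b => ?_
  rw [← sum_inSlot b, map_sum, LinearMap.zero_apply]
  refine Finset.sum_eq_zero fun k _ => ?_
  rcases k with A | A | u
  · by_cases hA : q A < m + 2
    · rcases key3 ⟨A, hA⟩ with ⟨A', hA'⟩ | h'
      · exact key1 _ A' (inSlot_of_ne (by simpa [Subtype.ext_iff] using hA') _)
          (inSlot_of_ne (by simp) _)
      · exact (key2 ⟨A, hA⟩ h'.1 h'.2).1 _
    · obtain ⟨A', hA'⟩ := key4
      refine key1 _ ⟨A', hA'⟩ (inSlot_of_ne ?_ _) (inSlot_of_ne (by simp) _)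
      rintro ⟨⟩
      exact hA hA'
  · rcases key3 A with ⟨A', hA'⟩ | h'
    · exact key1 _ A' (inSlot_of_ne (by simp) _) (inSlot_of_ne (by simpa using hA') _)
    · exact (key2 A h'.1 h'.2).2 _
  · obtain ⟨A', hA'⟩ := key4
    exact key1 _ ⟨A', hA'⟩ (inSlot_of_ne (by simp) _) (inSlot_of_ne (by simp) _)

end Fibre


/-! ### Interior products and alternatization -/

section InteriorAlt

open ContinuousAlternatingMap (alternatizeUncurryFin alternatizeUncurryFinCLM)

variable {V : Type*} [NormedAddCommGroup V] [NormedSpace ℝ V]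

/-- `(v, α) ↦ i_v α` as a continuous bilinear map. -/
def interiorL (V : Type*) [NormedAddCommGroup V] [NormedSpace ℝ V] (k : ℕ) :
    (V [⋀^Fin (k + 1)]→L[ℝ] ℝ) →L[ℝ] V →L[ℝ] (V [⋀^Fin k]→L[ℝ] ℝ) :=
  (ContinuousAlternatingMap.curryLeftLI : (V [⋀^Fin (k + 1)]→L[ℝ] ℝ) →ₗᵢ[ℝ] _).toContinuousLinearMap

@[simp] theorem interiorL_apply {k : ℕ} (v : V) (α : V [⋀^Fin (k + 1)]→L[ℝ] ℝ) :
    interiorL V k α v = interior v α := rfl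

theorem interior_add {k : ℕ} (v : V) (α β : V [⋀^Fin (k + 1)]→L[ℝ] ℝ) :
    interior v (α + β) = interior v α + interior v β := rfl

theorem interior_add_left {k : ℕ} (v v' : V) (α : V [⋀^Fin (k + 1)]→L[ℝ] ℝ) :
    interior (v + v') α = interior v α + interior v' α := by
  simp only [← interiorL_apply, map_add]

theorem interior_sub_left {k : ℕ} (v v' : V) (α : V [⋀^Fin (k + 1)]→L[ℝ] ℝ) :
    interior (v - v') α = interior v α - interior v' α := by
  simp only [← interiorL_apply, map_sub]

theorem interior_neg {k : ℕ} (v : V) (α : V [⋀^Fin (k + 1)]→L[ℝ] ℝ) :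
    interior v (-α) = -interior v α := rfl

theorem interior_zero {k : ℕ} (v : V) : interior v (0 : V [⋀^Fin (k + 1)]→L[ℝ] ℝ) = 0 := rfl

theorem interior_smul {k : ℕ} (v : V) (c : ℝ) (α : V [⋀^Fin (k + 1)]→L[ℝ] ℝ) :
    interior v (c • α) = c • interior v α := rfl

theorem interior_sum {k : ℕ} {κ : Type*} (s : Finset κ) (v : V) (α : κ → V [⋀^Fin (k + 1)]→L[ℝ] ℝ) :
    interior v (∑ i ∈ s, α i) = ∑ i ∈ s, interior v (α i) :=
  map_sum (ContinuousLinearMap.flip (interiorL V k) v) α s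

theorem interior_interior_swap {k : ℕ} (v w : V) (α : V [⋀^Fin (k + 2)]→L[ℝ] ℝ) :
    interior v (interior w α) = -interior w (interior v α) := by
  ext a
  have h := α.toAlternatingMap.map_swap (Matrix.vecCons v (Matrix.vecCons w a))
    (Fin.zero_ne_one : (0 : Fin (k + 2)) ≠ 1)
  have h' : (Matrix.vecCons v (Matrix.vecCons w a)) ∘ Equiv.swap (0 : Fin (k + 2)) 1 =
      Matrix.vecCons w (Matrix.vecCons v a) := by
    funext i
    refine Fin.cases ?_ (fun i => Fin.cases ?_ (fun i => ?_) i) i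
    · simp
    · simp
    · have : Equiv.swap (0 : Fin (k + 2)) 1 i.succ.succ = i.succ.succ :=
        Equiv.swap_apply_of_ne_of_ne (by simp [Fin.ext_iff]) (by simp [Fin.ext_iff])
      simp [this]
  rw [h'] at h
  exact h

theorem interior_comp {V' : Type*} [NormedAddCommGroup V'] [NormedSpace ℝ V'] {k : ℕ} (v : V)
    (L : V →L[ℝ] V') (α : V' [⋀^Fin (k + 1)]→L[ℝ] ℝ) :
    interior v (α.compContinuousLinearMap L) = (interior (L v) α).compContinuousLinearMap L := by
  ext w
  change α (fun i => L (Matrix.vecCons v w i)) = α (Matrix.vecCons (L v) (fun i => L (w i)))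
  congr 1
  funext i
  cases i using Fin.cases <;> simp

theorem contract_comp {V' : Type*} [NormedAddCommGroup V'] [NormedSpace ℝ V'] {k : ℕ} (v : V)
    (L : V →L[ℝ] V') (α : V' [⋀^Fin k]→L[ℝ] ℝ) :
    contract v (α.compContinuousLinearMap L) = (contract (L v) α).compContinuousLinearMap L := by
  cases k
  · rfl
  · exact interior_comp v L α

/-- Cartan's formula for alternatizations. -/
theorem interior_alternatizeUncurryFin {k : ℕ} (v : V) (A : V →L[ℝ] V [⋀^Fin (k + 1)]→L[ℝ] ℝ) :
    interior v (alternatizeUncurryFin A) =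
      A v - alternatizeUncurryFin (((interiorL V k).flip v).comp A) := by
  ext w
  rw [interior_apply, ContinuousAlternatingMap.alternatizeUncurryFin_apply, Fin.sum_univ_succ,
    ContinuousAlternatingMap.sub_apply, ContinuousAlternatingMap.alternatizeUncurryFin_apply,
    sub_eq_add_neg, ← Finset.sum_neg_distrib]
  congr 1
  · simp
  · refine Finset.sum_congr rfl fun i _ => ?_
    rw [Fin.val_succ, pow_succ, mul_neg_one, neg_smul, Matrix.cons_val_succ]
    congr 2
    change A (w i) _ = A (w i) _
    congr 1
    funext j
    cases j using Fin.cases <;> simp [Fin.removeNth]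

theorem interior_covWedge {k : ℕ} (v : V) (c : V →L[ℝ] ℝ) (α : V [⋀^Fin (k + 1)]→L[ℝ] ℝ) :
    interior v (covWedge c α) = c v • α - covWedge c (interior v α) := by
  rw [covWedge_apply, interior_alternatizeUncurryFin, covWedge_apply]
  rfl

end InteriorAlt

/-! ### Forms in a bundle chart -/

section Chart

open ContinuousAlternatingMap (alternatizeUncurryFin alternatizeUncurryFinCLM)

variable {E G : Type*} [NormedAddCommGroup E] [NormedSpace ℝ E] [NormedAddCommGroup G]
  [NormedSpace ℝ G]

/-- The pullback of forms along the projection `E × G → E`. -/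
def horL (E G : Type*) [NormedAddCommGroup E] [NormedSpace ℝ E] [NormedAddCommGroup G]
    [NormedSpace ℝ G] (k : ℕ) : (E [⋀^Fin k]→L[ℝ] ℝ) →L[ℝ] ((E × G) [⋀^Fin k]→L[ℝ] ℝ) :=
  ContinuousAlternatingMap.compContinuousLinearMapCLM (ContinuousLinearMap.fst ℝ E G)

theorem horL_apply {k : ℕ} (α : E [⋀^Fin k]→L[ℝ] ℝ) (w : Fin k → E × G) :
    horL E G k α w = α (fun i => (w i).1) := rfl

theorem horL_injective (k : ℕ) : Function.Injective (horL E G k) := fun α β h => by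
  ext w
  exact congrArg (fun γ : (E × G) [⋀^Fin k]→L[ℝ] ℝ => γ fun i => (w i, 0)) h

theorem interior_horL {k : ℕ} (v : E × G) (α : E [⋀^Fin (k + 1)]→L[ℝ] ℝ) :
    interior v (horL E G (k + 1) α) = horL E G k (interior v.1 α) :=
  interior_comp v (ContinuousLinearMap.fst ℝ E G) α

theorem interior_vertical_horL {k : ℕ} (b : G) (α : E [⋀^Fin (k + 1)]→L[ℝ] ℝ) :
    interior ((0, b) : E × G) (horL E G (k + 1) α) = 0 := by
  rw [interior_horL]
  change horL E G k (interiorL E k α 0) = 0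
  rw [map_zero, map_zero]

theorem contract_vertical_horL {k : ℕ} (b : G) (α : E [⋀^Fin k]→L[ℝ] ℝ) :
    contract ((0, b) : E × G) (horL E G k α) = 0 := by
  cases k
  · rfl
  · exact interior_vertical_horL b α

theorem alternatizeUncurryFin_horL {k : ℕ} (A : E →L[ℝ] E [⋀^Fin k]→L[ℝ] ℝ) :
    alternatizeUncurryFin ((horL E G k).comp (A.comp (ContinuousLinearMap.fst ℝ E G))) =
      horL E G (k + 1) (alternatizeUncurryFin A) := by
  ext w
  rw [horL_apply, ContinuousAlternatingMap.alternatizeUncurryFin_apply,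
    ContinuousAlternatingMap.alternatizeUncurryFin_apply]
  rfl

/-- The exterior derivative of the tautological form defined by a linear map `T` from the fibre to
the forms on the base; it is a constant form. -/
def dTaut {k : ℕ} (T : G →L[ℝ] E [⋀^Fin k]→L[ℝ] ℝ) : (E × G) [⋀^Fin (k + 1)]→L[ℝ] ℝ :=
  alternatizeUncurryFin ((horL E G k).comp (T.comp (ContinuousLinearMap.snd ℝ E G)))

theorem extDeriv_taut {k : ℕ} (T : G →L[ℝ] E [⋀^Fin k]→L[ℝ] ℝ) (u : E × G) :
    extDeriv (fun u : E × G => horL E G k (T u.2)) u = dTaut T := by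
  have h := ((horL E G k).comp (T.comp (ContinuousLinearMap.snd ℝ E G))).hasFDerivAt (x := u)
  have : HasFDerivAt (fun u : E × G => horL E G k (T u.2))
    ((horL E G k).comp (T.comp (ContinuousLinearMap.snd ℝ E G))) u := h
  rw [extDeriv, this.fderiv, dTaut]

/-- In Cartan's formula the correction term contracts a horizontal form with a vertical vector and
drops out. -/
theorem interior_vertical_dTaut {k : ℕ} (T : G →L[ℝ] E [⋀^Fin k]→L[ℝ] ℝ) (b : G) :
    interior ((0, b) : E × G) (dTaut T) = horL E G k (T b) := by
  cases k with
  | zero =>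
    ext w
    rw [interior_apply, dTaut, ContinuousAlternatingMap.alternatizeUncurryFin_apply]
    simp [horL_apply]
  | succ k =>
    rw [dTaut, interior_alternatizeUncurryFin]
    have : ((interiorL (E × G) k).flip ((0, b) : E × G)).comp
        ((horL E G (k + 1)).comp (T.comp (ContinuousLinearMap.snd ℝ E G))) = 0 := by
      refine ContinuousLinearMap.ext fun w => ?_
      exact interior_vertical_horL b _
    rw [this, ← ContinuousAlternatingMap.alternatizeUncurryFinCLM_apply, map_zero, sub_zero]
    rfl

/-- The infinitesimal action of an endomorphism on forms. -/
def lieTerm (A : E →L[ℝ] E) : {k : ℕ} → (E [⋀^Fin k]→L[ℝ] ℝ) → E [⋀^Fin k]→L[ℝ] ℝ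
  | 0, _ => 0
  | k + 1, α => alternatizeUncurryFin ((interiorL E k α).comp A)

/-- The condition on b says that (ξ, b) is, as far as T is concerned, the canonical lift of ξ. The
Lie derivative of the tautological form along the lift is zero, and Cartan's formula turns this into
the claim. -/
theorem extDeriv_horL_interior {k : ℕ} (T : G →L[ℝ] E [⋀^Fin (k + 1)]→L[ℝ] ℝ) {ξ : E → E}
    {u : E × G} (hξ : DifferentiableAt ℝ ξ u.1) {b : G}
    (hb : T b = -lieTerm (fderiv ℝ ξ u.1) (T u.2)) :
    extDeriv (fun u : E × G => horL E G k (interior (ξ u.1) (T u.2))) u =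
      -interior ((ξ u.1, b) : E × G) (dTaut T) := by
  have h1 : HasFDerivAt (fun u : E × G => interior (ξ u.1) (T u.2))
      ((interiorL E k (T u.2)).comp ((fderiv ℝ ξ u.1).comp (ContinuousLinearMap.fst ℝ E G)) +
        ((interiorL E k).flip (ξ u.1)).comp (T.comp (ContinuousLinearMap.snd ℝ E G))) u := by
    have h2 : HasFDerivAt (fun u : E × G => T u.2) (T.comp (ContinuousLinearMap.snd ℝ E G)) u :=
      (T.comp (ContinuousLinearMap.snd ℝ E G)).hasFDerivAt
    have h3 : HasFDerivAt (fun u : E × G => ξ u.1)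
      ((fderiv ℝ ξ u.1).comp (ContinuousLinearMap.fst ℝ E G)) u :=
      hξ.hasFDerivAt.comp u hasFDerivAt_fst
    exact (interiorL E k).hasFDerivAt_of_bilinear h2 h3
  have h2 := (horL E G k).hasFDerivAt.comp u h1
  have h3 : extDeriv (fun u : E × G => horL E G k (interior (ξ u.1) (T u.2))) u =
      alternatizeUncurryFin ((horL E G k).comp ((interiorL E k (T u.2)).comp
        ((fderiv ℝ ξ u.1).comp (ContinuousLinearMap.fst ℝ E G)) +
        ((interiorL E k).flip (ξ u.1)).comp (T.comp (ContinuousLinearMap.snd ℝ E G)))) := by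
    rw [extDeriv]
    exact congrArg _ h2.fderiv
  have h4 : interior ((ξ u.1, (0 : G)) : E × G) (dTaut T) =
      -alternatizeUncurryFin ((horL E G k).comp
        (((interiorL E k).flip (ξ u.1)).comp (T.comp (ContinuousLinearMap.snd ℝ E G)))) := by
    rw [dTaut, interior_alternatizeUncurryFin]
    have e1 : ((horL E G (k + 1)).comp (T.comp (ContinuousLinearMap.snd ℝ E G)))
        (ξ u.1, (0 : G)) = 0 := by simp
    rw [e1, zero_sub]
    congr 2
    refine ContinuousLinearMap.ext fun w => ?_
    exact interior_horL (G := G) (ξ u.1, (0 : G)) (T w.2)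
  have h5 : ((ξ u.1, b) : E × G) = (ξ u.1, 0) + (0, b) := by simp
  rw [h5, interior_add_left, h4, interior_vertical_dTaut, hb, h3, ContinuousLinearMap.comp_add,
    ContinuousAlternatingMap.alternatizeUncurryFin_add, map_neg, neg_add, neg_neg, neg_neg,
    add_comm (alternatizeUncurryFin _)]
  congr 1
  exact alternatizeUncurryFin_horL ((interiorL E k (T u.2)).comp (fderiv ℝ ξ u.1))

theorem extDeriv_horL_contract_zero {k : ℕ} (hk : k = 0) (T : G →L[ℝ] E [⋀^Fin k]→L[ℝ] ℝ)
    (ξ : E → E) (u : E × G) :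
    extDeriv (fun u : E × G => horL E G (k - 1) (contract (ξ u.1) (T u.2))) u = 0 := by
  subst hk
  have : (fun u : E × G => horL E G (0 - 1) (contract (ξ u.1) (T u.2))) = fun _ => 0 := by
    funext u
    exact map_zero (horL E G (0 - 1))
  rw [this, extDeriv, fderiv_fun_const, ← ContinuousAlternatingMap.alternatizeUncurryFinCLM_apply]
  exact map_zero _

theorem contract_dTaut_zero {k : ℕ} (hk : k = 0) (T : G →L[ℝ] E [⋀^Fin k]→L[ℝ] ℝ) {b : G}
    (a : E) (hb : T b = 0) : contract ((a, b) : E × G) (dTaut T) = 0 := by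
  subst hk
  ext w
  change dTaut T (Matrix.vecCons _ w) = 0
  rw [dTaut, ContinuousAlternatingMap.alternatizeUncurryFin_apply]
  simp [hb, alt_zero_apply]

/-- The forms `d(i_ξ T)` and `-i_{(ξ, b)} dT` have the same wedge products; in degree `0` the two
have different degrees, but both vanish. -/
theorem wedge_extDeriv_contract_left {k l : ℕ} (M : ℕ) (T : G →L[ℝ] E [⋀^Fin k]→L[ℝ] ℝ) {ξ : E → E}
    {u : E × G} (hξ : DifferentiableAt ℝ ξ u.1) {b : G}
    (hb : T b = -lieTerm (fderiv ℝ ξ u.1) (T u.2)) (β : (E × G) [⋀^Fin l]→L[ℝ] ℝ) :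
    wedge M (extDeriv (fun u : E × G => horL E G (k - 1) (contract (ξ u.1) (T u.2))) u) β =
      -wedge M (contract ((ξ u.1, b) : E × G) (dTaut T)) β := by
  cases k with
  | zero =>
    rw [extDeriv_horL_contract_zero rfl, contract_dTaut_zero rfl T _ (by simpa [lieTerm] using hb),
      wedge_zero_left, wedge_zero_left, neg_zero]
  | succ k =>
    rw [← wedge_neg_left]
    congr 1
    exact extDeriv_horL_interior T hξ hb

theorem wedge_extDeriv_contract_right {k l : ℕ} (M : ℕ) (T : G →L[ℝ] E [⋀^Fin k]→L[ℝ] ℝ) {ξ : E → E}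
    {u : E × G} (hξ : DifferentiableAt ℝ ξ u.1) {b : G}
    (hb : T b = -lieTerm (fderiv ℝ ξ u.1) (T u.2)) (β : (E × G) [⋀^Fin l]→L[ℝ] ℝ) :
    wedge M β (extDeriv (fun u : E × G => horL E G (k - 1) (contract (ξ u.1) (T u.2))) u) =
      -wedge M β (contract ((ξ u.1, b) : E × G) (dTaut T)) := by
  cases k with
  | zero =>
    rw [extDeriv_horL_contract_zero rfl, contract_dTaut_zero rfl T _ (by simpa [lieTerm] using hb),
      wedge_zero_right, wedge_zero_right, neg_zero]
  | succ k =>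
    rw [← wedge_neg_right]
    congr 1
    exact extDeriv_horL_interior T hξ hb

/-- The iterated vertical filtration: a form is in step `p` if contractions with `p` vertical
vectors give zero. -/
def VertFilt : (p : ℕ) → {k : ℕ} → ((E × G) [⋀^Fin k]→L[ℝ] ℝ) → Prop
  | 0, _, α => α = 0
  | _ + 1, 0, _ => True
  | p + 1, _ + 1, α => ∀ b : G, VertFilt p (interior ((0, b) : E × G) α)

theorem vertFilt_top : ∀ {k : ℕ} (α : (E × G) [⋀^Fin k]→L[ℝ] ℝ), VertFilt (k + 1) α
  | 0, _ => trivial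
  | _ + 1, α => fun b => vertFilt_top (interior ((0, b) : E × G) α)

theorem VertFilt.zero : ∀ (p k : ℕ), VertFilt p (0 : (E × G) [⋀^Fin k]→L[ℝ] ℝ)
  | 0, _ => rfl
  | _ + 1, 0 => trivial
  | p + 1, k + 1 => fun _ => VertFilt.zero p k

theorem VertFilt.add : ∀ {p k : ℕ} {α β : (E × G) [⋀^Fin k]→L[ℝ] ℝ}, VertFilt p α → VertFilt p β →
    VertFilt p (α + β)
  | 0, _, _, _, hα, hβ => by
    change _ = _ at hα hβ ⊢
    rw [hα, hβ, add_zero]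
  | _ + 1, 0, _, _, _, _ => trivial
  | p + 1, k + 1, _, _, hα, hβ => fun b => VertFilt.add (hα b) (hβ b)

theorem VertFilt.smul : ∀ {p k : ℕ} (c : ℝ) {α : (E × G) [⋀^Fin k]→L[ℝ] ℝ}, VertFilt p α →
    VertFilt p (c • α)
  | 0, _, c, _, hα => by
    change _ = _ at hα ⊢
    rw [hα, smul_zero]
  | _ + 1, 0, _, _, _ => trivial
  | p + 1, k + 1, c, _, hα => fun b => VertFilt.smul c (hα b)

theorem VertFilt.succ : ∀ {p k : ℕ} {α : (E × G) [⋀^Fin k]→L[ℝ] ℝ}, VertFilt p α →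
    VertFilt (p + 1) α
  | 0, 0, _, _ => trivial
  | 0, k + 1, _, hα => fun b => by
    change _ = _ at hα
    rw [hα]
    rfl
  | _ + 1, 0, _, _ => trivial
  | p + 1, k + 1, _, hα => fun b => VertFilt.succ (hα b)

theorem VertFilt.mono {p p' k : ℕ} (h : p ≤ p') {α : (E × G) [⋀^Fin k]→L[ℝ] ℝ}
    (hα : VertFilt p α) : VertFilt p' α := by
  induction h with
  | refl => exact hα
  | step _ ih => exact ih.succ

/-- A horizontal covector anticommutes with vertical contractions. This controls the errors dρ_i ∧
α_i caused by a partition of unity on the base. -/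
theorem VertFilt.covWedge : ∀ {p k : ℕ} {c : E × G →L[ℝ] ℝ} (_ : ∀ b : G, c (0, b) = 0)
    {α : (E × G) [⋀^Fin k]→L[ℝ] ℝ}, VertFilt p α → VertFilt p (covWedge c α)
  | 0, _, _, _, _, hα => by
    change _ = _ at hα ⊢
    rw [hα, map_zero]
  | p + 1, 0, c, hc, α, _ => fun b => by
    have : interior ((0, b) : E × G) (DJet.covWedge c α) = 0 := by
      ext w
      change DJet.covWedge c α (Matrix.vecCons _ w) = 0
      rw [covWedge_apply, ContinuousAlternatingMap.alternatizeUncurryFin_apply]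
      simp [hc]
    rw [this]
    exact VertFilt.zero _ _
  | p + 1, k + 1, c, hc, α, hα => fun b => by
    rw [interior_covWedge, hc, zero_smul, zero_sub, ← neg_one_smul ℝ]
    exact VertFilt.smul _ (VertFilt.covWedge hc (hα b))

/-- Pullback along a map that sends vertical vectors to vertical vectors creates no new vertical
arguments. It is applied to chart changes and to the slices of a fibrewise contraction. -/
theorem VertFilt.comp {E' G' : Type*} [NormedAddCommGroup E'] [NormedSpace ℝ E']
    [NormedAddCommGroup G'] [NormedSpace ℝ G'] : ∀ {p k : ℕ} {L : E' × G' →L[ℝ] E × G}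
    (_ : ∀ b : G', (L (0, b)).1 = 0) {α : (E × G) [⋀^Fin k]→L[ℝ] ℝ}, VertFilt p α →
    VertFilt p (α.compContinuousLinearMap L)
  | 0, _, _, _, _, hα => by
    change _ = _ at hα ⊢
    rw [hα]
    rfl
  | _ + 1, 0, _, _, _, _ => trivial
  | p + 1, k + 1, L, hL, α, hα => fun b => by
    have : L (0, b) = (0, (L (0, b)).2) := Prod.ext (hL b) rfl
    rw [interior_comp, this]
    exact VertFilt.comp hL (hα _)

/-- The horizontal forms are those of filtration step `1`. -/
theorem VertFilt.eq_horL : ∀ {k : ℕ} {α : (E × G) [⋀^Fin k]→L[ℝ] ℝ}, VertFilt 1 α →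
    α = horL E G k (α.compContinuousLinearMap (ContinuousLinearMap.inl ℝ E G))
  | 0, α, _ => by
    ext w
    exact congrArg α (Subsingleton.elim _ _)
  | k + 1, α, hα => by
    -- A vertical argument can be moved to the front at the cost of a sign, where the hypothesis
    -- kills it.
    have key : ∀ w : Fin (k + 1) → E × G, ∀ i, (w i).1 = 0 → α w = 0 := by
      intro w i hi
      have h1 : w = i.insertNth (w i) (i.removeNth w) := (Fin.insertNth_self_removeNth _ _).symm
      rw [h1, ContinuousAlternatingMap.map_insertNth]
      have h2 : w i = (0, (w i).2) := Prod.ext hi rfl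
      have h3 : interior ((0, (w i).2) : E × G) α = 0 := hα _
      rw [h2, ← interior_apply, h3, alt_zero_apply, smul_zero]
    -- The arguments are replaced by their base components one at a time; each difference has a
    -- vertical argument.
    have key2 : ∀ (s : Finset (Fin (k + 1))) (w : Fin (k + 1) → E × G),
        α w = α (fun i => if i ∈ s then ((w i).1, 0) else w i) := by
      intro s w
      induction s using Finset.induction_on with
      | empty => simp
      | insert j s hj ih =>
        rw [ih]
        have e : (fun i => if i ∈ s then ((w i).1, (0 : G)) else w i) = Function.update
            (fun i => if i ∈ insert j s then ((w i).1, (0 : G)) else w i) j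
            (((w j).1, 0) + (0, (w j).2)) := by
          funext i
          by_cases h : i = j
          · subst h; simp [hj]
          · simp [h]
        rw [e, ContinuousAlternatingMap.map_update_add]
        rw [key (Function.update _ j (0, (w j).2)) j (by simp), add_zero]
        congr 1
        funext i
        by_cases h : i = j
        · subst h; simp
        · simp [h]
    ext w
    rw [key2 Finset.univ w]
    simp only [Finset.mem_univ, if_true, horL_apply]
    rfl

end Chart


/-! ### Calculus of forms -/

section FormCalculus

open ContinuousAlternatingMap (alternatizeUncurryFin alternatizeUncurryFinCLM)

variable {V X : Type*} [NormedAddCommGroup V] [NormedSpace ℝ V] [NormedAddCommGroup X]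
  [NormedSpace ℝ X]

/-- The exterior derivative of a finite sum. -/
theorem extDeriv_sum {κ : Type*} (s : Finset κ)
    {k : ℕ} {η : κ → V → V [⋀^Fin k]→L[ℝ] ℝ} {u : V} (h : ∀ i ∈ s, DifferentiableAt ℝ (η i) u) :
    extDeriv (fun u => ∑ i ∈ s, η i u) u = ∑ i ∈ s, extDeriv (η i) u := by
  rw [extDeriv, fderiv_fun_sum h, ← ContinuousAlternatingMap.alternatizeUncurryFinCLM_apply, map_sum]
  rfl

theorem extDeriv_const_smul {k : ℕ} (c : ℝ) (η : V → V [⋀^Fin k]→L[ℝ] ℝ) (u : V) :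
    extDeriv (fun u => c • η u) u = c • extDeriv η u :=
  extDeriv_fun_smul c η

theorem neg_one_smul' {k : ℕ} (α : V [⋀^Fin k]→L[ℝ] ℝ) : (-1 : ℝ) • α = -α :=
  neg_one_smul ℝ α

theorem extDeriv_const {k : ℕ} (c : V [⋀^Fin k]→L[ℝ] ℝ) (u : V) :
    extDeriv (fun _ : V => c) u = 0 := by
  rw [extDeriv, fderiv_fun_const]
  exact map_zero (alternatizeUncurryFinCLM ℝ V ℝ)

theorem contDiff_wedge [FiniteDimensional ℝ V] (k l M : ℕ) : ContDiff ℝ ∞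
    (fun x : (V [⋀^Fin k]→L[ℝ] ℝ) × (V [⋀^Fin l]→L[ℝ] ℝ) => wedge M x.1 x.2) :=
  (wedgeL (V := V) k l M).isBoundedBilinearMap.contDiff

theorem contDiffOn_wedge [FiniteDimensional ℝ V] {k l : ℕ} (M : ℕ) {α : X → V [⋀^Fin k]→L[ℝ] ℝ}
    {β : X → V [⋀^Fin l]→L[ℝ] ℝ} {s : Set X}
    (hα : ContDiffOn ℝ ∞ α s) (hβ : ContDiffOn ℝ ∞ β s) :
    ContDiffOn ℝ ∞ (fun u => wedge M (α u) (β u)) s :=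
  (contDiff_wedge k l M).comp_contDiffOn (f := fun u => (α u, β u)) (hα.prodMk hβ)

theorem differentiableAt_wedge [FiniteDimensional ℝ V] {k l : ℕ} (M : ℕ)
    {α : X → V [⋀^Fin k]→L[ℝ] ℝ} {β : X → V [⋀^Fin l]→L[ℝ] ℝ} {u : X}
    (hα : DifferentiableAt ℝ α u) (hβ : DifferentiableAt ℝ β u) :
    DifferentiableAt ℝ (fun u => wedge M (α u) (β u)) u := by
  exact ((wedgeL (V := V) k l M).hasFDerivAt_of_bilinear hα.hasFDerivAt
    hβ.hasFDerivAt).differentiableAt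

theorem contDiffOn_contract {k : ℕ} {ξ : X → V} {α : X → V [⋀^Fin k]→L[ℝ] ℝ} {s : Set X}
    (hξ : ContDiffOn ℝ ∞ ξ s) (hα : ContDiffOn ℝ ∞ α s) :
    ContDiffOn ℝ ∞ (fun u => contract (ξ u) (α u)) s := by
  cases k with
  | zero => exact contDiffOn_const
  | succ k => exact ((interiorL V k).contDiff.comp_contDiffOn hα).clm_apply hξ

theorem contDiffOn_extDeriv {k : ℕ} {η : V → V [⋀^Fin k]→L[ℝ] ℝ} {s : Set V} (hs : IsOpen s)
    (h : ContDiffOn ℝ ∞ η s) : ContDiffOn ℝ ∞ (extDeriv η) s :=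
  (alternatizeUncurryFinCLM ℝ V ℝ).contDiff.comp_contDiffOn (h.fderiv_of_isOpen hs (by simp))

end FormCalculus

theorem minSmoothness_infty : minSmoothness ℝ 2 ≤ (∞ : WithTop ℕ∞) := by
  rw [minSmoothness_of_isRCLikeNormedField]
  exact ENat.LEInfty.out

/-! ### The canonical forms in a bundle chart -/

section LocalForms

open ContinuousAlternatingMap (alternatizeUncurryFin alternatizeUncurryFinCLM)

variable {E G : Type*} [NormedAddCommGroup E] [NormedSpace ℝ E]
  [NormedAddCommGroup G] [NormedSpace ℝ G]

theorem contDiff_horL_clm {k : ℕ} (T : G →L[ℝ] E [⋀^Fin k]→L[ℝ] ℝ) :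
    ContDiff ℝ ∞ (fun u : E × G => horL E G k (T u.2)) :=
  (horL E G k).contDiff.comp (T.contDiff.comp contDiff_snd)

theorem contDiffOn_horL {X : Type*} [NormedAddCommGroup X] [NormedSpace ℝ X] {k : ℕ}
    {Q : X → E [⋀^Fin k]→L[ℝ] ℝ} {s : Set X} (hQ : ContDiffOn ℝ ∞ Q s) :
    ContDiffOn ℝ ∞ (fun u => horL E G k (Q u)) s :=
  (horL E G k).contDiff.comp_contDiffOn hQ

theorem contDiffOn_horL_contract {k : ℕ} (T : G →L[ℝ] E [⋀^Fin k]→L[ℝ] ℝ)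
    {ξ : E → E} {s : Set E} (hξ : ContDiffOn ℝ ∞ ξ s) :
    ContDiffOn ℝ ∞ (fun u : E × G => horL E G (k - 1) (contract (ξ u.1) (T u.2)))
      (Prod.fst ⁻¹' s) :=
  (horL E G _).contDiff.comp_contDiffOn (contDiffOn_contract
    (hξ.comp contDiff_fst.contDiffOn fun _ h => h) (T.contDiff.comp contDiff_snd).contDiffOn)

variable {κ : Type*} [Fintype κ] {dp dy : κ → ℕ} {N : ℕ}
  (P : ∀ A, G →L[ℝ] E [⋀^Fin (dp A)]→L[ℝ] ℝ) (Y : ∀ A, G →L[ℝ] E [⋀^Fin (dy A)]→L[ℝ] ℝ)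
  (Z : G →L[ℝ] E [⋀^Fin (N + 1)]→L[ℝ] ℝ)

/-- The Cartan–Poincaré form in a bundle chart. -/
def thetaLoc (u : E × G) : (E × G) [⋀^Fin (N + 1)]→L[ℝ] ℝ :=
  (∑ A, (-1 : ℝ) ^ (dp A + 1) • wedge (N + 1) (horL E G _ (P A u.2)) (dTaut (Y A)))
  + horL E G _ (Z u.2)

/-- The multisymplectic form in a bundle chart, a constant form. -/
def omegaLoc : (E × G) [⋀^Fin (N + 2)]→L[ℝ] ℝ :=
  -((∑ A, (-1 : ℝ) ^ (dp A + 1) • wedge (N + 2) (dTaut (P A)) (dTaut (Y A))) + dTaut Z)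

/-- The pairing of two vertical vectors. -/
def pairingLoc (N : ℕ) (b b' : G) : E [⋀^Fin N]→L[ℝ] ℝ :=
  ∑ A, (wedge N (P A b) (Y A b') - wedge N (P A b') (Y A b))

/-- The Noether current in a bundle chart. -/
def noetherLoc (ξ : E → E) (u : E × G) : (E × G) [⋀^Fin N]→L[ℝ] ℝ :=
  (∑ A, ((-1 : ℝ) ^ (dp A + 1) • wedge N (horL E G _ (contract (ξ u.1) (P A u.2))) (dTaut (Y A))
      + wedge N (horL E G _ (P A u.2))
        (extDeriv (fun u : E × G => horL E G _ (contract (ξ u.1) (Y A u.2))) u)))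
  + horL E G _ (interior (ξ u.1) (Z u.2))

variable [FiniteDimensional ℝ E] [FiniteDimensional ℝ G]

theorem contDiff_thetaLoc : ContDiff ℝ ∞ (thetaLoc P Y Z) := by
  refine ContDiff.add (ContDiff.sum fun A _ => ?_) (contDiff_horL_clm _)
  have h := contDiffOn_univ.1 (contDiffOn_wedge (V := E × G) (N + 1)
    (contDiff_horL_clm (P A)).contDiffOn (contDiffOn_const (c := dTaut (Y A))))
  exact h.const_smul _

omit [FiniteDimensional ℝ E] [FiniteDimensional ℝ G] in
theorem differentiableAt_horL_clm {k : ℕ} (T : G →L[ℝ] E [⋀^Fin k]→L[ℝ] ℝ) (u : E × G) :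
    DifferentiableAt ℝ (fun u : E × G => horL E G k (T u.2)) u :=
  (contDiff_horL_clm T).differentiable (by simp) u

/-- The forms `dTaut (Y A)` are constant, so the Leibniz rule differentiates only the momenta and h,
whose differentials are constant as well. -/
theorem extDeriv_thetaLoc (u : E × G) : -extDeriv (thetaLoc P Y Z) u = omegaLoc P Y Z := by
  have hw : ∀ A, DifferentiableAt ℝ (fun u : E × G => (-1 : ℝ) ^ (dp A + 1) •
      wedge (N + 1) (horL E G _ (P A u.2)) (dTaut (Y A))) u := fun A =>
    (differentiableAt_wedge _ (differentiableAt_horL_clm _ u) (differentiableAt_const _)).fun_const_smul _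
  rw [omegaLoc]
  congr 1
  have e : thetaLoc P Y Z = fun u => (∑ A, (-1 : ℝ) ^ (dp A + 1) •
    wedge (N + 1) (horL E G _ (P A u.2)) (dTaut (Y A))) + horL E G _ (Z u.2) := rfl
  rw [e, extDeriv_fun_add (DifferentiableAt.fun_sum fun A _ => hw A) (differentiableAt_horL_clm _ u),
    extDeriv_taut, extDeriv_sum _ fun A _ => hw A]
  congr 1
  refine Finset.sum_congr rfl fun A _ => ?_
  rw [extDeriv_const_smul, extDeriv_wedge _ (differentiableAt_horL_clm _ u) (differentiableAt_const _),
    extDeriv_taut, extDeriv_const, wedge_zero_right, smul_zero, add_zero]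

theorem interior_vertical_omegaLoc (b : G) :
    interior ((0, b) : E × G) (omegaLoc P Y Z) =
      -((∑ A, ((-1 : ℝ) ^ (dp A + 1) • wedge (N + 1) (horL E G _ (P A b)) (dTaut (Y A)) +
        wedge (N + 1) (dTaut (P A)) (horL E G _ (Y A b)))) + horL E G _ (Z b)) := by
  rw [omegaLoc, interior_neg, interior_add, interior_sum, interior_vertical_dTaut]
  congr 2
  refine Finset.sum_congr rfl fun A _ => ?_
  have hs : (-1 : ℝ) ^ (dp A + 1) * (-1 : ℝ) ^ (dp A + 1) = 1 := by
    rw [← mul_pow]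
    simp
  rw [interior_smul, interior_wedge, smul_add, smul_smul, hs, one_smul]
  congr 2
  · congr 1
    exact interior_vertical_dTaut (P A) b
  · exact interior_vertical_dTaut (Y A) b

/-- Of the factors dp and dy each must absorb one of the vertical vectors, and the h-term dies at
the second contraction. The prefactors (−1)^(deg p_A + 1) in θ are chosen so that the Koszul signs
reduce to a plain antisymmetric expression. -/
theorem interior_interior_vertical_omegaLoc (b b' : G) :
    interior ((0, b') : E × G) (interior ((0, b) : E × G) (omegaLoc P Y Z)) =
      horL E G _ (pairingLoc P Y N b b') := by
  rw [interior_vertical_omegaLoc, interior_neg, interior_add, interior_sum, interior_vertical_horL,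
    add_zero, pairingLoc, map_sum, ← Finset.sum_neg_distrib]
  refine Finset.sum_congr rfl fun A _ => ?_
  have hs : (-1 : ℝ) ^ (dp A + 1) * (-1 : ℝ) ^ (dp A) = -1 := by
    rw [pow_succ, mul_right_comm, ← mul_pow]
    simp
  have e1 : contract ((0, b') : E × G) (dTaut (P A)) = horL E G _ (P A b') :=
    interior_vertical_dTaut (P A) b'
  have e2 : contract ((0, b') : E × G) (dTaut (Y A)) = horL E G _ (Y A b') :=
    interior_vertical_dTaut (Y A) b'
  rw [interior_add, interior_smul, interior_wedge, interior_wedge, contract_vertical_horL,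
    contract_vertical_horL, wedge_zero_left, wedge_zero_right, smul_zero, zero_add, add_zero,
    smul_smul, hs, e1, e2, map_sub, neg_one_smul', neg_add, neg_neg, ← sub_eq_add_neg]
  congr 1
  · exact (wedge_comp _ _ _ _).symm
  · exact (wedge_comp _ _ _ _).symm

theorem contDiffOn_noetherLoc {ξ : E → E} {s : Set E} (hs : IsOpen s) (hξ : ContDiffOn ℝ ∞ ξ s) :
    ContDiffOn ℝ ∞ (noetherLoc P Y Z ξ) (Prod.fst ⁻¹' s) := by
  have hs' : IsOpen (Prod.fst ⁻¹' s : Set (E × G)) := hs.preimage continuous_fst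
  refine ContDiffOn.add (ContDiffOn.sum fun A _ => ContDiffOn.add ?_ ?_)
    (contDiffOn_horL_contract Z hξ)
  · have h := contDiffOn_wedge (V := E × G) N (contDiffOn_horL_contract (P A) hξ)
      (contDiffOn_const (c := dTaut (Y A)))
    exact h.const_smul _
  · exact contDiffOn_wedge (V := E × G) _ (contDiff_horL_clm (P A)).contDiffOn
      (contDiffOn_extDeriv hs' (contDiffOn_horL_contract (Y A) hξ))

/-- The canonical lift of a vector field `ξ` generates the Noether current. -/
theorem extDeriv_noetherLoc {ξ : E → E} {s : Set E} (hs : IsOpen s) (hξ : ContDiffOn ℝ ∞ ξ s)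
    {u : E × G} (hu : u.1 ∈ s) {b : G} (hP : ∀ A, P A b = -lieTerm (fderiv ℝ ξ u.1) (P A u.2))
    (hY : ∀ A, Y A b = -lieTerm (fderiv ℝ ξ u.1) (Y A u.2))
    (hZ : Z b = -lieTerm (fderiv ℝ ξ u.1) (Z u.2)) :
    extDeriv (noetherLoc P Y Z ξ) u = interior ((ξ u.1, b) : E × G) (omegaLoc P Y Z) := by
  have hs' : IsOpen (Prod.fst ⁻¹' s : Set (E × G)) := hs.preimage continuous_fst
  have hsn : (Prod.fst ⁻¹' s : Set (E × G)) ∈ 𝓝 u := hs'.mem_nhds hu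
  have hξd : DifferentiableAt ℝ ξ u.1 := (hξ.contDiffAt (hs.mem_nhds hu)).differentiableAt (by simp)
  have hC : ∀ {k : ℕ} (T : G →L[ℝ] E [⋀^Fin k]→L[ℝ] ℝ),
      ContDiffAt ℝ ∞ (fun u : E × G => horL E G (k - 1) (contract (ξ u.1) (T u.2))) u :=
    fun T => (contDiffOn_horL_contract T hξ).contDiffAt hsn
  have hC' : ∀ {k : ℕ} (T : G →L[ℝ] E [⋀^Fin k]→L[ℝ] ℝ),
      DifferentiableAt ℝ (fun u : E × G => horL E G (k - 1) (contract (ξ u.1) (T u.2))) u :=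
    fun T => (hC T).differentiableAt (by simp)
  have hD : ∀ {k : ℕ} (T : G →L[ℝ] E [⋀^Fin k]→L[ℝ] ℝ),
      DifferentiableAt ℝ (extDeriv (fun u : E × G => horL E G (k - 1) (contract (ξ u.1) (T u.2)))) u :=
    fun T => ((contDiffOn_extDeriv hs' (contDiffOn_horL_contract T hξ)).contDiffAt
      hsn).differentiableAt (by simp)
  have e : noetherLoc P Y Z ξ = fun u => (∑ A,
    ((-1 : ℝ) ^ (dp A + 1) • wedge N (horL E G _ (contract (ξ u.1) (P A u.2))) (dTaut (Y A))
      + wedge N (horL E G _ (P A u.2))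
        (extDeriv (fun u : E × G => horL E G _ (contract (ξ u.1) (Y A u.2))) u)))
    + horL E G _ (interior (ξ u.1) (Z u.2)) := rfl
  have h0 : ∀ A, DifferentiableAt ℝ (fun u : E × G =>
      wedge N (horL E G _ (contract (ξ u.1) (P A u.2))) (dTaut (Y A))) u :=
    fun A => (differentiableAt_wedge _ (hC' _) (differentiableAt_const _))
  have h1 : ∀ A, DifferentiableAt ℝ (fun u : E × G => (-1 : ℝ) ^ (dp A + 1) •
      wedge N (horL E G _ (contract (ξ u.1) (P A u.2))) (dTaut (Y A))) u :=
    fun A => (h0 A).fun_const_smul _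
  have h2 : ∀ A, DifferentiableAt ℝ (fun u : E × G =>
      wedge N (horL E G _ (P A u.2))
        (extDeriv (fun u : E × G => horL E G _ (contract (ξ u.1) (Y A u.2))) u)) u :=
    fun A => differentiableAt_wedge _ (differentiableAt_horL_clm _ u) (hD _)
  rw [e, extDeriv_fun_add (DifferentiableAt.fun_sum fun A _ => (h1 A).fun_add (h2 A)) (show DifferentiableAt ℝ
      (fun u : E × G => horL E G N (interior (ξ u.1) (Z u.2))) u from hC' Z),
    extDeriv_sum _ fun A _ => (h1 A).fun_add (h2 A), omegaLoc, interior_neg, interior_add, neg_add,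
    interior_sum, ← Finset.sum_neg_distrib]
  congr 1
  · refine Finset.sum_congr rfl fun A _ => ?_
    have hs : (-1 : ℝ) ^ (dp A + 1) * (-1 : ℝ) ^ (dp A + 1) = 1 := by
      rw [← mul_pow]
      simp
    -- The terms with d of dy or d of d(i_ξ y) vanish. What is left, d(i_ξ p) ∧ dy and dp ∧ d(i_ξ
    -- y), becomes the two halves of the contraction of dp ∧ dy with the lift.
    rw [extDeriv_fun_add (h1 A) (h2 A), extDeriv_const_smul, extDeriv_wedge _ (hC' _)
      (differentiableAt_const _), extDeriv_const, wedge_zero_right, smul_zero, add_zero,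
      extDeriv_wedge _ (differentiableAt_horL_clm _ u) (hD _),
      extDeriv_extDeriv_apply (hC _) minSmoothness_infty, wedge_zero_right,
      smul_zero, add_zero, interior_smul, interior_wedge, smul_add, smul_smul, hs, one_smul,
      extDeriv_taut, wedge_extDeriv_contract_left _ _ hξd (hP A),
      wedge_extDeriv_contract_right _ _ hξd (hY A), smul_neg, neg_add]
  · exact extDeriv_horL_interior Z hξd hZ

omit [FiniteDimensional ℝ E] [FiniteDimensional ℝ G] in
theorem extDeriv_horL {k : ℕ} {Q : E × G → E [⋀^Fin k]→L[ℝ] ℝ} {u : E × G}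
    (hQ : DifferentiableAt ℝ Q u) : extDeriv (fun u => horL E G k (Q u)) u =
      alternatizeUncurryFin ((horL E G k).comp (fderiv ℝ Q u)) := by
  rw [extDeriv]
  congr 1
  exact ((horL E G k).hasFDerivAt.comp u hQ.hasFDerivAt).fderiv

omit [FiniteDimensional ℝ E] [FiniteDimensional ℝ G] in
theorem VertFilt.horL {k : ℕ} (α : E [⋀^Fin k]→L[ℝ] ℝ) : VertFilt 1 (DJet.horL E G k α) := by
  cases k with
  | zero => exact trivial
  | succ k => exact fun b => interior_vertical_horL b α

omit [FiniteDimensional ℝ E] [FiniteDimensional ℝ G] in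
theorem interior_vertical_alternatizeUncurryFin {k : ℕ}
    (B : (E × G) →L[ℝ] (E × G) [⋀^Fin k]→L[ℝ] ℝ) (hB : ∀ w, VertFilt 1 (B w)) (b : G) :
    interior ((0, b) : E × G) (alternatizeUncurryFin B) = B (0, b) := by
  cases k with
  | zero =>
    ext w
    rw [interior_apply, ContinuousAlternatingMap.alternatizeUncurryFin_apply]
    simp
  | succ k =>
    rw [interior_alternatizeUncurryFin]
    have : ((interiorL (E × G) k).flip ((0, b) : E × G)).comp B = 0 :=
      ContinuousLinearMap.ext fun w => hB w b
    rw [this, ← ContinuousAlternatingMap.alternatizeUncurryFinCLM_apply, map_zero, sub_zero]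

omit [FiniteDimensional ℝ E] [FiniteDimensional ℝ G] in
theorem interior_vertical_extDeriv_horL {k : ℕ} {Q : E × G → E [⋀^Fin k]→L[ℝ] ℝ} {u : E × G}
    (hQ : DifferentiableAt ℝ Q u) (δ : G) :
    interior ((0, δ) : E × G) (extDeriv (fun u => horL E G k (Q u)) u) =
      horL E G k (fderiv ℝ Q u (0, δ)) := by
  rw [extDeriv_horL hQ]
  exact interior_vertical_alternatizeUncurryFin _ (fun w => VertFilt.horL _) δ

/-- The vertical derivative of a horizontal form `Q` with `dQ = i_b ω`. -/
theorem fderiv_vertical_of_extDeriv {Q : E × G → E [⋀^Fin N]→L[ℝ] ℝ} {u : E × G}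
    (hQ : DifferentiableAt ℝ Q u) {b : G}
    (h : extDeriv (fun u => horL E G _ (Q u)) u = interior ((0, b) : E × G) (omegaLoc P Y Z))
    (δ : G) : fderiv ℝ Q u (0, δ) = pairingLoc P Y N b δ := by
  apply horL_injective (G := G)
  rw [← interior_interior_vertical_omegaLoc (Z := Z), ← h, interior_vertical_extDeriv_horL hQ]

theorem vertFilt_interior_omegaLoc (b : G) :
    VertFilt 2 (interior ((0, b) : E × G) (omegaLoc P Y Z)) := by
  intro b₁
  rw [interior_interior_vertical_omegaLoc]
  exact VertFilt.horL _

/-- Three contractions of `d(i_v ω)` with vertical vectors, for a constant form `ω`. -/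
theorem interior_vertical_extDeriv_omegaLoc {N : ℕ} (Z : G →L[ℝ] E [⋀^Fin (N + 2)]→L[ℝ] ℝ)
    {v : E × G → E × G} {u : E × G}
    (hv : DifferentiableAt ℝ v u) (h : extDeriv (fun u => interior (v u) (omegaLoc P Y Z)) u = 0)
    (b₁ b₂ b₃ : G) :
    interior (fderiv ℝ v u (0, b₁)).1 (pairingLoc P Y (N + 1) b₂ b₃) -
      interior (fderiv ℝ v u (0, b₂)).1 (pairingLoc P Y (N + 1) b₁ b₃) +
      interior (fderiv ℝ v u (0, b₃)).1 (pairingLoc P Y (N + 1) b₁ b₂) = 0 := by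
  have h1 : extDeriv (fun u => interior (v u) (omegaLoc P Y Z)) u =
      alternatizeUncurryFin ((interiorL (E × G) (N + 2) (omegaLoc P Y Z)).comp (fderiv ℝ v u)) := by
    rw [extDeriv]
    congr 1
    exact ((interiorL (E × G) (N + 2) (omegaLoc P Y Z)).hasFDerivAt.comp u hv.hasFDerivAt).fderiv
  rw [h1] at h
  -- Two anticommutations, whose signs cancel, bring x to the outside. There it acts on a horizontal
  -- form, so only its base component counts.
  have key : ∀ (c : G) (x : E × G) (c' : G), interior ((0, c') : E × G)
      (interior ((0, c) : E × G) (interior x (omegaLoc P Y Z))) =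
      horL E G _ (interior x.1 (pairingLoc P Y (N + 1) c c')) := by
    intro c x c'
    rw [interior_interior_swap _ x, interior_neg, interior_interior_swap _ x, neg_neg,
      interior_interior_vertical_omegaLoc, interior_horL]
  apply horL_injective (G := G)
  set A := (interiorL (E × G) (N + 2) (omegaLoc P Y Z)).comp (fderiv ℝ v u) with hA
  have hA' : ∀ w, A w = interior (fderiv ℝ v u w) (omegaLoc P Y Z) := fun w => rfl
  rw [map_zero, map_add, map_sub, ← key, ← key, ← key, ← hA', ← hA', ← hA']
  -- Cartan's formula strips off b₁, b₂, b₃ in turn and produces the alternating sum of derivatives.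
  -- The last contraction has no correction term because the form is already horizontal after two.
  have h2 := congrArg (fun β => interior ((0, b₃) : E × G) (interior ((0, b₂) : E × G)
    (interior ((0, b₁) : E × G) β))) h
  simp only [interior_zero] at h2
  have sub' : ∀ {k : ℕ} (x : E × G) (α β : (E × G) [⋀^Fin (k + 1)]→L[ℝ] ℝ),
    interior x (α - β) = interior x α - interior x β := fun x α β => rfl
  rw [interior_alternatizeUncurryFin, sub', interior_alternatizeUncurryFin, sub', sub',
    interior_vertical_alternatizeUncurryFin] at h2
  · rw [← h2]
    change _ = _ - (_ - _)
    rw [sub_sub_eq_add_sub, sub_add_eq_add_sub]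
    rfl
  · intro w
    have : (((interiorL (E × G) N).flip ((0, b₂) : E × G)).comp
      (((interiorL (E × G) (N + 1)).flip ((0, b₁) : E × G)).comp A)) w =
      horL E G _ (interior (fderiv ℝ v u w).1 (pairingLoc P Y (N + 1) b₁ b₂)) := key _ _ _
    rw [this]
    exact VertFilt.horL _

end LocalForms


/-! ### Integrals depending on parameters -/

section ParametricIntegral

open MeasureTheory

universe u

variable {X : Type u} [NormedAddCommGroup X] [NormedSpace ℝ X] [FiniteDimensional ℝ X]

/-- Differentiation under the integral sign; the constant bound comes from compactness of [0, 1]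
times a closed ball inside Ω. -/
theorem hasFDerivAt_integral_unitInterval {Z : Type*} [NormedAddCommGroup Z] [NormedSpace ℝ Z]
    [CompleteSpace Z] {Ω : Set X} (hΩ : IsOpen Ω) {F : ℝ × X → Z}
    (hF : ContDiffOn ℝ ∞ F (Prod.snd ⁻¹' Ω)) {u : X} (hu : u ∈ Ω) :
    HasFDerivAt (fun u => ∫ t in (0 : ℝ)..1, F (t, u))
      (∫ t in (0 : ℝ)..1, (fderiv ℝ F (t, u)).comp (ContinuousLinearMap.inr ℝ ℝ X)) u := by
  have hO : IsOpen (Prod.snd ⁻¹' Ω : Set (ℝ × X)) := hΩ.preimage continuous_snd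
  have hF' : ContinuousOn (fun p => (fderiv ℝ F p).comp (ContinuousLinearMap.inr ℝ ℝ X))
      (Prod.snd ⁻¹' Ω) :=
    (hF.continuousOn_fderiv_of_isOpen hO (by simp)).clm_comp continuousOn_const
  have hline : ∀ x ∈ Ω, Continuous fun t : ℝ => F (t, x) := fun x hx =>
    continuousOn_univ.1 (hF.continuousOn.comp (Continuous.prodMk_left x).continuousOn fun _ _ => hx)
  have hline' : Continuous fun t : ℝ =>
      (fderiv ℝ F (t, u)).comp (ContinuousLinearMap.inr ℝ ℝ X) :=
    continuousOn_univ.1 (hF'.comp (Continuous.prodMk_left u).continuousOn fun _ _ => hu)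
  obtain ⟨r, hr, hball⟩ := Metric.nhds_basis_closedBall.mem_iff.1 (hΩ.mem_nhds hu)
  have hK : IsCompact (Icc (0 : ℝ) 1 ×ˢ Metric.closedBall u r) :=
    isCompact_Icc.prod (isCompact_closedBall u r)
  obtain ⟨C, hC⟩ := hK.exists_bound_of_continuousOn (hF'.mono fun p hp => hball hp.2)
  refine intervalIntegral.hasFDerivAt_integral_of_dominated_of_fderiv_le
    (F' := fun x t => (fderiv ℝ F (t, x)).comp (ContinuousLinearMap.inr ℝ ℝ X))
    (bound := fun _ => C) (Metric.closedBall_mem_nhds u hr) ?_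
    ((hline u hu).intervalIntegrable 0 1) hline'.aestronglyMeasurable ?_
    intervalIntegrable_const ?_
  · filter_upwards [hΩ.mem_nhds hu] with x hx using (hline x hx).aestronglyMeasurable
  · refine Filter.Eventually.of_forall fun t ht x hx => hC (t, x) ⟨?_, hx⟩
    rw [uIoc_of_le zero_le_one] at ht
    exact ⟨ht.1.le, ht.2⟩
  · refine Filter.Eventually.of_forall fun t ht x hx => ?_
    have h1 : HasFDerivAt F (fderiv ℝ F (t, x)) (t, x) :=
      ((hF.contDiffAt (hO.mem_nhds (hball hx))).differentiableAt (by simp)).hasFDerivAt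
    exact h1.comp x (hasFDerivAt_prodMk_right t x)

/-- The derivative is again such an integral, with values in X →L[ℝ] Z. Induction on the order
therefore runs over all targets Z at once, and Z has to share the universe of X. -/
theorem contDiffOn_integral_unitInterval {Z : Type u} [NormedAddCommGroup Z] [NormedSpace ℝ Z]
    [CompleteSpace Z] {Ω : Set X} (hΩ : IsOpen Ω) {F : ℝ × X → Z}
    (hF : ContDiffOn ℝ ∞ F (Prod.snd ⁻¹' Ω)) :
    ContDiffOn ℝ ∞ (fun u => ∫ t in (0 : ℝ)..1, F (t, u)) Ω := by
  have hO : IsOpen (Prod.snd ⁻¹' Ω : Set (ℝ × X)) := hΩ.preimage continuous_snd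
  refine contDiffOn_infty.2 fun n => ?_
  induction n generalizing Z with
  | zero =>
    exact contDiffOn_zero.2 fun u hu =>
      (hasFDerivAt_integral_unitInterval hΩ hF hu).continuousAt.continuousWithinAt
  | succ n ih =>
    push_cast
    refine (contDiffOn_succ_iff_fderiv_of_isOpen hΩ).2 ⟨fun u hu =>
      (hasFDerivAt_integral_unitInterval hΩ hF hu).differentiableAt.differentiableWithinAt,
      fun h => by simp at h, ?_⟩
    refine (ih (F := fun p => (fderiv ℝ F p).comp (ContinuousLinearMap.inr ℝ ℝ X))
      ((hF.fderiv_of_isOpen hO (by simp)).clm_comp contDiffOn_const)).congr fun u hu => ?_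
    exact (hasFDerivAt_integral_unitInterval hΩ hF hu).fderiv

theorem map_integral_unitInterval {A B : Type*} [NormedAddCommGroup A] [NormedSpace ℝ A]
    [CompleteSpace A] [NormedAddCommGroup B] [NormedSpace ℝ B] [CompleteSpace B]
    (L : A →L[ℝ] B) {f : ℝ → A} (hf : Continuous f) :
    L (∫ t in (0 : ℝ)..1, f t) = ∫ t in (0 : ℝ)..1, L (f t) :=
  (L.intervalIntegral_comp_comm (hf.intervalIntegrable 0 1)).symm

end ParametricIntegral

/-! ### Fibre integration and the homotopy formula -/

section Homotopy

open ContinuousAlternatingMap (alternatizeUncurryFin alternatizeUncurryFinCLM)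

universe u

variable {X : Type u} [NormedAddCommGroup X] [NormedSpace ℝ X]

/-- Restriction of forms on `ℝ × X` to the slices `{t} × X`. -/
def sliceL (X : Type*) [NormedAddCommGroup X] [NormedSpace ℝ X] (k : ℕ) :
    ((ℝ × X) [⋀^Fin k]→L[ℝ] ℝ) →L[ℝ] X [⋀^Fin k]→L[ℝ] ℝ :=
  ContinuousAlternatingMap.compContinuousLinearMapCLM (ContinuousLinearMap.inr ℝ ℝ X)

/-- The `dt`-component of a form on `ℝ × X`, integrated over the unit interval. -/
def fibreIntegral {k : ℕ} (γ : ℝ × X → (ℝ × X) [⋀^Fin (k + 1)]→L[ℝ] ℝ) (u : X) :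
    X [⋀^Fin k]→L[ℝ] ℝ :=
  ∫ t in (0 : ℝ)..1, sliceL X k (interior ((1, 0) : ℝ × X) (γ (t, u)))

theorem contDiffOn_sliceL_interior {k : ℕ} {s : Set (ℝ × X)}
    {γ : ℝ × X → (ℝ × X) [⋀^Fin (k + 1)]→L[ℝ] ℝ} (hγ : ContDiffOn ℝ ∞ γ s) :
    ContDiffOn ℝ ∞ (fun p => sliceL X k (interior ((1, 0) : ℝ × X) (γ p))) s :=
  ((sliceL X k).comp ((interiorL (ℝ × X) k).flip ((1, 0) : ℝ × X))).contDiff.comp_contDiffOn hγ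

variable [FiniteDimensional ℝ X]

theorem contDiffOn_fibreIntegral {k : ℕ} {Ω : Set X} (hΩ : IsOpen Ω)
    {γ : ℝ × X → (ℝ × X) [⋀^Fin (k + 1)]→L[ℝ] ℝ} (hγ : ContDiffOn ℝ ∞ γ (Prod.snd ⁻¹' Ω)) :
    ContDiffOn ℝ ∞ (fibreIntegral γ) Ω :=
  contDiffOn_integral_unitInterval hΩ (contDiffOn_sliceL_interior hγ)

/-- The t-derivative of the slice of γ is, by Cartan's formula for ∂_t, the sum of d(i_{∂_t} γ) and
i_{∂_t} dγ restricted to the slice. Integration over the unit interval gives the homotopy formula.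
-/
theorem extDeriv_fibreIntegral {k : ℕ} {Ω : Set X} (hΩ : IsOpen Ω)
    {γ : ℝ × X → (ℝ × X) [⋀^Fin (k + 1)]→L[ℝ] ℝ} (hγ : ContDiffOn ℝ ∞ γ (Prod.snd ⁻¹' Ω))
    {u : X} (hu : u ∈ Ω) :
    extDeriv (fibreIntegral γ) u + fibreIntegral (extDeriv γ) u =
      sliceL X (k + 1) (γ (1, u)) - sliceL X (k + 1) (γ (0, u)) := by
  have hO : IsOpen (Prod.snd ⁻¹' Ω : Set (ℝ × X)) := hΩ.preimage continuous_snd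
  set c : ℝ × X → X [⋀^Fin k]→L[ℝ] ℝ := fun p => sliceL X k (interior ((1, 0) : ℝ × X) (γ p))
    with hc
  have hcs : ContDiffOn ℝ ∞ c (Prod.snd ⁻¹' Ω) := contDiffOn_sliceL_interior hγ
  have hdγ : ContDiffOn ℝ ∞ (extDeriv γ) (Prod.snd ⁻¹' Ω) := contDiffOn_extDeriv hO hγ
  have hd : ∀ t : ℝ, HasFDerivAt γ (fderiv ℝ γ (t, u)) (t, u) := fun t =>
    ((hγ.contDiffAt (hO.mem_nhds hu)).differentiableAt (by simp)).hasFDerivAt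
  have hcd : ∀ t : ℝ, fderiv ℝ c (t, u) = ((sliceL X k).comp
      ((interiorL (ℝ × X) k).flip ((1, 0) : ℝ × X))).comp (fderiv ℝ γ (t, u)) := fun t =>
    (((sliceL X k).comp ((interiorL (ℝ × X) k).flip ((1, 0) : ℝ × X))).hasFDerivAt.comp (t, u)
      (hd t)).fderiv
  have hcont : Continuous fun t : ℝ =>
      (fderiv ℝ c (t, u)).comp (ContinuousLinearMap.inr ℝ ℝ X) :=
    continuousOn_univ.1 (((hcs.continuousOn_fderiv_of_isOpen hO (by simp)).clm_comp
      continuousOn_const).comp (Continuous.prodMk_left u).continuousOn fun _ _ => hu)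
  have e1 : extDeriv (fibreIntegral γ) u = ∫ t in (0 : ℝ)..1, alternatizeUncurryFin
      ((fderiv ℝ c (t, u)).comp (ContinuousLinearMap.inr ℝ ℝ X)) := by
    have h : fderiv ℝ (fibreIntegral γ) u = _ :=
      (hasFDerivAt_integral_unitInterval hΩ hcs hu).fderiv
    rw [extDeriv, h]
    exact map_integral_unitInterval (A := X →L[ℝ] X [⋀^Fin k]→L[ℝ] ℝ)
      (B := X [⋀^Fin (k + 1)]→L[ℝ] ℝ) (alternatizeUncurryFinCLM ℝ X ℝ) hcont
  have hcont2 : Continuous fun t : ℝ => sliceL X (k + 1) (interior ((1, 0) : ℝ × X)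
      (extDeriv γ (t, u))) := continuousOn_univ.1
    ((contDiffOn_sliceL_interior hdγ).continuousOn.comp
      (Continuous.prodMk_left u).continuousOn fun _ _ => hu)
  have hcont1 : Continuous fun t : ℝ => alternatizeUncurryFin
      ((fderiv ℝ c (t, u)).comp (ContinuousLinearMap.inr ℝ ℝ X)) :=
    (alternatizeUncurryFinCLM ℝ X ℝ).continuous.comp hcont
  have key : ∀ t : ℝ, HasDerivAt (fun t => sliceL X (k + 1) (γ (t, u)))
      (alternatizeUncurryFin ((fderiv ℝ c (t, u)).comp (ContinuousLinearMap.inr ℝ ℝ X)) +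
        sliceL X (k + 1) (interior ((1, 0) : ℝ × X) (extDeriv γ (t, u)))) t := by
    intro t
    have h1 : HasDerivAt (fun t => sliceL X (k + 1) (γ (t, u)))
        (sliceL X (k + 1) (fderiv ℝ γ (t, u) (1, 0))) t :=
      (sliceL X (k + 1)).hasFDerivAt.comp_hasDerivAt t
        ((hd t).comp_hasDerivAt t ((hasDerivAt_id t).prodMk (hasDerivAt_const t u)))
    convert h1 using 1
    have h2 : alternatizeUncurryFin ((fderiv ℝ c (t, u)).comp (ContinuousLinearMap.inr ℝ ℝ X)) =
        sliceL X (k + 1) (alternatizeUncurryFin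
          (((interiorL (ℝ × X) k).flip ((1, 0) : ℝ × X)).comp (fderiv ℝ γ (t, u)))) := by
      rw [hcd]
      ext w
      simp only [sliceL, ContinuousAlternatingMap.alternatizeUncurryFin_apply,
        ContinuousAlternatingMap.compContinuousLinearMapCLM_apply,
        ContinuousAlternatingMap.compContinuousLinearMap_apply]
      rfl
    rw [extDeriv, interior_alternatizeUncurryFin, map_sub, h2]
    exact add_sub_cancel _ _
  rw [e1]
  have h2 := intervalIntegral.integral_eq_sub_of_hasDerivAt (a := 0) (b := 1) (fun t _ => key t)
    ((hcont1.add hcont2).intervalIntegrable 0 1)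
  rw [intervalIntegral.integral_add (hcont1.intervalIntegrable 0 1)
    (hcont2.intervalIntegrable 0 1)] at h2
  exact h2

/-- A linear map V → V' is treated as an endomorphism of V × V', to which `contDiff_compCLM`
applies. -/
theorem contDiffOn_pullback {W V V' : Type*} [NormedAddCommGroup W] [NormedSpace ℝ W]
    [NormedAddCommGroup V] [NormedSpace ℝ V] [NormedAddCommGroup V'] [NormedSpace ℝ V'] {k : ℕ}
    {s : Set W} {L : W → V →L[ℝ] V'} {α : W → V' [⋀^Fin k]→L[ℝ] ℝ} (hL : ContDiffOn ℝ ∞ L s)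
    (hα : ContDiffOn ℝ ∞ α s) :
    ContDiffOn ℝ ∞ (fun x => (α x).compContinuousLinearMap (L x)) s := by
  let j : (V × V') [⋀^Fin k]→L[ℝ] ℝ →L[ℝ] V [⋀^Fin k]→L[ℝ] ℝ :=
    ContinuousAlternatingMap.compContinuousLinearMapCLM (ContinuousLinearMap.inl ℝ V V')
  let i : V' [⋀^Fin k]→L[ℝ] ℝ →L[ℝ] (V × V') [⋀^Fin k]→L[ℝ] ℝ :=
    ContinuousAlternatingMap.compContinuousLinearMapCLM (ContinuousLinearMap.snd ℝ V V')
  have h1 : ContDiffOn ℝ ∞ (fun x => (ContinuousLinearMap.inr ℝ V V').comp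
      ((L x).comp (ContinuousLinearMap.fst ℝ V V'))) s :=
    contDiffOn_const.clm_comp (hL.clm_comp contDiffOn_const)
  have h2 := ((contDiff_compCLM (E := V × V') k).comp_contDiffOn h1).clm_apply
    (i.contDiff.comp_contDiffOn hα)
  exact j.contDiff.comp_contDiffOn h2

end Homotopy

/-! ### Fibrewise contractions -/

section Contraction

open MeasureTheory

/-- Vertical contractions commute with the integral. -/
theorem VertFilt.integral {E G : Type*} [NormedAddCommGroup E] [NormedSpace ℝ E]
    [NormedAddCommGroup G] [NormedSpace ℝ G] : ∀ {p k : ℕ}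
    {f : ℝ → (E × G) [⋀^Fin k]→L[ℝ] ℝ} (_ : Continuous f) (_ : ∀ t, VertFilt p (f t)),
    VertFilt p (∫ t in (0 : ℝ)..1, f t)
  | 0, _, f, _, h => by
    have : f = fun _ => 0 := funext h
    rw [this]
    exact intervalIntegral.integral_zero
  | _ + 1, 0, _, _, _ => trivial
  | p + 1, k + 1, f, hf, h => fun b => by
    have hL := ((interiorL (E × G) k).flip ((0, b) : E × G)).intervalIntegral_comp_comm
      (hf.intervalIntegrable (μ := volume) 0 1)
    have h' : interior ((0, b) : E × G) (∫ t in (0 : ℝ)..1, f t) =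
        ∫ t in (0 : ℝ)..1, (interiorL (E × G) k).flip ((0, b) : E × G) (f t) := hL.symm
    rw [h']
    exact VertFilt.integral (((interiorL (E × G) k).flip ((0, b) : E × G)).continuous.comp hf)
      fun t => h t b

variable {E G : Type*} [NormedAddCommGroup E] [NormedSpace ℝ E] [FiniteDimensional ℝ E]
  [NormedAddCommGroup G] [NormedSpace ℝ G] [FiniteDimensional ℝ G]

/-- A smooth contraction of the fibres of the open set `Ω` over `E`. -/
structure IsFibreContraction (Ω : Set (E × G)) (H : ℝ × (E × G) → E × G) : Prop where
  isOpen : IsOpen Ω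
  contDiffOn : ContDiffOn ℝ ∞ H (Prod.snd ⁻¹' Ω)
  mapsTo : ∀ t, ∀ u ∈ Ω, H (t, u) ∈ Ω
  fst : ∀ t, ∀ u ∈ Ω, (H (t, u)).1 = u.1
  one : ∀ u ∈ Ω, H (1, u) = u
  zero : ∀ u ∈ Ω, ∀ u' ∈ Ω, u.1 = u'.1 → H (0, u) = H (0, u')

/-- The relative Poincaré lemma: a form that is closed up to the first step of the vertical
filtration is exact up to horizontal forms. -/
theorem IsFibreContraction.exists_primitive {Ω : Set (E × G)} {H : ℝ × (E × G) → E × G}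
    (hH : IsFibreContraction Ω H) {k p : ℕ} {β : E × G → (E × G) [⋀^Fin (k + 1)]→L[ℝ] ℝ}
    (hβ : ContDiffOn ℝ ∞ β Ω) (hd : ∀ u ∈ Ω, VertFilt 2 (extDeriv β u))
    (hp : ∀ u ∈ Ω, VertFilt (p + 1) (β u)) :
    ∃ α : E × G → (E × G) [⋀^Fin k]→L[ℝ] ℝ, ContDiffOn ℝ ∞ α Ω ∧
      ∀ u ∈ Ω, VertFilt p (α u) ∧ VertFilt 1 (β u - extDeriv α u) := by
  have hΩ := hH.isOpen
  have hO : IsOpen (Prod.snd ⁻¹' Ω : Set (ℝ × (E × G))) := hΩ.preimage continuous_snd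
  have hHd : ∀ t, ∀ u ∈ Ω, ContDiffAt ℝ ∞ H (t, u) := fun t u hu =>
    hH.contDiffOn.contDiffAt (hO.mem_nhds hu)
  have hHf : ∀ t, ∀ u ∈ Ω, HasFDerivAt H (fderiv ℝ H (t, u)) (t, u) := fun t u hu =>
    ((hHd t u hu).differentiableAt (by simp)).hasFDerivAt
  -- H covers the identity of the base. In particular its velocity is vertical, and its slices
  -- preserve vertical vectors.
  have hfst : ∀ t, ∀ u ∈ Ω, ∀ w, (fderiv ℝ H (t, u) w).1 = w.2.1 := by
    intro t u hu w
    have h1 : HasFDerivAt (fun p => (H p).1) _ (t, u) := (hHf t u hu).fst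
    have h2 : HasFDerivAt (fun p : ℝ × (E × G) => p.2.1) ((ContinuousLinearMap.fst ℝ E G).comp
      (ContinuousLinearMap.snd ℝ ℝ (E × G))) (t, u) := hasFDerivAt_snd.fst
    have h3 : (fun p => (H p).1) =ᶠ[𝓝 (t, u)] fun p => p.2.1 := by
      filter_upwards [hO.mem_nhds hu] with p hp using hH.fst p.1 p.2 hp
    exact DFunLike.congr_fun (h1.unique (h2.congr_of_eventuallyEq h3)) w
  -- The end map H(0, ·) is constant along a vertical line through u, so its vertical derivative is
  -- zero.
  have hzero : ∀ u ∈ Ω, ∀ b : G, fderiv ℝ H (0, u) (0, (0, b)) = 0 := by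
    intro u hu b
    have hc : Continuous fun s : ℝ => u + s • ((0, b) : E × G) := by fun_prop
    have h1 : HasDerivAt (fun s : ℝ => u + s • ((0, b) : E × G)) (0, b) 0 := by
      simpa using ((hasDerivAt_id (0 : ℝ)).smul_const ((0, b) : E × G)).const_add u
    have h2 : HasDerivAt (fun s : ℝ => H (0, u + s • ((0, b) : E × G)))
        (fderiv ℝ H (0, u) (0, (0, b))) 0 := by
      refine HasFDerivAt.comp_hasDerivAt (0 : ℝ) ?_ ((hasDerivAt_const (0 : ℝ) (0 : ℝ)).prodMk h1)
      simpa using hHf 0 u hu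
    have h3 : (fun s : ℝ => H (0, u + s • ((0, b) : E × G))) =ᶠ[𝓝 0] fun _ => H (0, u) := by
      have : (fun s : ℝ => u + s • ((0, b) : E × G)) ⁻¹' Ω ∈ 𝓝 (0 : ℝ) :=
        hc.continuousAt.preimage_mem_nhds (by simpa using hΩ.mem_nhds hu)
      filter_upwards [this] with s hs
      exact hH.zero _ hs u hu (by simp)
    exact h2.unique ((hasDerivAt_const _ _).congr_of_eventuallyEq h3)
  have hone : ∀ u ∈ Ω, ∀ w, fderiv ℝ H (1, u) (0, w) = w := by
    intro u hu w
    have h1 : HasFDerivAt (fun u => H (1, u)) _ u :=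
      (hHf 1 u hu).comp u (hasFDerivAt_prodMk_right 1 u)
    have h3 : (fun u => H (1, u)) =ᶠ[𝓝 u] fun u => u := by
      filter_upwards [hΩ.mem_nhds hu] with u hu using hH.one u hu
    exact DFunLike.congr_fun (h1.unique ((hasFDerivAt_id u).congr_of_eventuallyEq h3)) w
  have hpull : ∀ {l : ℕ} {η : E × G → (E × G) [⋀^Fin l]→L[ℝ] ℝ}, ContDiffOn ℝ ∞ η Ω →
      ContDiffOn ℝ ∞ (fun p => (η (H p)).compContinuousLinearMap (fderiv ℝ H p))
        (Prod.snd ⁻¹' Ω) := fun hη =>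
    contDiffOn_pullback (hH.contDiffOn.fderiv_of_isOpen hO (by simp))
      (hη.comp hH.contDiffOn fun p hp => hH.mapsTo p.1 p.2 hp)
  -- The velocity of H uses up one vertical argument, so the filtration index drops by one. This
  -- serves twice: for β it bounds the primitive, for dβ it makes the error horizontal.
  have hslice : ∀ {l q : ℕ} {η : E × G → (E × G) [⋀^Fin (l + 1)]→L[ℝ] ℝ},
      ContDiffOn ℝ ∞ η Ω → (∀ u ∈ Ω, VertFilt (q + 1) (η u)) → ∀ u ∈ Ω, VertFilt q (fibreIntegral
        (fun p => (η (H p)).compContinuousLinearMap (fderiv ℝ H p)) u) := by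
    intro l q η hη hq u hu
    refine VertFilt.integral (continuousOn_univ.1 ((contDiffOn_sliceL_interior
      (hpull hη)).continuousOn.comp (Continuous.prodMk_left u).continuousOn fun _ _ => hu)) ?_
    intro t
    have h1 : fderiv ℝ H (t, u) (1, 0) = (0, (fderiv ℝ H (t, u) (1, 0)).2) :=
      Prod.ext (hfst t u hu _) rfl
    rw [interior_comp, h1]
    refine VertFilt.comp (L := (fderiv ℝ H (t, u)).comp (ContinuousLinearMap.inr ℝ ℝ (E × G)))
      (fun b => hfst t u hu _) (hq _ (hH.mapsTo t u hu) _)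
  set γ : ℝ × (E × G) → (ℝ × (E × G)) [⋀^Fin (k + 1)]→L[ℝ] ℝ :=
    fun p => (β (H p)).compContinuousLinearMap (fderiv ℝ H p) with hγ
  refine ⟨fibreIntegral γ, contDiffOn_fibreIntegral hΩ (hpull hβ), fun u hu =>
    ⟨hslice hβ hp u hu, ?_⟩⟩
  have hdγ : ∀ t, extDeriv γ (t, u) =
      (extDeriv β (H (t, u))).compContinuousLinearMap (fderiv ℝ H (t, u)) := fun t =>
    extDeriv_pullback ((hβ.contDiffAt (hΩ.mem_nhds (hH.mapsTo t u hu))).differentiableAt (by simp))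
      (hHd t u hu) minSmoothness_infty
  have hI : fibreIntegral (extDeriv γ) u = fibreIntegral
      (fun p => (extDeriv β (H p)).compContinuousLinearMap (fderiv ℝ H p)) u := by
    simp only [fibreIntegral, hdγ]
  have key := extDeriv_fibreIntegral hΩ (hpull hβ) hu
  have e1 : sliceL (E × G) (k + 1) (γ (1, u)) = β u := by
    ext w
    change β (H (1, u)) (fun i => fderiv ℝ H (1, u) (0, w i)) = β u w
    simp only [hone u hu, hH.one u hu]
  rw [e1, hI] at key
  -- The homotopy formula, with naturality of d, writes the error as the fibre integral of the
  -- pullback of dβ plus the pullback of β under the end map.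
  have e2 : β u - extDeriv (fibreIntegral γ) u = fibreIntegral
      (fun p => (extDeriv β (H p)).compContinuousLinearMap (fderiv ℝ H p)) u +
      sliceL (E × G) (k + 1) (γ (0, u)) := by
    rw [sub_eq_iff_eq_add, add_right_comm, add_comm (fibreIntegral _ u), key, sub_add_cancel]
  rw [e2]
  refine VertFilt.add (hslice (contDiffOn_extDeriv hΩ hβ) hd u hu) fun b => ?_
  have h0 : interior ((0, b) : E × G) (sliceL (E × G) (k + 1) (γ (0, u))) = 0 := by
    ext w
    refine (β (H (0, u))).map_coord_zero 0 ?_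
    exact hzero u hu b
  exact h0

end Contraction


/-! ### Coordinate expressions of forms and vector fields -/

section LocalRep

variable {E : Type*} [NormedAddCommGroup E] [NormedSpace ℝ E] {H : Type*} [TopologicalSpace H]
  {I : ModelWithCorners ℝ E H} {N : Type*} [TopologicalSpace N] [ChartedSpace H N]

theorem localRep_congr {k : ℕ} {η η' : DForm I N k} {P₀ : N} {u : E}
    (h : η ((extChartAt I P₀).symm u) = η' ((extChartAt I P₀).symm u)) :
    localRep η P₀ u = localRep η' P₀ u := by
  rw [localRep, h, localRep]

theorem localRep_add {k : ℕ} (η η' : DForm I N k) (P₀ : N) (u : E) :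
    localRep (fun P => η P + η' P) P₀ u = localRep η P₀ u + localRep η' P₀ u := rfl

theorem localRep_sub {k : ℕ} (η η' : DForm I N k) (P₀ : N) (u : E) :
    localRep (fun P => η P - η' P) P₀ u = localRep η P₀ u - localRep η' P₀ u := rfl

theorem localRep_neg {k : ℕ} (η : DForm I N k) (P₀ : N) (u : E) :
    localRep (fun P => -η P) P₀ u = -localRep η P₀ u := rfl

theorem localRep_smul {k : ℕ} (c : N → ℝ) (η : DForm I N k) (P₀ : N) (u : E) :
    localRep (fun P => c P • η P) P₀ u = c ((extChartAt I P₀).symm u) • localRep η P₀ u := rfl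

theorem localRep_sum {κ : Type*} (s : Finset κ) {k : ℕ} (η : κ → DForm I N k) (P₀ : N) (u : E) :
    localRep (fun P => ∑ i ∈ s, η i P) P₀ u = ∑ i ∈ s, localRep (η i) P₀ u := by
  ext w
  let w' : Fin k → TangentSpace I ((extChartAt I P₀).symm u) :=
    fun j => mfderiv 𝓘(ℝ, E) I (extChartAt I P₀).symm u (w j)
  change (∑ i ∈ s, η i ((extChartAt I P₀).symm u)) w' = _
  rw [ContinuousAlternatingMap.sum_apply, ContinuousAlternatingMap.sum_apply]
  rfl

theorem localRep_wedge {k l : ℕ} (m : ℕ) (η : DForm I N k) (η' : DForm I N l) (P₀ : N) (u : E) :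
    localRep (fun P => wedge m (η P) (η' P)) P₀ u =
      wedge m (localRep η P₀ u) (localRep η' P₀ u) :=
  wedge_comp _ _ _ _

theorem localRep_sum_wedge {κ : Type*} [Fintype κ] {m : ℕ} {k l k' l' : κ → ℕ} (c : κ → ℝ)
    (η : ∀ A, DForm I N (k A)) (η' : ∀ A, DForm I N (l A)) (σ : ∀ A, DForm I N (k' A))
    (σ' : ∀ A, DForm I N (l' A)) (ζ : DForm I N m) (P₀ : N) (u : E) :
    localRep (fun P => (∑ A, (c A • wedge m (η A P) (η' A P) + wedge m (σ A P) (σ' A P))) + ζ P)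
      P₀ u = (∑ A, (c A • wedge m (localRep (η A) P₀ u) (localRep (η' A) P₀ u) +
        wedge m (localRep (σ A) P₀ u) (localRep (σ' A) P₀ u))) + localRep ζ P₀ u := by
  refine (localRep_add (fun P => ∑ A, (c A • wedge m (η A P) (η' A P) +
    wedge m (σ A P) (σ' A P))) ζ P₀ u).trans ?_
  rw [localRep_sum]
  congr 1
  refine Finset.sum_congr rfl fun A _ => ?_
  rw [localRep_add (fun P => c A • wedge m (η A P) (η' A P)), localRep_smul (fun _ => c A),
    localRep_wedge, localRep_wedge]

theorem localRep_sum_wedge' {κ : Type*} [Fintype κ] {m : ℕ} {k l : κ → ℕ} (c : κ → ℝ)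
    (η : ∀ A, DForm I N (k A)) (η' : ∀ A, DForm I N (l A)) (ζ : DForm I N m) (P₀ : N) (u : E) :
    localRep (fun P => (∑ A, c A • wedge m (η A P) (η' A P)) + ζ P) P₀ u =
      (∑ A, c A • wedge m (localRep (η A) P₀ u) (localRep (η' A) P₀ u)) + localRep ζ P₀ u := by
  refine (localRep_add (fun P => ∑ A, c A • wedge m (η A P) (η' A P)) ζ P₀ u).trans ?_
  rw [localRep_sum]
  congr 1
  refine Finset.sum_congr rfl fun A _ => ?_
  rw [localRep_smul (fun _ => c A), localRep_wedge]

theorem SmoothFormOn.mono {k : ℕ} {η : DForm I N k} {U U' : Set N} (h : SmoothFormOn η U)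
    (hU : U' ⊆ U) : SmoothFormOn η U' := fun P₀ =>
  (h P₀).mono fun _ hu => ⟨hu.1, hU hu.2⟩

variable [I.Boundaryless]

theorem isOpen_overlap (P₀ : N) {U : Set N} (hU : IsOpen U) :
    IsOpen ((extChartAt I P₀).target ∩ (extChartAt I P₀).symm ⁻¹' U) :=
  (continuousOn_extChartAt_symm P₀).isOpen_inter_preimage (isOpen_extChartAt_target P₀) hU

variable [IsManifold I ∞ N]

theorem isManifold_one (I : ModelWithCorners ℝ E H) (N : Type*) [TopologicalSpace N]
    [ChartedSpace H N] [IsManifold I ∞ N] : IsManifold I 1 N :=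
  IsManifold.of_le (n := ∞) (by simp)

theorem contMDiffAt_extChartAt_symm (P₀ : N) {u : E} (hu : u ∈ (extChartAt I P₀).target) :
    ContMDiffAt 𝓘(ℝ, E) I ∞ (extChartAt I P₀).symm u :=
  (contMDiffOn_extChartAt_symm P₀).contMDiffAt ((isOpen_extChartAt_target P₀).mem_nhds hu)

theorem mdifferentiableAt_extChartAt_symm (P₀ : N) {u : E} (hu : u ∈ (extChartAt I P₀).target) :
    MDifferentiableAt 𝓘(ℝ, E) I (extChartAt I P₀).symm u :=
  (contMDiffAt_extChartAt_symm P₀ hu).mdifferentiableAt (by simp)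

theorem mfderiv_extChartAt_symm_self (P : N) :
    mfderiv 𝓘(ℝ, E) I (extChartAt I P).symm (extChartAt I P P) = ContinuousLinearMap.id ℝ E := by
  have := isManifold_one I N
  have h := mfderivWithin_range_extChartAt_symm (I := I) (x := P)
  rwa [I.range_eq_univ, mfderivWithin_univ] at h

theorem mfderiv_extChartAt_comp_symm (P₀ : N) {u : E} (hu : u ∈ (extChartAt I P₀).target) (w : E) :
    mfderiv I 𝓘(ℝ, E) (extChartAt I P₀) ((extChartAt I P₀).symm u)
      (mfderiv 𝓘(ℝ, E) I (extChartAt I P₀).symm u w) = w := by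
  have := isManifold_one I N
  have h := mfderiv_extChartAt_comp_mfderivWithin_extChartAt_symm hu
  rw [I.range_eq_univ, mfderivWithin_univ] at h
  exact DFunLike.congr_fun h w

theorem mfderiv_extChartAt_symm_comp (P₀ : N) {u : E} (hu : u ∈ (extChartAt I P₀).target)
    (w : TangentSpace I ((extChartAt I P₀).symm u)) :
    mfderiv 𝓘(ℝ, E) I (extChartAt I P₀).symm u
      (mfderiv I 𝓘(ℝ, E) (extChartAt I P₀) ((extChartAt I P₀).symm u) w) = w := by
  have := isManifold_one I N
  have h := mfderivWithin_extChartAt_symm_comp_mfderiv_extChartAt hu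
  rw [I.range_eq_univ, mfderivWithin_univ] at h
  exact DFunLike.congr_fun h w

/-- In the chart around a point, a form at that point is its own coordinate expression. -/
theorem localRep_self {k : ℕ} (η : DForm I N k) (P : N) :
    localRep η P (extChartAt I P P) = η P := by
  have key : ∀ (x : N) (L : E →L[ℝ] E), x = P → L = ContinuousLinearMap.id ℝ E →
      ((η x : E [⋀^Fin k]→L[ℝ] ℝ).compContinuousLinearMap L : E [⋀^Fin k]→L[ℝ] ℝ) = η P := by
    rintro x L rfl rfl
    rfl
  exact key _ _ (extChartAt_to_inv P) (mfderiv_extChartAt_symm_self P)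

/-- The change of coordinates between two charts. -/
def transition (I : ModelWithCorners ℝ E H) {N : Type*} [TopologicalSpace N] [ChartedSpace H N]
    (P₀ P : N) (u : E) : E := extChartAt I P ((extChartAt I P₀).symm u)

theorem contDiffAt_transition {P₀ P : N} {u : E} (hu : u ∈ (extChartAt I P₀).target)
    (hP : (extChartAt I P₀).symm u ∈ (extChartAt I P).source) :
    ContDiffAt ℝ ∞ (transition I P₀ P) u := by
  rw [extChartAt_source] at hP
  exact ((contMDiffAt_extChartAt' hP).comp u (contMDiffAt_extChartAt_symm P₀ hu)).contDiffAt

theorem mfderiv_symm_transition {P₀ P : N} {u : E} (hu : u ∈ (extChartAt I P₀).target)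
    (hP : (extChartAt I P₀).symm u ∈ (extChartAt I P).source) (w : E) :
    (mfderiv 𝓘(ℝ, E) I (extChartAt I P₀).symm u w : E) =
      mfderiv 𝓘(ℝ, E) I (extChartAt I P).symm (transition I P₀ P u)
        (fderiv ℝ (transition I P₀ P) u w) := by
  have h1 : (extChartAt I P₀).symm =ᶠ[𝓝 u] (extChartAt I P).symm ∘ transition I P₀ P := by
    filter_upwards [(isOpen_overlap P₀ (isOpen_extChartAt_source P)).mem_nhds ⟨hu, hP⟩] with y hy
    exact ((extChartAt I P).left_inv hy.2).symm
  have hT : transition I P₀ P u ∈ (extChartAt I P).target := (extChartAt I P).map_source hP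
  have h2 := mfderiv_comp u (mdifferentiableAt_extChartAt_symm P hT)
    ((contDiffAt_transition hu hP).contMDiffAt.mdifferentiableAt (by simp))
  have h3 : (mfderiv 𝓘(ℝ, E) I (extChartAt I P₀).symm u : E →L[ℝ] E) =
    mfderiv 𝓘(ℝ, E) I ((extChartAt I P).symm ∘ transition I P₀ P) u := h1.mfderiv_eq
  rw [h3, h2, mfderiv_eq_fderiv]
  rfl

/-- The transformation law of the coordinate expressions of a form. -/
theorem localRep_transition {k : ℕ} (η : DForm I N k) {P₀ P : N} {u : E}
    (hu : u ∈ (extChartAt I P₀).target)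
    (hP : (extChartAt I P₀).symm u ∈ (extChartAt I P).source) :
    localRep η P₀ u = (localRep η P (transition I P₀ P u)).compContinuousLinearMap
      (fderiv ℝ (transition I P₀ P) u) := by
  have key : ∀ (x x' : N) (L L' : E →L[ℝ] E), x = x' → L = L' →
      ((η x : E [⋀^Fin k]→L[ℝ] ℝ).compContinuousLinearMap L : E [⋀^Fin k]→L[ℝ] ℝ) =
      (η x' : E [⋀^Fin k]→L[ℝ] ℝ).compContinuousLinearMap L' := by
    rintro x x' L L' rfl rfl
    rfl
  let A : E →L[ℝ] E := mfderiv 𝓘(ℝ, E) I (extChartAt I P).symm (transition I P₀ P u)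
  let B : E →L[ℝ] E := fderiv ℝ (transition I P₀ P) u
  let C : E →L[ℝ] E := mfderiv 𝓘(ℝ, E) I (extChartAt I P₀).symm u
  have h : C = A.comp B := ContinuousLinearMap.ext fun w => mfderiv_symm_transition hu hP w
  exact key _ _ C (A.comp B) ((extChartAt I P).left_inv hP).symm h

theorem localRep_transition_eventuallyEq {k : ℕ} (η : DForm I N k) {P₀ P : N} {u : E}
    (hu : u ∈ (extChartAt I P₀).target)
    (hP : (extChartAt I P₀).symm u ∈ (extChartAt I P).source) :
    localRep η P₀ =ᶠ[𝓝 u] fun u => (localRep η P (transition I P₀ P u)).compContinuousLinearMap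
      (fderiv ℝ (transition I P₀ P) u) := by
  filter_upwards [(isOpen_overlap P₀ (isOpen_extChartAt_source P)).mem_nhds ⟨hu, hP⟩] with y hy
  exact localRep_transition η hy.1 hy.2

/-- Smoothness may be checked in one chart. -/
theorem contDiffAt_localRep {k : ℕ} {η : DForm I N k} {P₀ P : N} {u : E}
    (hu : u ∈ (extChartAt I P₀).target)
    (hP : (extChartAt I P₀).symm u ∈ (extChartAt I P).source)
    (h : ContDiffAt ℝ ∞ (localRep η P) (transition I P₀ P u)) :
    ContDiffAt ℝ ∞ (localRep η P₀) u := by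
  refine ContDiffAt.congr_of_eventuallyEq ?_ (localRep_transition_eventuallyEq η hu hP)
  have hT := contDiffAt_transition hu hP
  have h1 := (hT.fderiv_right (m := ∞) (by simp))
  exact ((contDiff_compCLM (E := E) k).contDiffAt.comp u h1).clm_apply (h.comp u hT)

omit [IsManifold I ∞ N] in
theorem SmoothFormOn.contDiffAt {k : ℕ} {η : DForm I N k} {U : Set N} (hU : IsOpen U)
    (h : SmoothFormOn η U) {P₀ : N} {u : E} (hu : u ∈ (extChartAt I P₀).target)
    (huU : (extChartAt I P₀).symm u ∈ U) : ContDiffAt ℝ ∞ (localRep η P₀) u :=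
  (h P₀).contDiffAt ((isOpen_overlap P₀ hU).mem_nhds ⟨hu, huU⟩)

theorem smoothFormOn_of_contDiffAt {k : ℕ} {η : DForm I N k} {U : Set N}
    (h : ∀ Q ∈ U, ∃ P : N, Q ∈ (extChartAt I P).source ∧
      ContDiffAt ℝ ∞ (localRep η P) (extChartAt I P Q)) : SmoothFormOn η U := by
  intro P₀ u hu
  obtain ⟨P, hP, hs⟩ := h _ hu.2
  exact (contDiffAt_localRep hu.1 hP hs).contDiffWithinAt

/-- The exterior derivative is computed by the coordinate expressions in any chart. -/
theorem localRep_extD {k : ℕ} {η : DForm I N k} {U : Set N} (hU : IsOpen U)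
    (h : SmoothFormOn η U) {P₀ : N} {u : E} (hu : u ∈ (extChartAt I P₀).target)
    (huU : (extChartAt I P₀).symm u ∈ U) :
    localRep (extD η) P₀ u = extDeriv (localRep η P₀) u := by
  -- `extD` uses a different chart at every point; naturality of d under the transition map compares
  -- the chart around this point with the one around P₀.
  set P := (extChartAt I P₀).symm u with hPdef
  have hP : P ∈ (extChartAt I P).source := mem_extChartAt_source P
  have h1 := localRep_transition_eventuallyEq η hu hP
  have hd : DifferentiableAt ℝ (localRep η P) (transition I P₀ P u) :=
    (h.contDiffAt hU ((extChartAt I P).map_source hP)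
      (by rwa [extChartAt_to_inv])).differentiableAt (by simp)
  rw [h1.extDeriv_eq, extDeriv_pullback hd (contDiffAt_transition hu hP) minSmoothness_infty]
  have h2 : (localRep (extD η) P (transition I P₀ P u)) =
      extDeriv (localRep η P) (transition I P₀ P u) := by
    refine (localRep_self (extD η) P).trans ?_
    have := isManifold_one I N
    change (extDeriv (localRep η P) (extChartAt I P P)).compContinuousLinearMap _ = _
    rw [mfderiv_extChartAt_self]
    rfl
  rw [localRep_transition (extD η) hu hP, h2]

theorem SmoothFormOn.extD {k : ℕ} {η : DForm I N k} {U : Set N} (hU : IsOpen U)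
    (h : SmoothFormOn η U) : SmoothFormOn (extD η) U := fun P₀ =>
  (contDiffOn_extDeriv (isOpen_overlap P₀ hU) (h P₀)).congr fun _ hu =>
    localRep_extD hU h hu.1 hu.2

/-- The coordinate expression of a vector field. -/
def fieldRep (v : (P : N) → TangentSpace I P) (P₀ : N) (u : E) : E :=
  mfderiv I 𝓘(ℝ, E) (extChartAt I P₀) ((extChartAt I P₀).symm u) (v ((extChartAt I P₀).symm u))

theorem mfderiv_symm_fieldRep (v : (P : N) → TangentSpace I P) {P₀ : N} {u : E}
    (hu : u ∈ (extChartAt I P₀).target) :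
    mfderiv 𝓘(ℝ, E) I (extChartAt I P₀).symm u (fieldRep (E := E) v P₀ u) =
      v ((extChartAt I P₀).symm u) :=
  mfderiv_extChartAt_symm_comp P₀ hu _

theorem localRep_interior {k : ℕ} (v : (P : N) → TangentSpace I P) (η : DForm I N (k + 1))
    {P₀ : N} {u : E} (hu : u ∈ (extChartAt I P₀).target) :
    localRep (fun P => interior (v P) (η P)) P₀ u =
      interior (fieldRep v P₀ u) (localRep η P₀ u) := by
  ext w
  let D : E →L[ℝ] E := mfderiv 𝓘(ℝ, E) I (extChartAt I P₀).symm u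
  have hD : D (fieldRep v P₀ u) = v ((extChartAt I P₀).symm u) := mfderiv_symm_fieldRep v hu
  let α : E [⋀^Fin (k + 1)]→L[ℝ] ℝ := η ((extChartAt I P₀).symm u)
  have h : interior (fieldRep v P₀ u) (α.compContinuousLinearMap D) =
      (interior (v ((extChartAt I P₀).symm u) : E) α).compContinuousLinearMap D := by
    rw [interior_comp, hD]
    rfl
  exact (DFunLike.congr_fun h w).symm

-- On its base set the trivialization of the tangent bundle at P₀ is the derivative of the chart, so
-- `fieldRep` is the second component of the trivialized section.
omit [I.Boundaryless] in
theorem contDiffOn_fieldRep [IsManifold I 1 N] {v : (P : N) → TangentSpace I P} {U : Set N}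
    (hU : IsOpen U) (hv : SmoothFieldOn v U) (P₀ : N) :
    ContDiffOn ℝ ∞ (fieldRep v P₀) ((extChartAt I P₀).target ∩ (extChartAt I P₀).symm ⁻¹' U) := by
  have : IsManifold I (∞ + 1) N := by simpa
  have hb : ((chartAt H P₀).source : Set N) = (trivializationAt E (TangentSpace I) P₀).baseSet := by
    simp
  have h1 : ContMDiffOn I 𝓘(ℝ, E) ∞
      (fun P => (trivializationAt E (TangentSpace I) P₀ ⟨P, v P⟩).2) (U ∩ (chartAt H P₀).source) :=
    ((trivializationAt E (TangentSpace I) P₀).contMDiffOn_section_iff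
      (hU.inter (chartAt H P₀).open_source) (fun x hx => hb ▸ hx.2)).1 (hv.mono inter_subset_left)
  have h2 := h1.comp ((contMDiffOn_extChartAt_symm (n := ∞) P₀).mono inter_subset_left)
    (s := (extChartAt I P₀).target ∩ (extChartAt I P₀).symm ⁻¹' U) (fun u hu => ⟨hu.2, by
      have := (extChartAt I P₀).map_target hu.1
      rwa [extChartAt_source] at this⟩)
  refine h2.contDiffOn.congr fun u hu => ?_
  have hs := (extChartAt I P₀).map_target hu.1
  rw [extChartAt_source] at hs
  have h3 := DFunLike.congr_fun (TangentBundle.continuousLinearMapAt_trivializationAt hs)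
    (v ((extChartAt I P₀).symm u))
  exact h3.symm.trans (congrFun (Trivialization.coe_linearMapAt_of_mem
    (trivializationAt E (TangentSpace I) P₀) (R := ℝ) (hb ▸ hs)) _)

end LocalRep


/-! ### Bundle charts -/

section BundleCharts

variable {n : ℕ} {κ : Type*} [Fintype κ] {d : κ → ℕ} {M : Type*} [TopologicalSpace M]
  [ChartedSpace (EuclideanSpace ℝ (Fin n)) M] [IsManifold (𝓡 n) ∞ M]

theorem mem_source_iff {P₀ P : FormBundle n d M} :
    P ∈ (extChartAt (bundleModel n d) P₀).source ↔
      P.proj ∈ (extChartAt (𝓡 n) P₀.proj).source := by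
  rw [FiberBundle.extChartAt]
  simp [Trivialization.mem_source]
  exact and_self_iff

theorem target_eq (P₀ : FormBundle n d M) : (extChartAt (bundleModel n d) P₀).target =
    (extChartAt (𝓡 n) P₀.proj).target ×ˢ univ := by
  rw [FiberBundle.extChartAt_target]
  congr 1
  refine inter_eq_left.2 fun u hu => ?_
  have := (extChartAt (𝓡 n) P₀.proj).map_target hu
  rw [extChartAt_source] at this
  exact this

theorem chart_fst (P₀ P : FormBundle n d M) :
    (extChartAt (bundleModel n d) P₀ P).1 = extChartAt (𝓡 n) P₀.proj P.proj := by
  rw [FiberBundle.extChartAt]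
  rfl

/-- The cocycle pulls forms back along inverse coordinate changes of the tangent bundle, and its
inverse trivialization is the derivative of the inverse base chart. -/
theorem chart_snd {P₀ P : FormBundle n d M} (hP : P ∈ (extChartAt (bundleModel n d) P₀).source)
    (k : κ) (w : Fin (d k) → EuclideanSpace ℝ (Fin n)) :
    (extChartAt (bundleModel n d) P₀ P).2 k w = P.2 k (fun i =>
      mfderiv 𝓘(ℝ, EuclideanSpace ℝ (Fin n)) (𝓡 n) (extChartAt (𝓡 n) P₀.proj).symm
        (extChartAt (𝓡 n) P₀.proj P.proj) (w i)) := by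
  have := isManifold_one (𝓡 n) M
  rw [mem_source_iff, extChartAt_source] at hP
  have h1 := TangentBundle.symmL_trivializationAt (I := 𝓡 n) hP
  rw [TangentBundle.symmL_trivializationAt_eq_core hP, (𝓡 n).range_eq_univ,
    mfderivWithin_univ] at h1
  rw [← h1, FiberBundle.extChartAt]
  rfl

theorem proj_symm (P₀ : FormBundle n d M) {u : EuclideanSpace ℝ (Fin n) × FormModel n d}
    (hu : u ∈ (extChartAt (bundleModel n d) P₀).target) :
    ((extChartAt (bundleModel n d) P₀).symm u).proj = (extChartAt (𝓡 n) P₀.proj).symm u.1 := by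
  have h := (extChartAt (bundleModel n d) P₀).map_target hu
  have h1 := chart_fst P₀ ((extChartAt (bundleModel n d) P₀).symm u)
  rw [(extChartAt (bundleModel n d) P₀).right_inv hu] at h1
  rw [h1, (extChartAt (𝓡 n) P₀.proj).left_inv (mem_source_iff.1 h)]

theorem contMDiff_proj : ContMDiff (bundleModel n d) (𝓡 n) ∞ (proj (n := n) (q := d) (M := M)) :=
  Bundle.contMDiff_proj _

theorem mfderiv_proj_symm (P₀ : FormBundle n d M) {u : EuclideanSpace ℝ (Fin n) × FormModel n d}
    (hu : u ∈ (extChartAt (bundleModel n d) P₀).target)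
    (w : EuclideanSpace ℝ (Fin n) × FormModel n d) :
    (mfderiv (bundleModel n d) (𝓡 n) (proj (n := n) (q := d))
      ((extChartAt (bundleModel n d) P₀).symm u)
      (mfderiv 𝓘(ℝ, EuclideanSpace ℝ (Fin n) × FormModel n d) (bundleModel n d)
        (extChartAt (bundleModel n d) P₀).symm u w) : EuclideanSpace ℝ (Fin n)) =
    mfderiv 𝓘(ℝ, EuclideanSpace ℝ (Fin n)) (𝓡 n) (extChartAt (𝓡 n) P₀.proj).symm u.1 w.1 := by
  have h1 : proj (n := n) (q := d) ∘ (extChartAt (bundleModel n d) P₀).symm =ᶠ[𝓝 u]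
      (extChartAt (𝓡 n) P₀.proj).symm ∘ Prod.fst := by
    filter_upwards [(isOpen_extChartAt_target P₀).mem_nhds hu] with y hy using proj_symm P₀ hy
  have hu1 : u.1 ∈ (extChartAt (𝓡 n) P₀.proj).target := by
    rw [target_eq] at hu
    exact hu.1
  have h2 := mfderiv_comp u (contMDiff_proj.mdifferentiableAt (by simp))
    (mdifferentiableAt_extChartAt_symm P₀ hu)
  have h3 := mfderiv_comp u (f := (Prod.fst : EuclideanSpace ℝ (Fin n) × FormModel n d → _))
    (I := 𝓘(ℝ, EuclideanSpace ℝ (Fin n) × FormModel n d))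
    (mdifferentiableAt_extChartAt_symm P₀.proj hu1)
    (contDiff_fst.contMDiff.mdifferentiable (n := ∞) (by simp) u)
  have h4 := h1.mfderiv_eq (I := 𝓘(ℝ, EuclideanSpace ℝ (Fin n) × FormModel n d)) (I' := 𝓡 n)
  have h5 := (h2.symm.trans h4).trans h3
  have h6 := DFunLike.congr_fun h5 w
  refine h6.trans ?_
  rw [mfderiv_eq_fderiv, fderiv_fst]
  rfl

/-- The coordinate expression of a horizontal form, with values in the forms on the base. -/
def baseRep {m : ℕ} (Q : HorizontalForm n d M m) (P₀ : FormBundle n d M)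
    (u : EuclideanSpace ℝ (Fin n) × FormModel n d) : EuclideanSpace ℝ (Fin n) [⋀^Fin m]→L[ℝ] ℝ :=
  (Q ((extChartAt (bundleModel n d) P₀).symm u) :
    EuclideanSpace ℝ (Fin n) [⋀^Fin m]→L[ℝ] ℝ).compContinuousLinearMap
    (mfderiv 𝓘(ℝ, EuclideanSpace ℝ (Fin n)) (𝓡 n) (extChartAt (𝓡 n) P₀.proj).symm u.1 :
      EuclideanSpace ℝ (Fin n) →L[ℝ] EuclideanSpace ℝ (Fin n))

theorem localRep_toForm {m : ℕ} (Q : HorizontalForm n d M m) {P₀ : FormBundle n d M}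
    {u : EuclideanSpace ℝ (Fin n) × FormModel n d}
    (hu : u ∈ (extChartAt (bundleModel n d) P₀).target) :
    localRep Q.toForm P₀ u = horL _ _ _ (baseRep Q P₀ u) := by
  ext w
  have h : ∀ i, _ := fun i => mfderiv_proj_symm P₀ hu (w i)
  exact congrArg (Q ((extChartAt (bundleModel n d) P₀).symm u) :
    EuclideanSpace ℝ (Fin n) [⋀^Fin m]→L[ℝ] ℝ) (funext h)

/-- The bundle chart pulls a form back by the same linear map as its coordinate expression does, so
the tautological form becomes a coordinate function. -/
theorem baseRep_taut (k : κ) {P₀ : FormBundle n d M}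
    {u : EuclideanSpace ℝ (Fin n) × FormModel n d}
    (hu : u ∈ (extChartAt (bundleModel n d) P₀).target) : baseRep (taut k) P₀ u = u.2 k := by
  ext w
  have h := chart_snd ((extChartAt (bundleModel n d) P₀).map_target hu) k w
  rw [(extChartAt (bundleModel n d) P₀).right_inv hu] at h
  rw [h, proj_symm P₀ hu, (extChartAt (𝓡 n) P₀.proj).right_inv
    (by rw [target_eq] at hu; exact hu.1)]
  rfl

end BundleCharts


/-! ### Coordinate expressions of θ, ω and the Noether current. -/

section CanonicalForms

variable {n : ℕ} {κ : Type*} [Fintype κ] {d : κ → ℕ} {M : Type*} [TopologicalSpace M]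
  [ChartedSpace (EuclideanSpace ℝ (Fin n)) M] [IsManifold (𝓡 n) ∞ M]

theorem smoothFormOn_toForm {m : ℕ} {Q : HorizontalForm n d M m} {U : Set (FormBundle n d M)}
    (h : ∀ P₀, ContDiffOn ℝ ∞ (baseRep Q P₀) ((extChartAt (bundleModel n d) P₀).target ∩
      (extChartAt (bundleModel n d) P₀).symm ⁻¹' U)) : SmoothFormOn Q.toForm U := fun P₀ =>
  (contDiffOn_horL (h P₀)).congr fun _ hu => localRep_toForm Q hu.1

theorem smoothFormOn_taut (k : κ) : SmoothFormOn (taut (n := n) (q := d) (M := M) k).toForm univ :=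
  smoothFormOn_toForm fun P₀ => by
  have h : ContDiff ℝ ∞ fun u : EuclideanSpace ℝ (Fin n) × FormModel n d => u.2 k :=
    contDiff_pi.1 contDiff_snd k
  exact h.contDiffOn.congr fun _ hu => baseRep_taut k hu.1

theorem localRep_extD_taut (k : κ) {P₀ : FormBundle n d M}
    {u : EuclideanSpace ℝ (Fin n) × FormModel n d}
    (hu : u ∈ (extChartAt (bundleModel n d) P₀).target) :
    localRep (extD (taut (n := n) (q := d) (M := M) k).toForm) P₀ u =
      dTaut (ContinuousLinearMap.proj k) := by
  rw [localRep_extD isOpen_univ (smoothFormOn_taut k) hu (mem_univ _), ← extDeriv_taut _ u]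
  refine Filter.EventuallyEq.extDeriv_eq ?_
  filter_upwards [(isOpen_extChartAt_target P₀).mem_nhds hu] with y hy
  rw [localRep_toForm _ hy, baseRep_taut k hy]
  rfl

theorem baseRep_contract {m : ℕ} (Q : HorizontalForm n d M m)
    (ξ : (x : M) → TangentSpace (𝓡 n) x) {P₀ : FormBundle n d M}
    {u : EuclideanSpace ℝ (Fin n) × FormModel n d}
    (hu : u ∈ (extChartAt (bundleModel n d) P₀).target) :
    baseRep (Q.contract ξ) P₀ u = contract (fieldRep ξ P₀.proj u.1) (baseRep Q P₀ u) := by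
  have hu1 : u.1 ∈ (extChartAt (𝓡 n) P₀.proj).target := by
    rw [target_eq] at hu
    exact hu.1
  have h := mfderiv_symm_fieldRep ξ hu1
  have h2 : (ξ ((extChartAt (bundleModel n d) P₀).symm u).proj : EuclideanSpace ℝ (Fin n)) =
      ξ ((extChartAt (𝓡 n) P₀.proj).symm u.1) := by
    rw [proj_symm P₀ hu]
  let D : EuclideanSpace ℝ (Fin n) →L[ℝ] EuclideanSpace ℝ (Fin n) :=
    mfderiv 𝓘(ℝ, EuclideanSpace ℝ (Fin n)) (𝓡 n) (extChartAt (𝓡 n) P₀.proj).symm u.1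
  let α : EuclideanSpace ℝ (Fin n) [⋀^Fin m]→L[ℝ] ℝ := Q ((extChartAt (bundleModel n d) P₀).symm u)
  have h3 : D (fieldRep ξ P₀.proj u.1) = ξ ((extChartAt (bundleModel n d) P₀).symm u).proj :=
    h.trans h2.symm
  have h4 := contract_comp (fieldRep ξ P₀.proj u.1) D α
  rw [h3] at h4
  exact h4.symm

theorem smoothFormOn_contract_taut (k : κ) {ξ : (x : M) → TangentSpace (𝓡 n) x}
    [IsManifold (𝓡 n) 1 M] (hξ : SmoothFieldOn ξ univ) :
    SmoothFormOn ((taut (n := n) (q := d) (M := M) k).contract ξ).toForm univ := by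
  refine smoothFormOn_toForm fun P₀ => ?_
  have h : ContDiffOn ℝ ∞ (fieldRep ξ P₀.proj) (extChartAt (𝓡 n) P₀.proj).target := by
    simpa using contDiffOn_fieldRep isOpen_univ hξ P₀.proj
  refine (contDiffOn_contract (h.comp contDiff_fst.contDiffOn (s := (extChartAt (bundleModel n d)
    P₀).target ∩ (extChartAt (bundleModel n d) P₀).symm ⁻¹' univ) ?_)
    (((ContinuousLinearMap.proj (R := ℝ) k).contDiff.comp contDiff_snd).contDiffOn)).congr ?_
  · intro u hu
    have := hu.1
    rw [target_eq] at this
    exact this.1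
  · intro u hu
    rw [baseRep_contract _ _ hu.1, baseRep_taut k hu.1]
    rfl

theorem localRep_extD_contract_taut (k : κ) {ξ : (x : M) → TangentSpace (𝓡 n) x}
    [IsManifold (𝓡 n) 1 M] (hξ : SmoothFieldOn ξ univ) {P₀ : FormBundle n d M}
    {u : EuclideanSpace ℝ (Fin n) × FormModel n d}
    (hu : u ∈ (extChartAt (bundleModel n d) P₀).target) :
    localRep (extD ((taut (n := n) (q := d) (M := M) k).contract ξ).toForm) P₀ u =
      extDeriv (fun u : EuclideanSpace ℝ (Fin n) × FormModel n d =>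
        horL _ _ _ (contract (fieldRep ξ P₀.proj u.1) (u.2 k))) u := by
  rw [localRep_extD isOpen_univ (smoothFormOn_contract_taut k hξ) hu (mem_univ _)]
  refine Filter.EventuallyEq.extDeriv_eq ?_
  filter_upwards [(isOpen_extChartAt_target P₀).mem_nhds hu] with y hy
  rw [localRep_toForm _ hy, baseRep_contract _ _ hy, baseRep_taut k hy]

variable {m : ℕ} {ι : Type*} [Fintype ι] {q : ι → ℕ} {M : Type*} [TopologicalSpace M]
  [ChartedSpace (EuclideanSpace ℝ (Fin (m + 2))) M] [IsManifold (𝓡 (m + 2)) ∞ M]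

/-- The coordinates `p_A`. -/
def pProj (m : ℕ) (q : ι → ℕ) (A : {A : ι // q A < m + 2}) :
    FormModel (m + 2) (phaseDeg (m + 2) q) →L[ℝ]
      EuclideanSpace ℝ (Fin (m + 2)) [⋀^Fin (m + 2 - q A - 1)]→L[ℝ] ℝ :=
  ContinuousLinearMap.proj (Sum.inr (Sum.inl A))

/-- The coordinates `y^A`, for fields of degree `< n`. -/
def yProj (m : ℕ) (q : ι → ℕ) (A : {A : ι // q A < m + 2}) :
    FormModel (m + 2) (phaseDeg (m + 2) q) →L[ℝ]
      EuclideanSpace ℝ (Fin (m + 2)) [⋀^Fin (q A)]→L[ℝ] ℝ :=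
  ContinuousLinearMap.proj (Sum.inl A.1)

/-- The coordinate `h`. -/
def hProj (m : ℕ) (q : ι → ℕ) : FormModel (m + 2) (phaseDeg (m + 2) q) →L[ℝ]
    EuclideanSpace ℝ (Fin (m + 2)) [⋀^Fin (m + 2)]→L[ℝ] ℝ :=
  ContinuousLinearMap.proj (Sum.inr (Sum.inr ()))

-- The sign exponent n − q_A of θ is the degree of p_A plus one, the form in which the chart
-- computations carry it.
omit [Fintype ι] in
theorem sign_exponent (A : {A : ι // q A < m + 2}) : m + 2 - q A - 1 + 1 = m + 2 - q A :=
  Nat.sub_add_cancel (Nat.sub_pos_of_lt A.2)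

theorem localRep_pForm (A : {A : ι // q A < m + 2}) {P₀ : PhaseBundle (m + 2) q M}
    {u : EuclideanSpace ℝ (Fin (m + 2)) × FormModel (m + 2) (phaseDeg (m + 2) q)}
    (hu : u ∈ (extChartAt (bundleModel (m + 2) (phaseDeg (m + 2) q)) P₀).target) :
    localRep (pForm A).toForm P₀ u = horL _ _ _ (pProj m q A u.2) :=
  (localRep_toForm _ hu).trans (congrArg _ (baseRep_taut (Sum.inr (Sum.inl A)) hu))

theorem localRep_hForm {P₀ : PhaseBundle (m + 2) q M}
    {u : EuclideanSpace ℝ (Fin (m + 2)) × FormModel (m + 2) (phaseDeg (m + 2) q)}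
    (hu : u ∈ (extChartAt (bundleModel (m + 2) (phaseDeg (m + 2) q)) P₀).target) :
    localRep hForm.toForm P₀ u = horL _ _ _ (hProj m q u.2) :=
  (localRep_toForm _ hu).trans (congrArg _ (baseRep_taut (Sum.inr (Sum.inr ())) hu))

theorem localRep_extD_yForm (A : {A : ι // q A < m + 2}) {P₀ : PhaseBundle (m + 2) q M}
    {u : EuclideanSpace ℝ (Fin (m + 2)) × FormModel (m + 2) (phaseDeg (m + 2) q)}
    (hu : u ∈ (extChartAt (bundleModel (m + 2) (phaseDeg (m + 2) q)) P₀).target) :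
    localRep (extD (yForm A.1).toForm) P₀ u = dTaut (yProj m q A) :=
  localRep_extD_taut (Sum.inl A.1) hu

theorem localRep_contract_pForm (A : {A : ι // q A < m + 2})
    (ξ : (x : M) → TangentSpace (𝓡 (m + 2)) x) {P₀ : PhaseBundle (m + 2) q M}
    {u : EuclideanSpace ℝ (Fin (m + 2)) × FormModel (m + 2) (phaseDeg (m + 2) q)}
    (hu : u ∈ (extChartAt (bundleModel (m + 2) (phaseDeg (m + 2) q)) P₀).target) :
    localRep ((pForm A).contract ξ).toForm P₀ u =
      horL _ _ _ (contract (fieldRep ξ P₀.proj u.1) (pProj m q A u.2)) :=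
  (localRep_toForm _ hu).trans (congrArg _ ((baseRep_contract _ _ hu).trans
    (congrArg _ (baseRep_taut (Sum.inr (Sum.inl A)) hu))))

theorem localRep_contract_hForm (ξ : (x : M) → TangentSpace (𝓡 (m + 2)) x)
    {P₀ : PhaseBundle (m + 2) q M}
    {u : EuclideanSpace ℝ (Fin (m + 2)) × FormModel (m + 2) (phaseDeg (m + 2) q)}
    (hu : u ∈ (extChartAt (bundleModel (m + 2) (phaseDeg (m + 2) q)) P₀).target) :
    localRep (HorizontalForm.toForm (m := m + 1) (hForm.contract ξ)) P₀ u =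
      horL _ _ _ (interior (fieldRep ξ P₀.proj u.1) (hProj m q u.2)) :=
  (localRep_toForm _ hu).trans (congrArg _ ((baseRep_contract _ _ hu).trans
    (congrArg (contract (fieldRep ξ P₀.proj u.1)) (baseRep_taut (Sum.inr (Sum.inr ())) hu))))

theorem localRep_extD_contract_yForm (A : {A : ι // q A < m + 2}) [IsManifold (𝓡 (m + 2)) 1 M]
    {ξ : (x : M) → TangentSpace (𝓡 (m + 2)) x} (hξ : SmoothFieldOn ξ univ)
    {P₀ : PhaseBundle (m + 2) q M}
    {u : EuclideanSpace ℝ (Fin (m + 2)) × FormModel (m + 2) (phaseDeg (m + 2) q)}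
    (hu : u ∈ (extChartAt (bundleModel (m + 2) (phaseDeg (m + 2) q)) P₀).target) :
    localRep (extD ((yForm A.1).contract ξ).toForm) P₀ u =
      extDeriv (fun u : EuclideanSpace ℝ (Fin (m + 2)) × FormModel (m + 2) (phaseDeg (m + 2) q) =>
        horL _ _ _ (contract (fieldRep ξ P₀.proj u.1) (yProj m q A u.2))) u :=
  localRep_extD_contract_taut (Sum.inl A.1) hξ hu

theorem localRep_theta {P₀ : PhaseBundle (m + 2) q M}
    {u : EuclideanSpace ℝ (Fin (m + 2)) × FormModel (m + 2) (phaseDeg (m + 2) q)}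
    (hu : u ∈ (extChartAt (bundleModel (m + 2) (phaseDeg (m + 2) q)) P₀).target) :
    localRep (theta (m + 2) q M) P₀ u = thetaLoc (pProj m q) (yProj m q) (hProj m q) u := by
  refine (localRep_sum_wedge' (fun A : {A : ι // q A < m + 2} => (-1 : ℝ) ^ (m + 2 - q A))
    (fun A => (pForm A).toForm) (fun A => extD (yForm A.1).toForm) hForm.toForm P₀ u).trans ?_
  rw [thetaLoc, localRep_hForm hu]
  congr 1
  refine Finset.sum_congr rfl fun A _ => ?_
  rw [sign_exponent, localRep_extD_yForm A hu, localRep_pForm A hu]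

theorem smoothFormOn_theta : SmoothFormOn (theta (m + 2) q M) univ := fun _ =>
  (contDiff_thetaLoc (pProj m q) (yProj m q) (hProj m q)).contDiffOn.congr fun _ hu =>
    localRep_theta hu.1

/-- The right-hand side depends neither on u nor on the chart: bundle charts are canonical
coordinates. This constancy makes d(i_v ω) computable from the derivative of v alone. -/
theorem localRep_omega {P₀ : PhaseBundle (m + 2) q M}
    {u : EuclideanSpace ℝ (Fin (m + 2)) × FormModel (m + 2) (phaseDeg (m + 2) q)}
    (hu : u ∈ (extChartAt (bundleModel (m + 2) (phaseDeg (m + 2) q)) P₀).target) :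
    localRep (omega (m + 2) q M) P₀ u = omegaLoc (pProj m q) (yProj m q) (hProj m q) := by
  refine (localRep_neg (extD (theta (m + 2) q M)) P₀ u).trans ?_
  rw [localRep_extD isOpen_univ smoothFormOn_theta hu (mem_univ _),
    ← extDeriv_thetaLoc (pProj m q) (yProj m q) (hProj m q) u]
  congr 1
  refine Filter.EventuallyEq.extDeriv_eq ?_
  filter_upwards [(isOpen_extChartAt_target P₀).mem_nhds hu] with y hy using localRep_theta hy

theorem localRep_noether [IsManifold (𝓡 (m + 2)) 1 M] {ξ : (x : M) → TangentSpace (𝓡 (m + 2)) x}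
    (hξ : SmoothFieldOn ξ univ) {P₀ : PhaseBundle (m + 2) q M}
    {u : EuclideanSpace ℝ (Fin (m + 2)) × FormModel (m + 2) (phaseDeg (m + 2) q)}
    (hu : u ∈ (extChartAt (bundleModel (m + 2) (phaseDeg (m + 2) q)) P₀).target) :
    localRep (noether (q := q) ξ) P₀ u =
      noetherLoc (pProj m q) (yProj m q) (hProj m q) (fieldRep ξ P₀.proj) u := by
  refine (localRep_sum_wedge (fun A : {A : ι // q A < m + 2} => (-1 : ℝ) ^ (m + 2 - q A))
    (fun A => ((pForm A).contract ξ).toForm) (fun A => extD (yForm A.1).toForm)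
    (fun A => (pForm A).toForm) (fun A => extD ((yForm A.1).contract ξ).toForm)
    (HorizontalForm.toForm (m := m + 1) (hForm.contract ξ)) P₀ u).trans ?_
  rw [noetherLoc, localRep_contract_hForm ξ hu]
  congr 1
  refine Finset.sum_congr rfl fun A _ => ?_
  rw [sign_exponent, localRep_extD_yForm A hu, localRep_pForm A hu, localRep_contract_pForm A ξ hu,
    localRep_extD_contract_yForm A hξ hu]

theorem smoothFormOn_noether [IsManifold (𝓡 (m + 2)) 1 M]
    {ξ : (x : M) → TangentSpace (𝓡 (m + 2)) x} (hξ : SmoothFieldOn ξ univ) :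
    SmoothFormOn (noether (q := q) ξ) univ := fun P₀ => by
  have h : ContDiffOn ℝ ∞ (fieldRep ξ P₀.proj) (extChartAt (𝓡 (m + 2)) P₀.proj).target := by
    simpa using contDiffOn_fieldRep isOpen_univ hξ P₀.proj
  refine ((contDiffOn_noetherLoc (pProj m q) (yProj m q) (hProj m q)
    (isOpen_extChartAt_target P₀.proj) h).mono ?_).congr fun u hu => localRep_noether hξ hu.1
  intro u hu
  have := hu.1
  rw [target_eq] at this
  exact this.1

end CanonicalForms


/-! ### Observables in charts: projectability and subtraction of the Noether current. -/

theorem extDeriv_fun_sub {V : Type*} [NormedAddCommGroup V] [NormedSpace ℝ V] {k : ℕ}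
    {η η' : V → V [⋀^Fin k]→L[ℝ] ℝ} {u : V} (h : DifferentiableAt ℝ η u)
    (h' : DifferentiableAt ℝ η' u) :
    extDeriv (fun u => η u - η' u) u = extDeriv η u - extDeriv η' u := by
  have e : (fun u => η u - η' u) = fun u => η u + (-1 : ℝ) • η' u := by
    funext u
    rw [neg_one_smul', sub_eq_add_neg]
  rw [e, extDeriv_fun_add h (h'.fun_const_smul _), extDeriv_const_smul, neg_one_smul',
    sub_eq_add_neg]

section Observables

variable {m : ℕ} {ι : Type*} [Fintype ι] {q : ι → ℕ} {M : Type*} [TopologicalSpace M]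
  [ChartedSpace (EuclideanSpace ℝ (Fin (m + 2))) M] [IsManifold (𝓡 (m + 2)) ∞ M]

/-- The model fibre of the dual of the d-jet bundle. -/
abbrev PhaseModel (m : ℕ) (q : ι → ℕ) := FormModel (m + 2) (phaseDeg (m + 2) q)

/-- The model of the dual of the d-jet bundle. -/
abbrev phaseI (m : ℕ) (q : ι → ℕ) := bundleModel (m + 2) (phaseDeg (m + 2) q)

/-- The multisymplectic form in bundle charts. -/
def omegaModel (m : ℕ) (q : ι → ℕ) :
    (EuclideanSpace ℝ (Fin (m + 2)) × FormModel (m + 2) (phaseDeg (m + 2) q)) [⋀^Fin (m + 3)]→L[ℝ] ℝ :=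
  omegaLoc (pProj m q) (yProj m q) (hProj m q)

variable {f : DForm (phaseI m q) (PhaseBundle (m + 2) q M) (m + 1)}
  {v : (P : PhaseBundle (m + 2) q M) → TangentSpace (phaseI m q) P}
  {F : Set (PhaseBundle (m + 2) q M)}

theorem extDeriv_localRep_observable (hF : IsOpen F) (hf : SmoothFormOn f F)
    (h : ∀ P ∈ F, interior (v P) (omega (m + 2) q M P) = extD f P)
    {P₀ : PhaseBundle (m + 2) q M} {u : (EuclideanSpace ℝ (Fin (m + 2))) × (PhaseModel m q)} (hu : u ∈ (extChartAt (phaseI m q) P₀).target)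
    (huF : (extChartAt (phaseI m q) P₀).symm u ∈ F) :
    extDeriv (localRep f P₀) u = interior (fieldRep v P₀ u) (omegaModel m q) := by
  rw [← localRep_extD hF hf hu huF, omegaModel, ← localRep_omega hu, ← localRep_interior v _ hu]
  exact localRep_congr (h _ huF).symm

/-- The generating vector field of an observable is projectable to `M` along the fibres. -/
theorem fderiv_fieldRep_vertical (hfields : 2 ≤ ∑ A, (m + 1).choose (q A)) (hF : IsOpen F)
    (hf : SmoothFormOn f F) (hv : SmoothFieldOn v F)
    (h : ∀ P ∈ F, interior (v P) (omega (m + 2) q M P) = extD f P)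
    {P₀ : PhaseBundle (m + 2) q M} {u : (EuclideanSpace ℝ (Fin (m + 2))) × (PhaseModel m q)} (hu : u ∈ (extChartAt (phaseI m q) P₀).target)
    (huF : (extChartAt (phaseI m q) P₀).symm u ∈ F) (b : (PhaseModel m q)) :
    (fderiv ℝ (fieldRep v P₀) u (0, b)).1 = 0 := by
  have hO := isOpen_overlap (I := (phaseI m q)) P₀ hF
  have hvd : DifferentiableAt ℝ (fieldRep v P₀) u :=
    ((contDiffOn_fieldRep hF hv P₀).contDiffAt (hO.mem_nhds ⟨hu, huF⟩)).differentiableAt (by simp)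
  -- Near u the contraction of ω with v is the differential of f, so this is d² = 0.
  have h0 : extDeriv (fun u => interior (fieldRep v P₀ u) (omegaModel m q)) u = 0 := by
    have e : (fun u => interior (fieldRep v P₀ u) (omegaModel m q)) =ᶠ[𝓝 u]
        extDeriv (localRep f P₀) := by
      filter_upwards [hO.mem_nhds ⟨hu, huF⟩] with y hy
      exact (extDeriv_localRep_observable hF hf h hy.1 hy.2).symm
    rw [e.extDeriv_eq]
    exact extDeriv_extDeriv_apply (hf.contDiffAt hF hu huF) minSmoothness_infty
  let L : (PhaseModel m q) →ₗ[ℝ] (EuclideanSpace ℝ (Fin (m + 2))) := (LinearMap.fst ℝ (EuclideanSpace ℝ (Fin (m + 2))) (PhaseModel m q)).comp ((fderiv ℝ (fieldRep v P₀) u).toLinearMap.comp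
    (LinearMap.inr ℝ (EuclideanSpace ℝ (Fin (m + 2))) (PhaseModel m q)))
  have hL : L = 0 := by
    refine eq_zero_of_pairing hfields L fun b₁ b₂ b₃ a => ?_
    have := interior_vertical_extDeriv_omegaLoc (pProj m q) (yProj m q) (hProj m q) hvd h0 b₁ b₂ b₃
    exact DFunLike.congr_fun this a
  exact DFunLike.congr_fun hL b

/-- The vector field along the projection given by a vector field on the total space. -/
def baseField (v : (P : PhaseBundle (m + 2) q M) → TangentSpace (phaseI m q) P)
    (P : PhaseBundle (m + 2) q M) : TangentSpace (𝓡 (m + 2)) P.proj :=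
  mfderiv (phaseI m q) (𝓡 (m + 2)) (proj (n := m + 2) (q := phaseDeg (m + 2) q)) P (v P)

/-- The bundle chart covers the base chart, so the base component in coordinates is the coordinate
expression of the projected vector. -/
theorem fieldRep_fst {ξ : (x : M) → TangentSpace (𝓡 (m + 2)) x} {P₀ : PhaseBundle (m + 2) q M}
    {u : (EuclideanSpace ℝ (Fin (m + 2))) × (PhaseModel m q)} (hu : u ∈ (extChartAt (phaseI m q) P₀).target)
    (h : baseField v ((extChartAt (phaseI m q) P₀).symm u) = ξ ((extChartAt (phaseI m q) P₀).symm u).proj) :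
    (fieldRep v P₀ u).1 = fieldRep ξ P₀.proj u.1 := by
  have hu1 : u.1 ∈ (extChartAt (𝓡 (m + 2)) P₀.proj).target := by
    rw [target_eq] at hu
    exact hu.1
  have h1 : (mfderiv 𝓘(ℝ, (EuclideanSpace ℝ (Fin (m + 2)))) (𝓡 (m + 2)) (extChartAt (𝓡 (m + 2)) P₀.proj).symm u.1
      (fieldRep v P₀ u).1 : (EuclideanSpace ℝ (Fin (m + 2)))) = ξ ((extChartAt (𝓡 (m + 2)) P₀.proj).symm u.1) := by
    have h2 := mfderiv_proj_symm P₀ hu (fieldRep v P₀ u)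
    have h3 := mfderiv_symm_fieldRep v hu
    have h4 : (ξ ((extChartAt (phaseI m q) P₀).symm u).proj : (EuclideanSpace ℝ (Fin (m + 2)))) =
        ξ ((extChartAt (𝓡 (m + 2)) P₀.proj).symm u.1) := by
      rw [proj_symm P₀ hu]
    rw [← h2, ← h4, ← h, baseField]
    exact congrArg _ h3
  have h5 := mfderiv_extChartAt_comp_symm P₀.proj hu1 (fieldRep v P₀ u).1
  rw [← h5]
  exact congrArg (mfderiv (𝓡 (m + 2)) 𝓘(ℝ, (EuclideanSpace ℝ (Fin (m + 2)))) (extChartAt (𝓡 (m + 2)) P₀.proj)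
    ((extChartAt (𝓡 (m + 2)) P₀.proj).symm u.1)) h1

/-- Subtracting the Noether current leaves an observable generated by a vertical field. -/
theorem extDeriv_localRep_sub_noether (hF : IsOpen F) (hf : SmoothFormOn f F)
    (h : ∀ P ∈ F, interior (v P) (omega (m + 2) q M P) = extD f P)
    {ξ : (x : M) → TangentSpace (𝓡 (m + 2)) x} [IsManifold (𝓡 (m + 2)) 1 M]
    (hξ : SmoothFieldOn ξ univ)
    {P₀ : PhaseBundle (m + 2) q M} {u : (EuclideanSpace ℝ (Fin (m + 2))) × (PhaseModel m q)} (hu : u ∈ (extChartAt (phaseI m q) P₀).target)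
    (huF : (extChartAt (phaseI m q) P₀).symm u ∈ F)
    (hv : baseField v ((extChartAt (phaseI m q) P₀).symm u) = ξ ((extChartAt (phaseI m q) P₀).symm u).proj) :
    ∃ b : (PhaseModel m q), extDeriv (localRep (fun P => f P - noether ξ P) P₀) u =
      interior ((0, b) : (EuclideanSpace ℝ (Fin (m + 2))) × (PhaseModel m q)) (omegaModel m q) := by
  have hu1 : u.1 ∈ (extChartAt (𝓡 (m + 2)) P₀.proj).target := by
    rw [target_eq] at hu
    exact hu.1
  have hξs : ContDiffOn ℝ ∞ (fieldRep ξ P₀.proj) (extChartAt (𝓡 (m + 2)) P₀.proj).target := by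
    simpa using contDiffOn_fieldRep isOpen_univ hξ P₀.proj
  -- Vertical part of the canonical lift of ξ: minus the infinitesimal action of Dξ in every slot,
  -- as `extDeriv_noetherLoc` demands.
  let b : (PhaseModel m q) := fun k => -lieTerm (fderiv ℝ (fieldRep ξ P₀.proj) u.1) (u.2 k)
  have hn : extDeriv (localRep (noether ξ) P₀) u =
      interior ((fieldRep ξ P₀.proj u.1, b) : (EuclideanSpace ℝ (Fin (m + 2))) × (PhaseModel m q)) (omegaModel m q) := by
    rw [omegaModel, ← extDeriv_noetherLoc (pProj m q) (yProj m q) (hProj m q)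
      (isOpen_extChartAt_target P₀.proj) hξs hu1 (fun _ => rfl) (fun _ => rfl) rfl]
    refine Filter.EventuallyEq.extDeriv_eq ?_
    filter_upwards [(isOpen_extChartAt_target P₀).mem_nhds hu] with y hy
    exact localRep_noether hξ hy
  have e : localRep (fun P => f P - noether ξ P) P₀ =
      fun u => localRep f P₀ u - localRep (noether ξ) P₀ u :=
    funext fun u => localRep_sub f (noether ξ) P₀ u
  have hd1 : DifferentiableAt ℝ (localRep f P₀) u :=
    (hf.contDiffAt hF hu huF).differentiableAt (by simp)
  have hd2 : DifferentiableAt ℝ (localRep (noether ξ) P₀) u :=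
    ((smoothFormOn_noether hξ).contDiffAt isOpen_univ hu (mem_univ _)).differentiableAt (by simp)
  -- v and the lift of ξ have the same base component, so their difference is vertical.
  refine ⟨(fieldRep v P₀ u).2 - b, ?_⟩
  rw [e, extDeriv_fun_sub hd1 hd2, extDeriv_localRep_observable hF hf h hu huF, hn,
    ← interior_sub_left]
  congr 1
  refine Prod.ext ?_ rfl
  change (fieldRep v P₀ u).1 - fieldRep ξ P₀.proj u.1 = 0
  rw [fieldRep_fst hu hv, sub_self]

end Observables


/-- Only the name of the degree changes, from l to m - k; the latter is the one in which simple
derivatives are declared. -/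
theorem exists_wedge_eq {V : Type*} [AddCommGroup V] [Module ℝ V] [TopologicalSpace V] {k l m : ℕ}
    (h : k + l = m) (β : V [⋀^Fin l]→L[ℝ] ℝ) :
    ∃ L : V [⋀^Fin (m - k)]→L[ℝ] ℝ, ∀ α : V [⋀^Fin k]→L[ℝ] ℝ, wedge m α β = wedge m α L := by
  obtain rfl : l = m - k := by omega
  exact ⟨β, fun _ => rfl⟩

theorem exists_wedge_swap {V : Type*} [AddCommGroup V] [Module ℝ V] [TopologicalSpace V]
    [IsTopologicalAddGroup V] [ContinuousSMul ℝ V] {k l m : ℕ}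
    (h : k + l = m) (β : V [⋀^Fin l]→L[ℝ] ℝ) :
    ∃ L : V [⋀^Fin (m - k)]→L[ℝ] ℝ, ∀ α : V [⋀^Fin k]→L[ℝ] ℝ, wedge m β α = wedge m α L := by
  obtain ⟨c, hc⟩ := exists_wedge_comm (V := V) l k m
  obtain ⟨L, hL⟩ := exists_wedge_eq (m := m) h (c • β)
  exact ⟨L, fun α => by rw [hc, ← hL, wedge_smul_right]⟩

/-! ### Charts and horizontal forms along a single fibre. -/

section Fibres

variable {n : ℕ} {κ : Type*} [Fintype κ] {d : κ → ℕ} {M : Type*} [TopologicalSpace M]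
  [ChartedSpace (EuclideanSpace ℝ (Fin n)) M] [IsManifold (𝓡 n) ∞ M]

/-- The chart centred at P has identity derivative at P and covers the chart centred at its base
point. Tangent vectors at P are thus pairs whose first entry is the base component. -/
theorem mfderiv_proj (P : FormBundle n d M) (w : EuclideanSpace ℝ (Fin n) × FormModel n d) :
    (mfderiv (bundleModel n d) (𝓡 n) (proj (n := n) (q := d)) P w : EuclideanSpace ℝ (Fin n)) =
      w.1 := by
  have key : ∀ (x : FormBundle n d M) (L : (EuclideanSpace ℝ (Fin n) × FormModel n d) →L[ℝ]
      (EuclideanSpace ℝ (Fin n) × FormModel n d)), x = P → L = ContinuousLinearMap.id ℝ _ →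
      (mfderiv (bundleModel n d) (𝓡 n) (proj (n := n) (q := d)) x (L w) :
        EuclideanSpace ℝ (Fin n)) =
      mfderiv (bundleModel n d) (𝓡 n) (proj (n := n) (q := d)) P w := by
    rintro x L rfl rfl
    rfl
  have h1 := key _ _ (extChartAt_to_inv (I := bundleModel n d) P) (mfderiv_extChartAt_symm_self (I := bundleModel n d) P)
  rw [← h1]
  refine (mfderiv_proj_symm P (mem_extChartAt_target P) w).trans ?_
  have h2 : (extChartAt (bundleModel n d) P P).1 = extChartAt (𝓡 n) P.proj P.proj := chart_fst P P
  rw [h2]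
  exact DFunLike.congr_fun (mfderiv_extChartAt_symm_self (I := 𝓡 n) P.proj) w.1

/-- The horizontal part of a form on the total space. -/
def horPart {k : ℕ} (β : DForm (bundleModel n d) (FormBundle n d M) k) : HorizontalForm n d M k :=
  fun P => (β P : (EuclideanSpace ℝ (Fin n) × FormModel n d) [⋀^Fin k]→L[ℝ] ℝ).compContinuousLinearMap
    (ContinuousLinearMap.inl ℝ (EuclideanSpace ℝ (Fin n)) (FormModel n d))

theorem toForm_horPart {k : ℕ} {β : DForm (bundleModel n d) (FormBundle n d M) k}
    {P : FormBundle n d M} (h : VertFilt (E := EuclideanSpace ℝ (Fin n)) (G := FormModel n d) 1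
      (β P)) : (horPart β).toForm P = β P := by
  refine Eq.trans ?_ (VertFilt.eq_horL h).symm
  ext w
  have h2 : ∀ i, _ := fun i => mfderiv_proj P (w i)
  exact congrArg (horPart β P : EuclideanSpace ℝ (Fin n) [⋀^Fin k]→L[ℝ] ℝ) (funext h2)

theorem fibre_mem_target (x : M) (z₀ z : FormModel n d) :
    (extChartAt (𝓡 n) x x, z) ∈
      (extChartAt (bundleModel n d) (⟨x, z₀⟩ : FormBundle n d M)).target := by
  rw [target_eq]
  exact ⟨mem_extChartAt_target x, mem_univ z⟩

/-- The inverse base chart has identity derivative at its centre, so the bundle chart does not alter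
the fibre over x. Questions about one fibre can be treated in the model. -/
theorem chart_fibre (x : M) (z₀ z : FormModel n d) :
    extChartAt (bundleModel n d) (⟨x, z₀⟩ : FormBundle n d M) (⟨x, z⟩ : FormBundle n d M) =
      (extChartAt (𝓡 n) x x, z) := by
  refine Prod.ext (chart_fst _ _) (funext fun k => ?_)
  refine ContinuousAlternatingMap.ext fun w => ?_
  let L : EuclideanSpace ℝ (Fin n) →L[ℝ] EuclideanSpace ℝ (Fin n) :=
    mfderiv 𝓘(ℝ, EuclideanSpace ℝ (Fin n)) (𝓡 n) (extChartAt (𝓡 n) x).symm (extChartAt (𝓡 n) x x)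
  have hL : L = ContinuousLinearMap.id ℝ _ := mfderiv_extChartAt_symm_self (I := 𝓡 n) x
  have h : (extChartAt (bundleModel n d) (⟨x, z₀⟩ : FormBundle n d M)
      (⟨x, z⟩ : FormBundle n d M)).2 k w = z k (fun i => L (w i)) :=
    chart_snd (mem_source_iff.2 (mem_extChartAt_source (I := 𝓡 n) x)) k w
  rw [h, hL]
  rfl

theorem chart_symm_fibre (x : M) (z₀ z : FormModel n d) :
    (extChartAt (bundleModel n d) (⟨x, z₀⟩ : FormBundle n d M)).symm (extChartAt (𝓡 n) x x, z) =
      ⟨x, z⟩ := by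
  rw [← chart_fibre x z₀ z]
  exact (extChartAt (bundleModel n d) (⟨x, z₀⟩ : FormBundle n d M)).left_inv
    (mem_source_iff.2 (mem_extChartAt_source (I := 𝓡 n) x))

theorem continuous_fibre (x : M) :
    Continuous fun z : FormModel n d => (⟨x, z⟩ : FormBundle n d M) := by
  have h : Continuous fun z : FormModel n d => (extChartAt (bundleModel n d)
      (⟨x, (0 : FormModel n d)⟩ : FormBundle n d M)).symm (extChartAt (𝓡 n) x x, z) :=
    (continuousOn_extChartAt_symm _).comp_continuous (by fun_prop) (fibre_mem_target x 0)
  exact h.congr fun z => chart_symm_fibre x 0 z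

theorem baseRep_fibre {k : ℕ} (Q : HorizontalForm n d M k) (x : M) (z₀ z : FormModel n d) :
    baseRep Q (⟨x, z₀⟩ : FormBundle n d M) (extChartAt (𝓡 n) x x, z) = Q.onFiber x z := by
  have key : ∀ (y : FormBundle n d M) (L : EuclideanSpace ℝ (Fin n) →L[ℝ] EuclideanSpace ℝ (Fin n)),
      y = ⟨x, z⟩ → L = ContinuousLinearMap.id ℝ _ →
      (Q y : EuclideanSpace ℝ (Fin n) [⋀^Fin k]→L[ℝ] ℝ).compContinuousLinearMap L =
        Q.onFiber x z := by
    rintro y L rfl rfl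
    rfl
  exact key _ _ (chart_symm_fibre x z₀ z) (mfderiv_extChartAt_symm_self (I := 𝓡 n) x)

end Fibres


/-! ### The horizontal remainder: simple differentiability and independence of h. -/

theorem differentiableAt_of_horL {E G : Type*} [NormedAddCommGroup E] [NormedSpace ℝ E]
    [NormedAddCommGroup G] [NormedSpace ℝ G] {k : ℕ} {Q : E × G → E [⋀^Fin k]→L[ℝ] ℝ} {u : E × G}
    (h : DifferentiableAt ℝ (fun u => horL E G k (Q u)) u) : DifferentiableAt ℝ Q u :=
  (ContinuousAlternatingMap.compContinuousLinearMapCLM (F := ℝ) (ι := Fin k)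
    (ContinuousLinearMap.inl ℝ E G)).differentiableAt.comp u h

/-- Only the derivative along the segment matters; it is applied to two points that differ in h
alone. -/
theorem eq_of_hasFDerivAt_segment {G B : Type*} [NormedAddCommGroup G] [NormedSpace ℝ G]
    [NormedAddCommGroup B] [NormedSpace ℝ B] {g : G → B} {z z' : G}
    (h : ∀ t ∈ Icc (0 : ℝ) 1, ∃ D : G →L[ℝ] B, HasFDerivAt g D (z + t • (z' - z)) ∧
      D (z' - z) = 0) : g z = g z' := by
  have hg : ∀ t ∈ Icc (0 : ℝ) 1, HasDerivAt (fun t : ℝ => g (z + t • (z' - z))) 0 t := by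
    intro t ht
    obtain ⟨D, hD, hb⟩ := h t ht
    have h1 : HasDerivAt (fun t : ℝ => z + t • (z' - z)) (z' - z) t := by
      simpa using ((hasDerivAt_id t).smul_const (z' - z)).const_add z
    have h2 := hD.comp_hasDerivAt t h1
    rwa [hb] at h2
  have := constant_of_has_deriv_right_zero (fun t ht => (hg t ht).continuousAt.continuousWithinAt)
    (fun t ht => (hg t (Ico_subset_Icc_self ht)).hasDerivWithinAt) 1 (by simp)
  simpa using this.symm

section Decomposition

variable {m : ℕ} {ι : Type*} [Fintype ι] {q : ι → ℕ} {M : Type*} [TopologicalSpace M]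
  [ChartedSpace (EuclideanSpace ℝ (Fin (m + 2))) M] [IsManifold (𝓡 (m + 2)) ∞ M]

theorem pairing_add_right (b δ δ' : PhaseModel m q) :
    pairing b (δ + δ') = pairing b δ + pairing b δ' := by
  rw [pairing, pairing, pairing, ← Finset.sum_add_distrib]
  refine Finset.sum_congr rfl fun A _ => ?_
  have e1 : yPart (δ + δ') A = yPart δ A + yPart δ' A := rfl
  have e2 : pPart (δ + δ') A = pPart δ A + pPart δ' A := rfl
  rw [e1, e2, wedge_add_right, wedge_add_left, add_sub_add_comm]

/-- A slot of y^A or p_A selects the single term with the conjugate component of b. Fields of degree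
n and h have no conjugate, the pairing ignores them, and L = 0. -/
theorem pairing_inSlot (b : PhaseModel m q) (k : ι ⊕ {A : ι // q A < m + 2} ⊕ Unit) :
    ∃ L : EuclideanSpace ℝ (Fin (m + 2)) [⋀^Fin (m + 1 - phaseDeg (m + 2) q k)]→L[ℝ] ℝ,
      ∀ ζ : EuclideanSpace ℝ (Fin (m + 2)) [⋀^Fin (phaseDeg (m + 2) q k)]→L[ℝ] ℝ,
        pairing b (inSlot k ζ) = wedge (m + 1) ζ L := by
  rcases k with A | A | _
  · by_cases h : q A < m + 2
    · obtain ⟨L, hL⟩ := exists_wedge_swap (k := q A) (l := m + 2 - q A - 1) (m := m + 1) (by omega)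
        (pPart b ⟨A, h⟩)
      exact ⟨L, fun ζ => (pairing_slotY b ⟨A, h⟩ ζ).trans (hL ζ)⟩
    · refine ⟨0, fun ζ => ?_⟩
      rw [wedge_zero_right]
      refine Finset.sum_eq_zero fun A' _ => ?_
      have e1 : yPart (inSlot (Sum.inl A) ζ) A' = 0 :=
        inSlot_of_ne (fun e => h ((Sum.inl_injective e : A'.1 = A) ▸ A'.2)) ζ
      have e2 : pPart (inSlot (Sum.inl A) ζ) A' = 0 := inSlot_of_ne (by simp) ζ
      rw [e1, e2, wedge_zero_left, wedge_zero_right, sub_zero]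
  · obtain ⟨L, hL⟩ := exists_wedge_eq (k := m + 2 - q A - 1) (l := q A) (m := m + 1)
      (by have := A.2; omega) (yPart b A)
    exact ⟨-L, fun ζ => (pairing_slotP b A ζ).trans
      ((congrArg _ (hL ζ)).trans (wedge_neg_right _ _ _).symm)⟩
  · refine ⟨0, fun ζ => ?_⟩
    rw [wedge_zero_right]
    refine Finset.sum_eq_zero fun A' _ => ?_
    have e1 : yPart (inSlot (Sum.inr (Sum.inr ())) ζ) A' = 0 := inSlot_of_ne (by simp) ζ
    have e2 : pPart (inSlot (Sum.inr (Sum.inr ())) ζ) A' = 0 := inSlot_of_ne (by simp) ζ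
    rw [e1, e2, wedge_zero_left, wedge_zero_right, sub_zero]

theorem exists_pairing_eq (b : PhaseModel m q) :
    ∃ L : ∀ k, EuclideanSpace ℝ (Fin (m + 2)) [⋀^Fin (m + 1 - phaseDeg (m + 2) q k)]→L[ℝ] ℝ,
      ∀ δ : PhaseModel m q, pairing b δ = ∑ k, wedge (m + 1) (δ k) (L k) := by
  choose L hL using pairing_inSlot b
  refine ⟨L, fun δ => ?_⟩
  have h := map_sum (AddMonoidHom.mk' (pairing b) (pairing_add_right b))
    (fun k => inSlot k (δ k)) Finset.univ
  rw [sum_inSlot] at h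
  exact h.trans (Finset.sum_congr rfl fun k _ => hL k (δ k))

variable {f : DForm (phaseI m q) (PhaseBundle (m + 2) q M) (m + 1)}
  {v : (P : PhaseBundle (m + 2) q M) → TangentSpace (phaseI m q) P}
  {U : Set (PhaseBundle (m + 2) q M)}

/-- If an observable differs from a Noether current and an exact form by a horizontal form, the
latter is simply differentiable and independent of `h`. -/
theorem decomposesOn_of_vertFilt (hU : IsOpen U) (hf : SmoothFormOn f U)
    (h : ∀ P ∈ U, interior (v P) (omega (m + 2) q M P) = extD f P)
    {ξ : (x : M) → TangentSpace (𝓡 (m + 2)) x} [IsManifold (𝓡 (m + 2)) 1 M]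
    (hξ : SmoothFieldOn ξ univ) (hv : ∀ P ∈ U, baseField v P = ξ P.proj)
    {α : DForm (phaseI m q) (PhaseBundle (m + 2) q M) m} (hα : SmoothFormOn α U)
    (hH : ∀ P ∈ U, VertFilt (E := EuclideanSpace ℝ (Fin (m + 2))) (G := PhaseModel m q) 1
      (f P - noether ξ P - extD α P))
    (hseg : ∀ (x : M) (z z' : PhaseModel m q), (⟨x, z⟩ : PhaseBundle (m + 2) q M) ∈ U →
      (⟨x, z'⟩ : PhaseBundle (m + 2) q M) ∈ U → (∀ A, z (Sum.inl A) = z' (Sum.inl A)) →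
      (∀ A, z (Sum.inr (Sum.inl A)) = z' (Sum.inr (Sum.inl A))) →
      ∀ t ∈ Icc (0 : ℝ) 1, (⟨x, z + t • (z' - z)⟩ : PhaseBundle (m + 2) q M) ∈ U) :
    DecomposesOn f U := by
  let β : DForm (phaseI m q) (PhaseBundle (m + 2) q M) (m + 1) := fun P =>
    f P - noether ξ P - extD α P
  have hβ : ∀ P ∈ U, (horPart β).toForm P = β P := fun P hP => toForm_horPart (hH P hP)
  have hloc : ∀ P₀, ∀ u ∈ (extChartAt (phaseI m q) P₀).target ∩
      (extChartAt (phaseI m q) P₀).symm ⁻¹' U, localRep (horPart β).toForm P₀ u =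
      localRep (fun P => f P - noether ξ P) P₀ u - extDeriv (localRep α P₀) u := by
    intro P₀ u hu
    rw [localRep_congr (hβ _ hu.2), ← localRep_extD hU hα hu.1 hu.2]
    rfl
  have hf' : ∀ P₀, ContDiffOn ℝ ∞ (localRep (fun P => f P - noether ξ P) P₀)
      ((extChartAt (phaseI m q) P₀).target ∩ (extChartAt (phaseI m q) P₀).symm ⁻¹' U) :=
    fun P₀ => ContDiffOn.sub (hf P₀) ((smoothFormOn_noether hξ).mono (subset_univ U) P₀)
  have hQ : SmoothFormOn (horPart β).toForm U := fun P₀ =>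
    ((hf' P₀).sub (contDiffOn_extDeriv (isOpen_overlap P₀ hU) (hα P₀))).congr (hloc P₀)
  -- Subtracting dα does not change the exterior derivative, so the horizontal remainder satisfies
  -- dQ = i_b ω with b vertical. Its derivative along the fibre is therefore the pairing with b.
  have key : ∀ (x : M) (z : PhaseModel m q), (⟨x, z⟩ : PhaseBundle (m + 2) q M) ∈ U →
      ∃ b : PhaseModel m q, ∃ D : PhaseModel m q →L[ℝ]
        EuclideanSpace ℝ (Fin (m + 2)) [⋀^Fin (m + 1)]→L[ℝ] ℝ,
        HasFDerivAt ((horPart β).onFiber x) D z ∧ ∀ δ, D δ = pairing b δ := by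
    intro x z hz
    set P : PhaseBundle (m + 2) q M := ⟨x, z⟩ with hP
    set u := (extChartAt (𝓡 (m + 2)) x x, z) with hu
    have hut : u ∈ (extChartAt (phaseI m q) P).target := fibre_mem_target x z z
    have huU : (extChartAt (phaseI m q) P).symm u ∈ U := by
      rw [chart_symm_fibre x z z]
      exact hz
    have hN := (isOpen_overlap P hU).mem_nhds ⟨hut, huU⟩
    have hd : DifferentiableAt ℝ (baseRep (horPart β) P) u := by
      refine differentiableAt_of_horL (((hQ.contDiffAt hU hut huU).differentiableAt
        (by simp)).congr_of_eventuallyEq ?_)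
      filter_upwards [hN] with y hy using (localRep_toForm _ hy.1).symm
    obtain ⟨b, hb⟩ := extDeriv_localRep_sub_noether hU hf h hξ hut huU (hv _ huU)
    have hE : extDeriv (fun u => horL _ _ _ (baseRep (horPart β) P u)) u =
        interior ((0, b) : EuclideanSpace ℝ (Fin (m + 2)) × PhaseModel m q) (omegaModel m q) := by
      rw [← hb]
      have e1 : (fun u => horL _ _ _ (baseRep (horPart β) P u)) =ᶠ[𝓝 u] fun u =>
          localRep (fun P => f P - noether ξ P) P u - extDeriv (localRep α P) u := by
        filter_upwards [hN] with y hy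
        rw [← localRep_toForm _ hy.1, hloc P y hy]
      rw [e1.extDeriv_eq, extDeriv_fun_sub (((hf' P).contDiffAt hN).differentiableAt (by simp))
        (((contDiffOn_extDeriv (isOpen_overlap P hU) (hα P)).contDiffAt hN).differentiableAt
          (by simp)), extDeriv_extDeriv_apply ((hα P).contDiffAt hN) minSmoothness_infty, sub_zero]
    refine ⟨b, (fderiv ℝ (baseRep (horPart β) P) u).comp (ContinuousLinearMap.inr ℝ _ _), ?_,
      fun δ => fderiv_vertical_of_extDeriv (pProj m q) (yProj m q) (hProj m q) hd hE δ⟩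
    have h3 := hd.hasFDerivAt.comp z (hasFDerivAt_prodMk_right (extChartAt (𝓡 (m + 2)) x x) z)
    refine h3.congr_of_eventuallyEq (Filter.Eventually.of_forall fun z' => ?_)
    exact (baseRep_fibre (horPart β) x z z').symm
  refine ⟨ξ, horPart β, α, hξ, hQ, fun P hP => ?_, fun x z z' hz hz' hy hp => ?_, hα,
    fun P hP => ?_⟩
  · obtain ⟨b, D, hD, hb⟩ := key P.proj P.2 hP
    obtain ⟨L, hL⟩ := exists_pairing_eq b
    refine ⟨hD.differentiableAt, L, fun δ => ?_⟩
    rw [hD.fderiv, hb, hL]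
  -- z' - z has only an h-component, which the pairing does not see.
  · refine eq_of_hasFDerivAt_segment fun t ht => ?_
    obtain ⟨b, D, hD, hb⟩ := key x _ (hseg x z z' hz hz' hy hp t ht)
    refine ⟨D, hD, ?_⟩
    rw [hb]
    refine Finset.sum_eq_zero fun A _ => ?_
    have e1 : yPart (z' - z) A = 0 := sub_eq_zero.2 (hy A.1).symm
    have e2 : pPart (z' - z) A = 0 := sub_eq_zero.2 (hp A).symm
    rw [e1, e2, wedge_zero_left, wedge_zero_right, sub_zero]
  · have e : ∀ a b c : (EuclideanSpace ℝ (Fin (m + 2)) × PhaseModel m q) [⋀^Fin (m + 1)]→L[ℝ] ℝ,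
        a = b + (a - b - c) + c := fun a b c => by abel
    rw [hβ P hP]
    exact e _ _ _

end Decomposition


/-! ### The vector field on `M` below the generator of an observable. -/

theorem smoothFieldOn_of_fieldRep {E : Type*} [NormedAddCommGroup E] [NormedSpace ℝ E]
    {H : Type*} [TopologicalSpace H] {I : ModelWithCorners ℝ E H} {N : Type*} [TopologicalSpace N]
    [ChartedSpace H N] [IsManifold I ∞ N] [IsManifold I 1 N] {v : (P : N) → TangentSpace I P}
    {U : Set N} (P₀ : N) (hU : IsOpen U) (hUs : U ⊆ (extChartAt I P₀).source)
    (h : ContDiffOn ℝ ∞ (fieldRep v P₀)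
      ((extChartAt I P₀).target ∩ (extChartAt I P₀).symm ⁻¹' U)) : SmoothFieldOn v U := by
  have : IsManifold I (∞ + 1) N := by simpa
  have hb : ((chartAt H P₀).source : Set N) = (trivializationAt E (TangentSpace I) P₀).baseSet := by
    simp
  rw [extChartAt_source] at hUs
  refine ((trivializationAt E (TangentSpace I) P₀).contMDiffOn_section_iff hU
    (fun x hx => hb ▸ hUs hx)).2 ?_
  have h2 := h.contMDiffOn.comp ((contMDiffOn_extChartAt (n := ∞) (x := P₀)).mono hUs)
    (fun x hx => by
      have hx' : x ∈ (extChartAt I P₀).source := by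
        rw [extChartAt_source]
        exact hUs hx
      exact ⟨(extChartAt I P₀).map_source hx', by
        rw [mem_preimage, (extChartAt I P₀).left_inv hx']
        exact hx⟩)
  refine h2.congr fun x hx => ?_
  have hx' : x ∈ (extChartAt I P₀).source := by
    rw [extChartAt_source]
    exact hUs hx
  have h3 := DFunLike.congr_fun (TangentBundle.continuousLinearMapAt_trivializationAt (hUs hx))
    (v x)
  have h4 : ∀ y, y = x → (mfderiv I 𝓘(ℝ, E) (extChartAt I P₀) y (v y) : E) =
      mfderiv I 𝓘(ℝ, E) (extChartAt I P₀) x (v x) := by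
    rintro y rfl
    rfl
  refine Eq.trans ?_ (h3.trans (h4 _ ((extChartAt I P₀).left_inv hx')).symm)
  exact (congrFun (Trivialization.coe_linearMapAt_of_mem
    (trivializationAt E (TangentSpace I) P₀) (R := ℝ) (hb ▸ hUs hx)) _).symm

theorem hasFDerivAt_fst_partial {E G A B : Type*} [NormedAddCommGroup E] [NormedSpace ℝ E]
    [NormedAddCommGroup G] [NormedSpace ℝ G] [NormedAddCommGroup A] [NormedSpace ℝ A]
    [NormedAddCommGroup B] [NormedSpace ℝ B] {g : E × G → A × B} {e : E} {y : G}
    (h : DifferentiableAt ℝ g (e, y)) (h0 : ∀ b, (fderiv ℝ g (e, y) (0, b)).1 = 0) :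
    HasFDerivAt (fun y => (g (e, y)).1) (0 : G →L[ℝ] A) y := by
  have h1 := (h.hasFDerivAt.comp y (hasFDerivAt_prodMk_right e y)).fst
  exact h1.congr_fderiv (ContinuousLinearMap.ext h0)

section BaseField

variable {m : ℕ} {ι : Type*} [Fintype ι] {q : ι → ℕ} {M : Type*} [TopologicalSpace M]
  [ChartedSpace (EuclideanSpace ℝ (Fin (m + 2))) M] [IsManifold (𝓡 (m + 2)) ∞ M]

variable {f : DForm (phaseI m q) (PhaseBundle (m + 2) q M) (m + 1)}
  {v : (P : PhaseBundle (m + 2) q M) → TangentSpace (phaseI m q) P}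
  {F : Set (PhaseBundle (m + 2) q M)}

theorem baseField_symm {P₀ : PhaseBundle (m + 2) q M}
    {u : EuclideanSpace ℝ (Fin (m + 2)) × PhaseModel m q}
    (hu : u ∈ (extChartAt (phaseI m q) P₀).target) :
    (baseField v ((extChartAt (phaseI m q) P₀).symm u) : EuclideanSpace ℝ (Fin (m + 2))) =
      mfderiv 𝓘(ℝ, EuclideanSpace ℝ (Fin (m + 2))) (𝓡 (m + 2))
        (extChartAt (𝓡 (m + 2)) P₀.proj).symm u.1 (fieldRep v P₀ u).1 := by
  have h2 := mfderiv_proj_symm P₀ hu (fieldRep v P₀ u)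
  have h3 := mfderiv_symm_fieldRep v hu
  rw [← h2, baseField]
  exact congrArg _ h3.symm

theorem baseField_fibre (x : M) (z₀ z : PhaseModel m q) :
    (baseField v (⟨x, z⟩ : PhaseBundle (m + 2) q M) : EuclideanSpace ℝ (Fin (m + 2))) =
      (fieldRep v (⟨x, z₀⟩ : PhaseBundle (m + 2) q M) (extChartAt (𝓡 (m + 2)) x x, z)).1 := by
  have key : ∀ P : PhaseBundle (m + 2) q M, P = ⟨x, z⟩ →
      (baseField v P : EuclideanSpace ℝ (Fin (m + 2))) =
        baseField v (⟨x, z⟩ : PhaseBundle (m + 2) q M) := by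
    rintro P rfl
    rfl
  rw [← key _ (chart_symm_fibre x z₀ z), baseField_symm (fibre_mem_target x z₀ z)]
  exact DFunLike.congr_fun (mfderiv_extChartAt_symm_self (I := 𝓡 (m + 2)) x) _

theorem isOpen_slice (P₀ : PhaseBundle (m + 2) q M) (hF : IsOpen F) (z : PhaseModel m q) :
    IsOpen ((extChartAt (𝓡 (m + 2)) P₀.proj).source ∩ extChartAt (𝓡 (m + 2)) P₀.proj ⁻¹'
      {e | (e, z) ∈ (extChartAt (phaseI m q) P₀).target ∩
        (extChartAt (phaseI m q) P₀).symm ⁻¹' F}) :=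
  (continuousOn_extChartAt P₀.proj).isOpen_inter_preimage (isOpen_extChartAt_source P₀.proj)
    ((isOpen_overlap (I := phaseI m q) P₀ hF).preimage (by fun_prop))

/-- Keeping the fibre coordinate z fixed gives a smooth local section; the base component of v along
it inherits smoothness. -/
theorem smoothFieldOn_slice [IsManifold (𝓡 (m + 2)) 1 M] {P₀ : PhaseBundle (m + 2) q M}
    (hF : IsOpen F) (hv : SmoothFieldOn v F) {z : PhaseModel m q}
    {ξ : (x : M) → TangentSpace (𝓡 (m + 2)) x}
    (h : ∀ e, (e, z) ∈ (extChartAt (phaseI m q) P₀).target ∩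
      (extChartAt (phaseI m q) P₀).symm ⁻¹' F → fieldRep ξ P₀.proj e = (fieldRep v P₀ (e, z)).1) :
    SmoothFieldOn ξ ((extChartAt (𝓡 (m + 2)) P₀.proj).source ∩ extChartAt (𝓡 (m + 2)) P₀.proj ⁻¹'
      {e | (e, z) ∈ (extChartAt (phaseI m q) P₀).target ∩
        (extChartAt (phaseI m q) P₀).symm ⁻¹' F}) := by
  refine smoothFieldOn_of_fieldRep P₀.proj (isOpen_slice P₀ hF z) inter_subset_left ?_
  have hmem : ∀ e ∈ (extChartAt (𝓡 (m + 2)) P₀.proj).target ∩ (extChartAt (𝓡 (m + 2))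
      P₀.proj).symm ⁻¹' ((extChartAt (𝓡 (m + 2)) P₀.proj).source ∩
      extChartAt (𝓡 (m + 2)) P₀.proj ⁻¹' {e | (e, z) ∈ (extChartAt (phaseI m q) P₀).target ∩
        (extChartAt (phaseI m q) P₀).symm ⁻¹' F}), (e, z) ∈ (extChartAt (phaseI m q) P₀).target ∩
        (extChartAt (phaseI m q) P₀).symm ⁻¹' F := by
    intro e he
    have := he.2.2
    rwa [mem_preimage, (extChartAt (𝓡 (m + 2)) P₀.proj).right_inv he.1] at this
  have hs : ContDiffOn ℝ ∞ (fun e => (fieldRep v P₀ (e, z)).1) _ :=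
    contDiff_fst.comp_contDiffOn ((contDiffOn_fieldRep hF hv P₀).comp
      (contDiff_prodMk_left z).contDiffOn hmem)
  exact hs.congr fun e he => h e (hmem e he)

/-- If the fibres are connected, the generator of an observable projects to the base. -/
theorem exists_field_of_preconnected (hfields : 2 ≤ ∑ A, (m + 1).choose (q A)) (hF : IsOpen F)
    [IsManifold (𝓡 (m + 2)) 1 M] (hf : SmoothFormOn f F) (hv : SmoothFieldOn v F)
    (h : ∀ P ∈ F, interior (v P) (omega (m + 2) q M P) = extD f P)
    (hne : ∀ x : M, ∃ z : PhaseModel m q, (⟨x, z⟩ : PhaseBundle (m + 2) q M) ∈ F)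
    (hpc : ∀ x : M, IsPreconnected {z : PhaseModel m q | (⟨x, z⟩ : PhaseBundle (m + 2) q M) ∈ F}) :
    ∃ ξ : (x : M) → TangentSpace (𝓡 (m + 2)) x, SmoothFieldOn ξ univ ∧
      ∀ P ∈ F, baseField v P = ξ P.proj := by
  -- The points s x are chosen without any regularity in x; smoothness of ξ is obtained afterwards,
  -- since the projection of v does not depend on the point of the fibre.
  choose s hs using hne
  let ξ : (x : M) → TangentSpace (𝓡 (m + 2)) x := fun x =>
    baseField v (⟨x, s x⟩ : PhaseBundle (m + 2) q M)
  have hO : ∀ x, IsOpen {z : PhaseModel m q | (⟨x, z⟩ : PhaseBundle (m + 2) q M) ∈ F} := fun x =>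
    hF.preimage (continuous_fibre x)
  have hconst : ∀ P ∈ F, baseField v P = ξ P.proj := by
    rintro ⟨x, z⟩ hz
    have hsm : ∀ y : PhaseModel m q, (⟨x, y⟩ : PhaseBundle (m + 2) q M) ∈ F →
        HasFDerivAt (fun y => (fieldRep v (⟨x, z⟩ : PhaseBundle (m + 2) q M)
          (extChartAt (𝓡 (m + 2)) x x, y)).1) (0 : PhaseModel m q →L[ℝ] _) y := by
      intro y hy
      have hut := fibre_mem_target (d := phaseDeg (m + 2) q) x z y
      have huF : (extChartAt (phaseI m q) (⟨x, z⟩ : PhaseBundle (m + 2) q M)).symm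
          (extChartAt (𝓡 (m + 2)) x x, y) ∈ F := by
        rw [chart_symm_fibre x z y]
        exact hy
      have h1 := ((contDiffOn_fieldRep hF hv (⟨x, z⟩ : PhaseBundle (m + 2) q M)).contDiffAt
        ((isOpen_overlap (I := phaseI m q) _ hF).mem_nhds ⟨hut, huF⟩)).differentiableAt (by simp)
      exact hasFDerivAt_fst_partial h1 fun b =>
        fderiv_fieldRep_vertical hfields hF hf hv h hut huF b
    -- The base component has zero derivative on the fibre, which is open and connected.
    obtain ⟨a, ha⟩ := (hO x).exists_is_const_of_fderiv_eq_zero (𝕜 := ℝ) (hpc x)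
      (fun y hy => (hsm y hy).differentiableAt.differentiableWithinAt) (fun y hy => (hsm y hy).fderiv)
    exact (baseField_fibre x z z).trans ((ha z hz).trans
      ((ha _ (hs x)).symm.trans (baseField_fibre x z (s x)).symm))
  refine ⟨ξ, fun x _ => ?_, hconst⟩
  -- Near x the section s may be replaced by the one with constant fibre coordinate s x, which
  -- yields the same values of ξ.
  have hsl := smoothFieldOn_slice (P₀ := (⟨x, s x⟩ : PhaseBundle (m + 2) q M)) hF hv (z := s x)
    (ξ := ξ) fun e he => (fieldRep_fst he.1 (hconst _ he.2)).symm
  refine (hsl.contMDiffAt ((isOpen_slice _ hF (s x)).mem_nhds ?_)).contMDiffWithinAt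
  refine ⟨mem_extChartAt_source x, fibre_mem_target x (s x) (s x), ?_⟩
  rw [mem_preimage, chart_symm_fibre x (s x) (s x)]
  exact hs x

/-- Near each point, the generator of an observable projects to the base. -/
theorem exists_field_of_mem [T2Space M] (hfields : 2 ≤ ∑ A, (m + 1).choose (q A)) (hF : IsOpen F)
    [IsManifold (𝓡 (m + 2)) 1 M] (hf : SmoothFormOn f F) (hv : SmoothFieldOn v F)
    (h : ∀ P ∈ F, interior (v P) (omega (m + 2) q M P) = extD f P)
    {x : M} {z₀ : PhaseModel m q} (hP : (⟨x, z₀⟩ : PhaseBundle (m + 2) q M) ∈ F) :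
    ∃ ξ : (x : M) → TangentSpace (𝓡 (m + 2)) x, SmoothFieldOn ξ univ ∧ ∃ r > 0,
      ∀ u ∈ Metric.ball (extChartAt (𝓡 (m + 2)) x x) r ×ˢ Metric.ball z₀ r,
        u ∈ (extChartAt (phaseI m q) (⟨x, z₀⟩ : PhaseBundle (m + 2) q M)).target ∧ (extChartAt (phaseI m q) (⟨x, z₀⟩ : PhaseBundle (m + 2) q M)).symm u ∈ F ∧
        baseField v ((extChartAt (phaseI m q) (⟨x, z₀⟩ : PhaseBundle (m + 2) q M)).symm u) =
          ξ ((extChartAt (phaseI m q) (⟨x, z₀⟩ : PhaseBundle (m + 2) q M)).symm u).proj := by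
  let P : PhaseBundle (m + 2) q M := ⟨x, z₀⟩
  have hO := isOpen_overlap (I := phaseI m q) P hF
  set e₀ := extChartAt (𝓡 (m + 2)) x x with he₀
  -- The projection of v along the constant section z₀ of the chart around P; it is meaningful only
  -- near x.
  let X : (x : M) → TangentSpace (𝓡 (m + 2)) x := fun y =>
    (mfderiv 𝓘(ℝ, EuclideanSpace ℝ (Fin (m + 2))) (𝓡 (m + 2)) (extChartAt (𝓡 (m + 2)) x).symm
      (extChartAt (𝓡 (m + 2)) x y) (fieldRep v P (extChartAt (𝓡 (m + 2)) x y, z₀)).1 :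
      EuclideanSpace ℝ (Fin (m + 2)))
  have hX : ∀ e ∈ (extChartAt (𝓡 (m + 2)) x).target,
      fieldRep X x e = (fieldRep v P (e, z₀)).1 := by
    intro e he
    refine Eq.trans ?_ (mfderiv_extChartAt_comp_symm x he (fieldRep v P (e, z₀)).1)
    have : (X ((extChartAt (𝓡 (m + 2)) x).symm e) : EuclideanSpace ℝ (Fin (m + 2))) =
        mfderiv 𝓘(ℝ, EuclideanSpace ℝ (Fin (m + 2))) (𝓡 (m + 2)) (extChartAt (𝓡 (m + 2)) x).symm
          e (fieldRep v P (e, z₀)).1 := by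
      have key : ∀ e', e' = e → (mfderiv 𝓘(ℝ, EuclideanSpace ℝ (Fin (m + 2))) (𝓡 (m + 2))
          (extChartAt (𝓡 (m + 2)) x).symm e' (fieldRep v P (e', z₀)).1 :
            EuclideanSpace ℝ (Fin (m + 2))) =
          mfderiv 𝓘(ℝ, EuclideanSpace ℝ (Fin (m + 2))) (𝓡 (m + 2)) (extChartAt (𝓡 (m + 2)) x).symm
          e (fieldRep v P (e, z₀)).1 := by
        rintro e' rfl
        rfl
      exact key _ ((extChartAt (𝓡 (m + 2)) x).right_inv he)
    exact congrArg (mfderiv (𝓡 (m + 2)) 𝓘(ℝ, EuclideanSpace ℝ (Fin (m + 2)))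
      (extChartAt (𝓡 (m + 2)) x) ((extChartAt (𝓡 (m + 2)) x).symm e)) this
  have hXs := smoothFieldOn_slice (P₀ := P) hF hv (z := z₀) (ξ := X) fun e he => by
    refine hX e ?_
    have := he.1
    rw [target_eq] at this
    exact this.1
  have hmem : (e₀, z₀) ∈ (extChartAt (phaseI m q) P).target ∩
      (extChartAt (phaseI m q) P).symm ⁻¹' F := by
    refine ⟨fibre_mem_target x z₀ z₀, ?_⟩
    rw [mem_preimage]
    rw [chart_symm_fibre x z₀ z₀]
    exact hP
  have hS := isOpen_slice P hF z₀
  have hxS : x ∈ (extChartAt (𝓡 (m + 2)) x).source ∩ extChartAt (𝓡 (m + 2)) x ⁻¹'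
      {e | (e, z₀) ∈ (extChartAt (phaseI m q) P).target ∩
        (extChartAt (phaseI m q) P).symm ⁻¹' F} := ⟨mem_extChartAt_source x, hmem⟩
  -- The bump function is supported where X is smooth, so χ X is smooth on all of `M`, and it equals
  -- X near x.
  obtain ⟨χ, hχ, -⟩ := (SmoothBumpFunction.nhds_basis_support (I := 𝓡 (m + 2))
    (hS.mem_nhds hxS)).mem_iff.1 Filter.univ_mem
  let ξ : (x : M) → TangentSpace (𝓡 (m + 2)) x := fun y => χ y • X y
  have hξ : SmoothFieldOn ξ univ := by
    have := ContMDiffOn.smul_section_of_tsupport (n := ∞) (V := TangentSpace (𝓡 (m + 2)))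
      (s := X) (ψ := χ) χ.contMDiff.contMDiffOn hS hχ hXs
    exact this.contMDiffOn
  have hone : ∀ᶠ u in 𝓝 ((e₀, z₀) : EuclideanSpace ℝ (Fin (m + 2)) × PhaseModel m q),
      χ ((extChartAt (𝓡 (m + 2)) x).symm u.1) = 1 := by
    have hc : ContinuousAt (fun u : EuclideanSpace ℝ (Fin (m + 2)) × PhaseModel m q =>
        (extChartAt (𝓡 (m + 2)) x).symm u.1) (e₀, z₀) :=
      ContinuousAt.comp (f := Prod.fst) (x := ((e₀, z₀) :
        EuclideanSpace ℝ (Fin (m + 2)) × PhaseModel m q)) (continuousAt_extChartAt_symm x)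
        continuous_fst.continuousAt
    have h1 : (extChartAt (𝓡 (m + 2)) x).symm ((e₀, z₀) :
        EuclideanSpace ℝ (Fin (m + 2)) × PhaseModel m q).1 = x := extChartAt_to_inv x
    have h2 := χ.eventuallyEq_one
    exact hc.eventually (h1.symm ▸ h2 : ∀ᶠ y in 𝓝 ((extChartAt (𝓡 (m + 2)) x).symm ((e₀, z₀) :
      EuclideanSpace ℝ (Fin (m + 2)) × PhaseModel m q).1), χ y = 1)
  -- Balls of the product norm are products of balls, so one radius works for base and fibre.
  obtain ⟨r, hr, hball⟩ := Metric.mem_nhds_iff.1 (Filter.inter_mem hone (hO.mem_nhds hmem))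
  refine ⟨ξ, hξ, r, hr, fun u hu => ?_⟩
  have hsub : ∀ u ∈ Metric.ball e₀ r ×ˢ Metric.ball z₀ r,
      χ ((extChartAt (𝓡 (m + 2)) x).symm u.1) = 1 ∧ u ∈ (extChartAt (phaseI m q) P).target ∩
        (extChartAt (phaseI m q) P).symm ⁻¹' F := fun u hu => by
    refine hball ?_
    rw [← ball_prod_same]
    exact hu
  refine ⟨(hsub u hu).2.1, (hsub u hu).2.2, ?_⟩
  -- The fibre direction of the box is a ball, hence connected, and the vertical derivative of the
  -- base component vanishes on it.
  have hc : (fieldRep v P u).1 = (fieldRep v P (u.1, z₀)).1 := by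
    have hd : ∀ y ∈ Metric.ball z₀ r, HasFDerivAt (fun y => (fieldRep v P (u.1, y)).1)
        (0 : PhaseModel m q →L[ℝ] _) y := fun y hy => by
      have h1 := (hsub (u.1, y) ⟨hu.1, hy⟩).2
      exact hasFDerivAt_fst_partial (((contDiffOn_fieldRep hF hv P).contDiffAt
        (hO.mem_nhds h1)).differentiableAt (by simp)) fun b =>
        fderiv_fieldRep_vertical hfields hF hf hv h h1.1 h1.2 b
    obtain ⟨a, ha⟩ := Metric.isOpen_ball.exists_is_const_of_fderiv_eq_zero (𝕜 := ℝ)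
      (convex_ball z₀ r).isPreconnected
      (fun y hy => (hd y hy).differentiableAt.differentiableWithinAt) (fun y hy => (hd y hy).fderiv)
    exact (ha u.2 hu.2).trans (ha z₀ (Metric.mem_ball_self hr)).symm
  have hu1 : u.1 ∈ (extChartAt (𝓡 (m + 2)) x).target := by
    have := (hsub u hu).2.1
    rw [target_eq] at this
    exact this.1
  have hp := proj_symm P (hsub u hu).2.1
  have key : ∀ y, y = (extChartAt (𝓡 (m + 2)) x).symm u.1 → (ξ y : EuclideanSpace ℝ (Fin (m + 2))) =
      X ((extChartAt (𝓡 (m + 2)) x).symm u.1) := by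
    rintro y rfl
    change χ _ • X _ = X _
    rw [(hsub u hu).1, one_smul]
  have e1 := baseField_symm (v := v) (hsub u hu).2.1
  rw [hc, ← hX u.1 hu1] at e1
  exact e1.trans ((mfderiv_symm_fieldRep X hu1).trans (key _ hp).symm)

end BaseField


/-! ### The vertical filtration on the total space and primitives in one chart. -/

section Primitive

variable {n : ℕ} {κ : Type*} [Fintype κ] {d : κ → ℕ} {M : Type*} [TopologicalSpace M]
  [ChartedSpace (EuclideanSpace ℝ (Fin n)) M] [IsManifold (𝓡 n) ∞ M]

/-- The filtration by the number of vertical arguments, for forms on the total space. -/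
def VertFiltAt (p : ℕ) {k : ℕ} (η : DForm (bundleModel n d) (FormBundle n d M) k)
    (P : FormBundle n d M) : Prop :=
  VertFilt (E := EuclideanSpace ℝ (Fin n)) (G := FormModel n d) p (η P)

theorem VertFiltAt.localRep {p k : ℕ} {η : DForm (bundleModel n d) (FormBundle n d M) k}
    {P₀ : FormBundle n d M} {u : EuclideanSpace ℝ (Fin n) × FormModel n d}
    (hu : u ∈ (extChartAt (bundleModel n d) P₀).target)
    (h : VertFiltAt p η ((extChartAt (bundleModel n d) P₀).symm u)) :
    VertFilt p (localRep η P₀ u) := by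
  let L : EuclideanSpace ℝ (Fin n) × FormModel n d →L[ℝ] EuclideanSpace ℝ (Fin n) × FormModel n d :=
    mfderiv 𝓘(ℝ, EuclideanSpace ℝ (Fin n) × FormModel n d) (bundleModel n d)
      (extChartAt (bundleModel n d) P₀).symm u
  refine VertFilt.comp (L := L) (fun b => ?_) h
  have h1 := mfderiv_proj ((extChartAt (bundleModel n d) P₀).symm u) (L (0, b))
  have h2 := mfderiv_proj_symm P₀ hu (0, b)
  rw [← h1]
  refine h2.trans ?_
  exact map_zero _

/-- Transition maps of the bundle cover transition maps of `M` and so preserve vertical vectors; one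
chart decides the filtration step. -/
theorem vertFiltAt_of_localRep {p k : ℕ} {η : DForm (bundleModel n d) (FormBundle n d M) k}
    {P₀ P : FormBundle n d M} (hP : P ∈ (extChartAt (bundleModel n d) P₀).source)
    (h : VertFilt p (localRep η P₀ (extChartAt (bundleModel n d) P₀ P))) : VertFiltAt p η P := by
  have hu := mem_extChartAt_target (I := bundleModel n d) P
  have hP' : (extChartAt (bundleModel n d) P).symm (extChartAt (bundleModel n d) P P) ∈
      (extChartAt (bundleModel n d) P₀).source := by
    rw [extChartAt_to_inv]
    exact hP
  have hT : transition (bundleModel n d) P P₀ (extChartAt (bundleModel n d) P P) =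
      extChartAt (bundleModel n d) P₀ P := by
    rw [transition, extChartAt_to_inv]
  have h1 := localRep_transition η hu hP'
  rw [hT, localRep_self] at h1
  refine Eq.subst (motive := fun α : (EuclideanSpace ℝ (Fin n) × FormModel n d) [⋀^Fin k]→L[ℝ] ℝ =>
    VertFilt p α) h1.symm (VertFilt.comp (fun b => ?_) h)
  have hd := ((contDiffAt_transition hu hP').differentiableAt (by simp)).hasFDerivAt
  have h2 := hd.fst
  have h3 : (fun u => (transition (bundleModel n d) P P₀ u).1) =ᶠ[𝓝 (extChartAt (bundleModel n d) P P)]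
      transition (𝓡 n) P.proj P₀.proj ∘ Prod.fst := by
    filter_upwards [(isOpen_extChartAt_target P).mem_nhds hu] with y hy
    rw [transition, chart_fst, proj_symm P hy]
    rfl
  have h4 : DifferentiableAt ℝ (transition (𝓡 n) P.proj P₀.proj) (extChartAt (bundleModel n d) P P).1 := by
    rw [chart_fst]
    refine (contDiffAt_transition (mem_extChartAt_target P.proj) ?_).differentiableAt (by simp)
    rw [extChartAt_to_inv]
    exact mem_source_iff.1 hP
  have h5 := (h4.hasFDerivAt.comp _ hasFDerivAt_fst).congr_of_eventuallyEq h3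
  refine (DFunLike.congr_fun (h2.unique h5) (0, b)).trans ?_
  exact (fderiv ℝ (transition (𝓡 n) P.proj P₀.proj) (extChartAt (bundleModel n d) P P).1).map_zero

/-- The form on the total space with a given coordinate expression in one chart. -/
def ofChart (P₀ : FormBundle n d M) {k : ℕ} (α : EuclideanSpace ℝ (Fin n) × FormModel n d →
    (EuclideanSpace ℝ (Fin n) × FormModel n d) [⋀^Fin k]→L[ℝ] ℝ) :
    DForm (bundleModel n d) (FormBundle n d M) k := fun P =>
  (α (extChartAt (bundleModel n d) P₀ P)).compContinuousLinearMap
    (mfderiv (bundleModel n d) 𝓘(ℝ, EuclideanSpace ℝ (Fin n) × FormModel n d)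
      (extChartAt (bundleModel n d) P₀) P)

theorem localRep_ofChart (P₀ : FormBundle n d M) {k : ℕ}
    (α : EuclideanSpace ℝ (Fin n) × FormModel n d →
      (EuclideanSpace ℝ (Fin n) × FormModel n d) [⋀^Fin k]→L[ℝ] ℝ)
    {u : EuclideanSpace ℝ (Fin n) × FormModel n d}
    (hu : u ∈ (extChartAt (bundleModel n d) P₀).target) :
    localRep (ofChart P₀ α) P₀ u = α u := by
  have h : ∀ w, _ := fun w => mfderiv_extChartAt_comp_symm P₀ hu w
  have hr := (extChartAt (bundleModel n d) P₀).right_inv hu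
  ext w
  refine Eq.trans ?_ (DFunLike.congr_fun (congrArg α hr) w)
  exact congrArg (α (extChartAt (bundleModel n d) P₀ ((extChartAt (bundleModel n d) P₀).symm u)))
    (funext fun i => h (w i))

/-- The relative Poincaré lemma on an open subset of a chart domain. -/
theorem exists_primitive_of_chart {P₀ : FormBundle n d M} {U : Set (FormBundle n d M)}
    (hU : IsOpen U) (hUs : U ⊆ (extChartAt (bundleModel n d) P₀).source)
    {H : ℝ × (EuclideanSpace ℝ (Fin n) × FormModel n d) → EuclideanSpace ℝ (Fin n) × FormModel n d}
    (hH : IsFibreContraction ((extChartAt (bundleModel n d) P₀).target ∩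
      (extChartAt (bundleModel n d) P₀).symm ⁻¹' U) H)
    {k p : ℕ} {η : DForm (bundleModel n d) (FormBundle n d M) (k + 1)} (hη : SmoothFormOn η U)
    (hd : ∀ P ∈ U, VertFiltAt 2 (extD η) P) (hp : ∀ P ∈ U, VertFiltAt (p + 1) η P) :
    ∃ α : DForm (bundleModel n d) (FormBundle n d M) k, SmoothFormOn α U ∧
      ∀ P ∈ U, VertFiltAt p α P ∧ VertFiltAt 1 (fun P => η P - extD α P) P := by
  have hO := isOpen_overlap (I := bundleModel n d) P₀ hU
  obtain ⟨α, hα, hα'⟩ := hH.exists_primitive (p := p) (hη P₀)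
    (fun u hu => by
      rw [← localRep_extD hU hη hu.1 hu.2]
      exact (hd _ hu.2).localRep hu.1)
    (fun u hu => (hp _ hu.2).localRep hu.1)
  have hmem : ∀ P ∈ U, extChartAt (bundleModel n d) P₀ P ∈ (extChartAt (bundleModel n d) P₀).target ∩
      (extChartAt (bundleModel n d) P₀).symm ⁻¹' U := fun P hP =>
    ⟨(extChartAt (bundleModel n d) P₀).map_source (hUs hP), by
      rw [mem_preimage, (extChartAt (bundleModel n d) P₀).left_inv (hUs hP)]
      exact hP⟩
  have hev : ∀ u ∈ (extChartAt (bundleModel n d) P₀).target, localRep (ofChart P₀ α) P₀ =ᶠ[𝓝 u] α :=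
    fun u hu => by
      filter_upwards [(isOpen_extChartAt_target P₀).mem_nhds hu] with y hy using
        localRep_ofChart P₀ α hy
  have hs : SmoothFormOn (ofChart P₀ α) U := smoothFormOn_of_contDiffAt fun P hP =>
    ⟨P₀, hUs hP, (hα.contDiffAt (hO.mem_nhds (hmem P hP))).congr_of_eventuallyEq
      (hev _ (hmem P hP).1)⟩
  refine ⟨ofChart P₀ α, hs, fun P hP => ?_⟩
  obtain ⟨h1, h2⟩ := hα' _ (hmem P hP)
  refine ⟨vertFiltAt_of_localRep (hUs hP) ?_, vertFiltAt_of_localRep (hUs hP) ?_⟩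
  · rwa [localRep_ofChart P₀ α (hmem P hP).1]
  · have e : localRep (fun P => η P - extD (ofChart P₀ α) P) P₀ (extChartAt (bundleModel n d) P₀ P) =
        localRep η P₀ (extChartAt (bundleModel n d) P₀ P) -
          extDeriv α (extChartAt (bundleModel n d) P₀ P) := by
      rw [← (hev _ (hmem P hP).1).extDeriv_eq, ← localRep_extD hU hs (hmem P hP).1 (hmem P hP).2]
      rfl
    rw [e]
    exact h2

end Primitive


/-! ### Gluing primitives with a partition of unity on the base. -/

section LocalGluing

variable {E G : Type*} [NormedAddCommGroup E] [NormedSpace ℝ E] [NormedAddCommGroup G]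
  [NormedSpace ℝ G]

theorem extDeriv_smul_base {k : ℕ} {g : E → ℝ} {a : E × G → (E × G) [⋀^Fin k]→L[ℝ] ℝ} {u : E × G}
    (hg : DifferentiableAt ℝ g u.1) (ha : DifferentiableAt ℝ a u) :
    extDeriv (fun u => g u.1 • a u) u = g u.1 • extDeriv a u +
      covWedge ((fderiv ℝ g u.1).comp (ContinuousLinearMap.fst ℝ E G)) (a u) := by
  have h1 : HasFDerivAt (fun u : E × G => g u.1)
      ((fderiv ℝ g u.1).comp (ContinuousLinearMap.fst ℝ E G)) u :=
    hg.hasFDerivAt.comp u hasFDerivAt_fst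
  rw [covWedge_apply, extDeriv, extDeriv, (h1.fun_smul ha.hasFDerivAt).fderiv,
    ← ContinuousAlternatingMap.alternatizeUncurryFinCLM_apply,
    ← ContinuousAlternatingMap.alternatizeUncurryFinCLM_apply,
    ← ContinuousAlternatingMap.alternatizeUncurryFinCLM_apply, map_add, map_smul]

/-- As Σ g_i = 1, the error is Σ g_i (β − da_i) − Σ dg_i ∧ a_i. The functions g_i come from the
base, so dg_i is horizontal and the last term has no more vertical arguments than a_i. -/
theorem vertFilt_sub_extDeriv_sum {κ : Type*} (s : Finset κ) {k p : ℕ} {g : κ → E → ℝ}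
    {a : κ → E × G → (E × G) [⋀^Fin k]→L[ℝ] ℝ} {u : E × G}
    {β : (E × G) [⋀^Fin (k + 1)]→L[ℝ] ℝ} (hg : ∀ i ∈ s, DifferentiableAt ℝ (g i) u.1)
    (ha : ∀ i ∈ s, DifferentiableAt ℝ (a i) u) (h1 : ∑ i ∈ s, g i u.1 = 1)
    (hp : ∀ i ∈ s, VertFilt p (a i u)) (hβ : ∀ i ∈ s, VertFilt p (β - extDeriv (a i) u)) :
    VertFilt p (β - extDeriv (fun u => ∑ i ∈ s, g i u.1 • a i u) u) := by
  have hsum : ∀ (t : Finset κ) (b : κ → (E × G) [⋀^Fin (k + 1)]→L[ℝ] ℝ),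
      (∀ i ∈ t, VertFilt p (b i)) → VertFilt p (∑ i ∈ t, b i) := fun t b hb =>
    Finset.sum_induction b (VertFilt p) (fun _ _ => VertFilt.add) (VertFilt.zero _ _) hb
  have e : β - extDeriv (fun u => ∑ i ∈ s, g i u.1 • a i u) u =
      ∑ i ∈ s, (g i u.1 • (β - extDeriv (a i) u) + (-1 : ℝ) •
        covWedge ((fderiv ℝ (g i) u.1).comp (ContinuousLinearMap.fst ℝ E G)) (a i u)) := by
    rw [extDeriv_sum (η := fun i u => g i u.1 • a i u) s fun i hi => ((hg i hi).comp u differentiableAt_fst).fun_smul (ha i hi),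
      Finset.sum_congr rfl fun i hi => extDeriv_smul_base (hg i hi) (ha i hi)]
    simp only [smul_sub, Finset.sum_add_distrib, Finset.sum_sub_distrib, ← Finset.sum_smul, h1,
      one_smul, ← Finset.smul_sum]
    rw [neg_one_smul' (∑ i ∈ s, _), sub_add_eq_sub_sub, sub_eq_add_neg _ (∑ i ∈ s, _)]
  rw [e]
  refine hsum s _ fun i hi => VertFilt.add (VertFilt.smul _ (hβ i hi)) (VertFilt.smul _
    (VertFilt.covWedge (fun b => ?_) (hp i hi)))
  exact (fderiv ℝ (g i) u.1).map_zero

theorem contDiffAt_sum_smul_base {κ : Type*} (s : Finset κ) {k : ℕ} {g : κ → E → ℝ}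
    {a : κ → E × G → (E × G) [⋀^Fin k]→L[ℝ] ℝ} {u : E × G}
    (hg : ∀ i ∈ s, ContDiffAt ℝ ∞ (g i) u.1) (ha : ∀ i ∈ s, ContDiffAt ℝ ∞ (a i) u) :
    ContDiffAt ℝ ∞ (fun u => ∑ i ∈ s, g i u.1 • a i u) u :=
  ContDiffAt.sum fun i hi => ((hg i hi).comp u contDiffAt_fst).smul (ha i hi)

end LocalGluing

section Gluing

variable {n : ℕ} {κ : Type*} [Fintype κ] {d : κ → ℕ} {M : Type*} [TopologicalSpace M]
  [ChartedSpace (EuclideanSpace ℝ (Fin n)) M] [IsManifold (𝓡 n) ∞ M]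

/-- Local primitives up to horizontal forms are glued to a form which is a primitive up to forms
with one vertical argument less. -/
theorem exists_primitive_step [T2Space M] [SigmaCompactSpace M] {F : Set (FormBundle n d M)}
    (hF : IsOpen F) {k p : ℕ} {η : DForm (bundleModel n d) (FormBundle n d M) (k + 1)}
    (hloc : ∀ x₀ : M, ∃ W : Set M, IsOpen W ∧ x₀ ∈ W ∧
      ∃ α : DForm (bundleModel n d) (FormBundle n d M) k, SmoothFormOn α (F ∩ proj ⁻¹' W) ∧
        ∀ P ∈ F ∩ proj ⁻¹' W, VertFiltAt (p + 1) α P ∧ VertFiltAt 1 (fun P => η P - extD α P) P) :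
    ∃ α : DForm (bundleModel n d) (FormBundle n d M) k, SmoothFormOn α F ∧
      ∀ P ∈ F, VertFiltAt (p + 1) (fun P => η P - extD α P) P := by
  choose W hWo hW a ha ha' using hloc
  obtain ⟨ρ, hρ⟩ := SmoothPartitionOfUnity.exists_isSubordinate (𝓡 n) isClosed_univ W hWo
    (fun x _ => mem_iUnion.2 ⟨x, hW x⟩)
  let α : DForm (bundleModel n d) (FormBundle n d M) k := fun P =>
    ∑ i ∈ ρ.finsupport P.proj, ρ i P.proj • a i P
  let g : M → M → EuclideanSpace ℝ (Fin n) → ℝ := fun x i e => ρ i ((extChartAt (𝓡 n) x).symm e)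
  have hWp : ∀ i, IsOpen (F ∩ proj ⁻¹' W i) := fun i =>
    hF.inter ((hWo i).preimage contMDiff_proj.continuous)
  -- By local finiteness the sum defining α can be taken near P over a fixed finite index set, which
  -- makes it differentiable term by term.
  have hev : ∀ P : FormBundle n d M, localRep α P =ᶠ[𝓝 (extChartAt (bundleModel n d) P P)] fun u =>
      ∑ i ∈ ρ.fintsupport P.proj, g P.proj i u.1 • localRep (a i) P u := by
    intro P
    have hc : ContinuousAt (fun u => ((extChartAt (bundleModel n d) P).symm u).proj)
        (extChartAt (bundleModel n d) P P) :=
      contMDiff_proj.continuous.continuousAt.comp (continuousAt_extChartAt_symm P)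
    have h1 := ρ.eventually_finsupport_subset P.proj
    have h2 : ((extChartAt (bundleModel n d) P).symm (extChartAt (bundleModel n d) P P)).proj =
        P.proj := by
      rw [extChartAt_to_inv]
    rw [← h2] at h1
    filter_upwards [hc.eventually h1, (isOpen_extChartAt_target P).mem_nhds
      (mem_extChartAt_target P)] with u hu hut
    rw [h2] at hu
    have e1 : α ((extChartAt (bundleModel n d) P).symm u) = ∑ i ∈ ρ.fintsupport P.proj,
        ρ i ((extChartAt (bundleModel n d) P).symm u).proj •
          a i ((extChartAt (bundleModel n d) P).symm u) := by
      refine Finset.sum_subset hu fun i _ hi => ?_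
      have : ρ i ((extChartAt (bundleModel n d) P).symm u).proj = 0 := by
        simpa [ρ.mem_finsupport] using hi
      rw [this, zero_smul]
    refine (localRep_congr (η' := fun P' => ∑ i ∈ ρ.fintsupport P.proj, ρ i P'.proj • a i P')
      e1).trans ?_
    rw [localRep_sum]
    refine Finset.sum_congr rfl fun i _ => ?_
    rw [localRep_smul (fun P' : FormBundle n d M => ρ i P'.proj), proj_symm P hut]
  have hWi : ∀ P ∈ F, ∀ i ∈ ρ.fintsupport P.proj, P ∈ F ∩ proj ⁻¹' W i := fun P hP i hi =>
    ⟨hP, hρ i ((ρ.mem_fintsupport_iff P.proj i).1 hi)⟩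
  have hai : ∀ P ∈ F, ∀ i ∈ ρ.fintsupport P.proj,
      ContDiffAt ℝ ∞ (localRep (a i) P) (extChartAt (bundleModel n d) P P) := fun P hP i hi =>
    (ha i).contDiffAt (hWp i) (mem_extChartAt_target P) (by
      rw [extChartAt_to_inv]
      exact hWi P hP i hi)
  have hgi : ∀ (P : FormBundle n d M) (i : M),
      ContDiffAt ℝ ∞ (g P.proj i) (extChartAt (bundleModel n d) P P).1 := fun P i => by
    rw [chart_fst]
    exact ((ρ i).contMDiff.contMDiffAt.comp _
      (contMDiffAt_extChartAt_symm P.proj (mem_extChartAt_target P.proj))).contDiffAt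
  have hs : SmoothFormOn α F := smoothFormOn_of_contDiffAt fun P hP => by
    refine ⟨P, mem_extChartAt_source P, ContDiffAt.congr_of_eventuallyEq ?_ (hev P)⟩
    exact contDiffAt_sum_smul_base _ (fun i _ => hgi P i) (hai P hP)
  refine ⟨α, hs, fun P hP => vertFiltAt_of_localRep (mem_extChartAt_source P) ?_⟩
  have hu := mem_extChartAt_target (I := bundleModel n d) P
  have hext : ∀ {U : Set (FormBundle n d M)} (_ : IsOpen U) (_ : P ∈ U)
      {σ : DForm (bundleModel n d) (FormBundle n d M) k} (_ : SmoothFormOn σ U),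
      localRep (fun P => η P - extD σ P) P (extChartAt (bundleModel n d) P P) =
        localRep η P (extChartAt (bundleModel n d) P P) -
          extDeriv (localRep σ P) (extChartAt (bundleModel n d) P P) := by
    intro U hU hPU σ hσ
    rw [← localRep_extD hU hσ hu (by rw [extChartAt_to_inv]; exact hPU)]
    rfl
  rw [hext hF hP hs, (hev P).extDeriv_eq]
  refine vertFilt_sub_extDeriv_sum _ (fun i hi => (hgi P i).differentiableAt (by simp))
    (fun i hi => (hai P hP i hi).differentiableAt (by simp)) ?_ (fun i hi => ?_) (fun i hi => ?_)
  · have e := ρ.sum_finsupport' P.proj (mem_univ P.proj) (ρ.finsupport_subset_fintsupport P.proj)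
    rw [← e]
    refine Finset.sum_congr rfl fun i _ => ?_
    change ρ i ((extChartAt (𝓡 n) P.proj).symm (extChartAt (bundleModel n d) P P).1) = _
    rw [chart_fst, extChartAt_to_inv]
  · rw [localRep_self]
    exact (ha' i P (hWi P hP i hi)).1
  · rw [← hext (hWp i) (hWi P hP i hi) (ha i), localRep_self]
    -- The local errors are even horizontal; only the terms dρ_i ∧ α_i require step p + 1.
    exact VertFilt.mono (Nat.le_add_left 1 p) (ha' i P (hWi P hP i hi)).2

end Gluing


/-! ### Linearity of the exterior derivative on the manifold, and d² = 0. -/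

section ExtD

variable {E : Type*} [NormedAddCommGroup E] [NormedSpace ℝ E] {H : Type*} [TopologicalSpace H]
  {I : ModelWithCorners ℝ E H} {N : Type*} [TopologicalSpace N] [ChartedSpace H N]
  [I.Boundaryless] [IsManifold I ∞ N] {U : Set N}

theorem extD_eq_extDeriv {k : ℕ} {η : DForm I N k} (hU : IsOpen U) (hη : SmoothFormOn η U) {P : N}
    (hP : P ∈ U) : extD η P = extDeriv (localRep η P) (extChartAt I P P) := by
  have h := localRep_extD hU hη (mem_extChartAt_target P) (by rwa [extChartAt_to_inv])
  rw [← h, localRep_self]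

omit [IsManifold I ∞ N] in
theorem SmoothFormOn.differentiableAt {k : ℕ} {η : DForm I N k} (hU : IsOpen U)
    (hη : SmoothFormOn η U) {P : N} (hP : P ∈ U) :
    DifferentiableAt ℝ (localRep η P) (extChartAt I P P) :=
  (hη.contDiffAt hU (mem_extChartAt_target P) (by rwa [extChartAt_to_inv])).differentiableAt (by simp)

omit [I.Boundaryless] [IsManifold I ∞ N] in
theorem SmoothFormOn.add {k : ℕ} {η η' : DForm I N k} (hη : SmoothFormOn η U)
    (hη' : SmoothFormOn η' U) : SmoothFormOn (fun P => η P + η' P) U := fun P₀ =>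
  ContDiffOn.add (hη P₀) (hη' P₀)

omit [I.Boundaryless] [IsManifold I ∞ N] in
theorem SmoothFormOn.sub {k : ℕ} {η η' : DForm I N k} (hη : SmoothFormOn η U)
    (hη' : SmoothFormOn η' U) : SmoothFormOn (fun P => η P - η' P) U := fun P₀ =>
  ContDiffOn.sub (hη P₀) (hη' P₀)

theorem extD_add {k : ℕ} {η η' : DForm I N k} (hU : IsOpen U) (hη : SmoothFormOn η U)
    (hη' : SmoothFormOn η' U) {P : N} (hP : P ∈ U) :
    extD (fun P => η P + η' P) P = extD η P + extD η' P := by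
  have h := extDeriv_fun_add (hη.differentiableAt hU hP) (hη'.differentiableAt hU hP)
  rw [extD_eq_extDeriv hU (hη.add hη') hP, extD_eq_extDeriv hU hη hP, extD_eq_extDeriv hU hη' hP]
  exact h

theorem extD_sub_extD {k : ℕ} {η : DForm I N (k + 1)} {α : DForm I N k} (hU : IsOpen U)
    (hη : SmoothFormOn η U) (hα : SmoothFormOn α U) {P : N} (hP : P ∈ U) :
    extD (fun P => η P - extD α P) P = extD η P := by
  have hα' := hα.extD hU
  have h := extDeriv_fun_sub (hη.differentiableAt hU hP) (hα'.differentiableAt hU hP)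
  have hut := mem_extChartAt_target (I := I) P
  have huU : (extChartAt I P).symm (extChartAt I P P) ∈ U := by rwa [extChartAt_to_inv]
  have e : localRep (extD α) P =ᶠ[𝓝 (extChartAt I P P)] extDeriv (localRep α P) := by
    filter_upwards [(isOpen_overlap P hU).mem_nhds ⟨hut, huU⟩] with y hy using
      localRep_extD hU hα hy.1 hy.2
  rw [extD_eq_extDeriv hU (hη.sub hα') hP, extD_eq_extDeriv hU hη hP]
  refine h.trans ?_
  rw [e.extDeriv_eq, extDeriv_extDeriv_apply (hα.contDiffAt hU hut huU) minSmoothness_infty, sub_zero]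

end ExtD

/-! ### The relative Poincaré lemma over all of `M`. -/

section Primitive

variable {n : ℕ} {κ : Type*} [Fintype κ] {d : κ → ℕ} {M : Type*} [TopologicalSpace M]
  [ChartedSpace (EuclideanSpace ℝ (Fin n)) M] [IsManifold (𝓡 n) ∞ M]

/-- The relative Poincaré lemma for a bundle with smoothly contractible fibres. -/
theorem exists_primitive_of_contraction [T2Space M] [SigmaCompactSpace M]
    {F : Set (FormBundle n d M)} (hF : IsOpen F)
    (hH : ∀ x₀ : M, ∃ W : Set M, IsOpen W ∧ x₀ ∈ W ∧ ∃ P₀ : FormBundle n d M,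
      W ⊆ (extChartAt (𝓡 n) P₀.proj).source ∧
      ∃ H, IsFibreContraction ((extChartAt (bundleModel n d) P₀).target ∩
        (extChartAt (bundleModel n d) P₀).symm ⁻¹' (F ∩ proj ⁻¹' W)) H) {k : ℕ} :
    ∀ (p : ℕ) {η : DForm (bundleModel n d) (FormBundle n d M) (k + 1)} (_ : SmoothFormOn η F)
      (_ : ∀ P ∈ F, VertFiltAt 2 (extD η) P) (_ : ∀ P ∈ F, VertFiltAt (p + 2) η P),
    ∃ α : DForm (bundleModel n d) (FormBundle n d M) k, SmoothFormOn α F ∧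
      ∀ P ∈ F, VertFiltAt 1 (fun P => η P - extD α P) P := by
  have step : ∀ (p : ℕ) {η : DForm (bundleModel n d) (FormBundle n d M) (k + 1)}
      (_ : SmoothFormOn η F) (_ : ∀ P ∈ F, VertFiltAt 2 (extD η) P)
      (_ : ∀ P ∈ F, VertFiltAt (p + 2) η P),
      ∃ α : DForm (bundleModel n d) (FormBundle n d M) k, SmoothFormOn α F ∧
        ∀ P ∈ F, VertFiltAt (p + 1) (fun P => η P - extD α P) P := by
    intro p η hη hd hp
    refine exists_primitive_step hF fun x₀ => ?_
    obtain ⟨W, hWo, hW, P₀, hWs, H, hHc⟩ := hH x₀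
    refine ⟨W, hWo, hW, exists_primitive_of_chart
      (hF.inter (hWo.preimage contMDiff_proj.continuous))
      (fun P hP => mem_source_iff.2 (hWs hP.2)) hHc (hη.mono inter_subset_left)
      (fun P hP => hd P hP.1) fun P hP => hp P hP.1⟩
  intro p
  induction p with
  | zero => exact fun hη hd hp => step 0 hη hd hp
  | succ p ih =>
    intro η hη hd hp
    obtain ⟨α, hα, h1⟩ := step (p + 1) hη hd hp
    -- η − dα has the same exterior derivative as η, so the hypothesis on dη persists while the
    -- filtration index has dropped by one.
    obtain ⟨α', hα', h2⟩ := ih (hη.sub (hα.extD hF)) (fun P hP => by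
      have := hd P hP
      rw [VertFiltAt] at this ⊢
      rwa [extD_sub_extD hF hη hα hP]) h1
    refine ⟨_, hα.add hα', fun P hP => ?_⟩
    have := h2 P hP
    rw [VertFiltAt] at this ⊢
    rwa [extD_add hF hα hα' hP, ← sub_sub]

end Primitive


/-! ### Smoothing a contraction of the typical fibre. -/

/-- A contractible open subset of a finite-dimensional vector space is smoothly contractible. -/
theorem exists_contDiffOn_contraction {V : Type*} [NormedAddCommGroup V] [NormedSpace ℝ V]
    [FiniteDimensional ℝ V] {S : Set V} (hS : IsOpen S) [ContractibleSpace S] :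
    ∃ (c : ℝ × V → V) (s₀ : V), s₀ ∈ S ∧ ContDiffOn ℝ ∞ c (univ ×ˢ S) ∧
      (∀ t, ∀ s ∈ S, c (t, s) ∈ S) ∧ (∀ s ∈ S, c (1, s) = s) ∧ ∀ s ∈ S, c (0, s) = s₀ := by
  obtain ⟨s₀, ⟨h⟩⟩ := id_nullhomotopic S
  let O : TopologicalSpace.Opens (ℝ × V) := ⟨univ ×ˢ S, isOpen_univ.prod hS⟩
  -- The clipped time is 1 for t ≤ 1/4 and 0 for t ≥ 3/4. The null-homotopy is thus run backwards,
  -- defined for all real t, and stationary near both ends.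
  let σ : ℝ → unitInterval := fun t => projIcc 0 1 zero_le_one (3 / 2 - 2 * t)
  have hσ : Continuous σ := continuous_projIcc.comp (by fun_prop)
  let pt : O → S := fun x => ⟨x.1.2, x.2.2⟩
  have hpt : Continuous pt := by fun_prop
  let f : O → V := fun x => (h (σ x.1.1, pt x) : V)
  have hf : Continuous f := continuous_subtype_val.comp
    (h.continuous.comp ((hσ.comp (continuous_fst.comp continuous_subtype_val)).prodMk hpt))
  have hfS : ∀ x, f x ∈ S := fun x => (h (σ x.1.1, pt x)).2
  have hf1 : ∀ x : O, 3 / 4 < x.1.1 → f x = x.1.2 := by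
    intro x hx
    have : σ x.1.1 = 0 := projIcc_of_le_left _ (by linarith)
    simp only [f, this, h.apply_zero]
    rfl
  have hf0 : ∀ x : O, x.1.1 < 1 / 4 → f x = s₀ := by
    intro x hx
    have : σ x.1.1 = 1 := projIcc_of_right_le _ (by linarith)
    simp only [f, this, h.apply_one]
    rfl
  -- ε is the distance to the complement of S, or 1 if S is the whole space; an approximation closer
  -- than ε stays in S.
  obtain ⟨ε, hε, hεpos, hεS⟩ : ∃ ε : V → ℝ, Continuous ε ∧ (∀ s ∈ S, 0 < ε s) ∧
      ∀ s ∈ S, ∀ y, dist y s < ε s → y ∈ S := by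
    by_cases hne : (Sᶜ).Nonempty
    · refine ⟨fun s => Metric.infDist s Sᶜ, Metric.continuous_infDist_pt _, fun s hs => ?_,
        fun s hs y hy => ?_⟩
      · refine (hS.isClosed_compl.notMem_iff_infDist_pos hne).1 ?_
        simpa using hs
      · by_contra hyS
        exact absurd (Metric.infDist_le_dist_of_mem (x := s) (show y ∈ Sᶜ from hyS))
          (by rw [dist_comm]; linarith)
    · rw [not_nonempty_iff_eq_empty, compl_empty_iff] at hne
      subst hne
      exact ⟨fun _ => 1, continuous_const, fun _ _ => one_pos, fun _ _ y _ => mem_univ y⟩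
  have hc1 : Continuous fun x : O => x.1.1 := by fun_prop
  have hU : ({x : O | x.1.1 < 1 / 4} ∪ {x : O | 3 / 4 < x.1.1}) ∈
      𝓝ˢ ({x : O | x.1.1 ≤ 0} ∪ {x : O | 1 ≤ x.1.1}) := by
    refine IsOpen.mem_nhdsSet ((isOpen_lt hc1 continuous_const).union
      (isOpen_lt continuous_const hc1)) |>.2 ?_
    rintro x (hx | hx)
    · exact Or.inl (lt_of_le_of_lt (b := (0 : ℝ)) hx (by norm_num))
    · exact Or.inr (lt_of_lt_of_le (b := (1 : ℝ)) (by norm_num) hx)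
  have : LocallyCompactSpace O := O.isOpen.isOpenEmbedding_subtypeVal.locallyCompactSpace
  have hsm : ContMDiffOn 𝓘(ℝ, ℝ × V) 𝓘(ℝ, V) ∞ f
      ({x : O | x.1.1 < 1 / 4} ∪ {x : O | 3 / 4 < x.1.1}) := by
    rintro x (hx | hx)
    · refine (contMDiffAt_const (c := (s₀ : V))).congr_of_eventuallyEq ?_ |>.contMDiffWithinAt
      filter_upwards [(isOpen_lt hc1 continuous_const).mem_nhds hx] with y hy using hf0 y hy
    · have h1 : ContMDiff 𝓘(ℝ, ℝ × V) 𝓘(ℝ, V) ∞ fun x : O => x.1.2 :=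
        contDiff_snd.contMDiff.comp contMDiff_subtype_val
      refine (h1 x).congr_of_eventuallyEq ?_ |>.contMDiffWithinAt
      filter_upwards [(isOpen_lt continuous_const hc1).mem_nhds hx] with y hy using hf1 y hy
  -- f is already smooth for t < 1/4 and for t > 3/4, so the smooth approximation can agree with it
  -- for t ≤ 0 and t ≥ 1. This keeps the values at times 0 and 1 exact.
  obtain ⟨g, hgd, hg, -⟩ := hf.exists_contMDiff_approx_and_eqOn 𝓘(ℝ, ℝ × V) (⊤ : ℕ∞)
    (ε := fun x => ε (f x)) (hε.comp hf) (fun x => hεpos _ (hfS x))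
    ((isClosed_le hc1 continuous_const).union (isClosed_le continuous_const hc1)) hU hsm
  classical
  let c : ℝ × V → V := fun p => if hp : p ∈ O then g ⟨p, hp⟩ else 0
  have hcg : ∀ x : O, c x.1 = g x := fun x => dif_pos x.2
  refine ⟨c, s₀, s₀.2, fun p hp => ?_, fun t s hs => ?_, fun s hs => ?_, fun s hs => ?_⟩
  · have h1 : ContMDiffAt 𝓘(ℝ, ℝ × V) 𝓘(ℝ, V) ∞ (fun x : O => c x.1) ⟨p, hp⟩ := by
      simp only [hcg]
      exact g.contMDiff ⟨p, hp⟩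
    exact (contMDiffAt_subtype_iff.1 h1).contDiffAt.contDiffWithinAt
  · rw [hcg ⟨(t, s), mem_univ t, hs⟩]
    exact hεS _ (hfS _) _ (hgd _)
  · rw [hcg ⟨(1, s), mem_univ 1, hs⟩, hg (Or.inr (le_refl (1 : ℝ))), hf1 _ (by norm_num)]
  · rw [hcg ⟨(0, s), mem_univ 0, hs⟩, hg (Or.inl (le_refl (0 : ℝ))), hf0 _ (by norm_num)]


/-! ### The projection from (x, y, p, h) to (x, y) and the fibres of the dual jet bundle. -/

section FieldBundle

variable {n : ℕ} {ι : Type*} [Fintype ι] {q : ι → ℕ} {M : Type*} [TopologicalSpace M]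
  [ChartedSpace (EuclideanSpace ℝ (Fin n)) M] [IsManifold (𝓡 n) ∞ M]

/-- The projection `(y, p, h) ↦ y` of the model fibres. -/
def resModel (n : ℕ) (q : ι → ℕ) : FormModel n (phaseDeg n q) →L[ℝ] FormModel n q :=
  ContinuousLinearMap.pi fun A => ContinuousLinearMap.proj (Sum.inl A)

/-- The differential of the inverse of the chart around `x₀` at the image of `x`. -/
def frame (x₀ x : M) : EuclideanSpace ℝ (Fin n) →L[ℝ] EuclideanSpace ℝ (Fin n) :=
  mfderiv 𝓘(ℝ, EuclideanSpace ℝ (Fin n)) (𝓡 n) (extChartAt (𝓡 n) x₀).symm (extChartAt (𝓡 n) x₀ x)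

theorem chart_mk {κ : Type*} [Fintype κ] {d : κ → ℕ} {x₀ x : M}
    (hx : x ∈ (extChartAt (𝓡 n) x₀).source) (z₀ z : FormModel n d) :
    extChartAt (bundleModel n d) (⟨x₀, z₀⟩ : FormBundle n d M) (⟨x, z⟩ : FormBundle n d M) =
      (extChartAt (𝓡 n) x₀ x, pullModel n d (frame x₀ x) z) := by
  refine Prod.ext (chart_fst _ _) (funext fun k => ContinuousAlternatingMap.ext fun w => ?_)
  have h : (extChartAt (bundleModel n d) (⟨x₀, z₀⟩ : FormBundle n d M)
      (⟨x, z⟩ : FormBundle n d M)).2 k w = z k (fun i => frame x₀ x (w i)) :=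
    chart_snd (mem_source_iff.2 hx) k w
  exact h

theorem chart_toField {x₀ : M} {z₀ : FormModel n (phaseDeg n q)} {y₀ : FormModel n q}
    {P : PhaseBundle n q M} (hP : P.proj ∈ (extChartAt (𝓡 n) x₀).source) :
    extChartAt (bundleModel n q) (⟨x₀, y₀⟩ : FieldBundle n q M) (toField P) =
      ((extChartAt (bundleModel n (phaseDeg n q)) (⟨x₀, z₀⟩ : PhaseBundle n q M) P).1,
        resModel n q (extChartAt (bundleModel n (phaseDeg n q)) (⟨x₀, z₀⟩ : PhaseBundle n q M)
          P).2) := by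
  obtain ⟨x, z⟩ := P
  have h1 : extChartAt (bundleModel n (phaseDeg n q)) (⟨x₀, z₀⟩ : PhaseBundle n q M)
      (⟨x, z⟩ : PhaseBundle n q M) = _ := chart_mk hP z₀ z
  have h2 : extChartAt (bundleModel n q) (⟨x₀, y₀⟩ : FieldBundle n q M)
      (toField (⟨x, z⟩ : PhaseBundle n q M)) = _ := chart_mk hP y₀ (resModel n q z)
  rw [h1, h2]
  rfl

theorem toField_symm {x₀ : M} {z₀ : FormModel n (phaseDeg n q)} {y₀ : FormModel n q}
    {u : EuclideanSpace ℝ (Fin n) × FormModel n (phaseDeg n q)}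
    (hu : u ∈ (extChartAt (bundleModel n (phaseDeg n q)) (⟨x₀, z₀⟩ : PhaseBundle n q M)).target) :
    toField ((extChartAt (bundleModel n (phaseDeg n q)) (⟨x₀, z₀⟩ : PhaseBundle n q M)).symm u) =
      (extChartAt (bundleModel n q) (⟨x₀, y₀⟩ : FieldBundle n q M)).symm
        (u.1, resModel n q u.2) := by
  have h := mem_source_iff.1
    ((extChartAt (bundleModel n (phaseDeg n q)) (⟨x₀, z₀⟩ : PhaseBundle n q M)).map_target hu)
  have h1 := chart_toField (z₀ := z₀) (y₀ := y₀) h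
  rw [(extChartAt (bundleModel n (phaseDeg n q)) (⟨x₀, z₀⟩ : PhaseBundle n q M)).right_inv hu] at h1
  rw [← h1]
  exact ((extChartAt (bundleModel n q) (⟨x₀, y₀⟩ : FieldBundle n q M)).left_inv
    (mem_source_iff.2 h)).symm

theorem mem_target_mk {κ : Type*} [Fintype κ] {d : κ → ℕ} {x₀ : M} {z₀ : FormModel n d}
    {u : EuclideanSpace ℝ (Fin n) × FormModel n d} : u ∈ (extChartAt (bundleModel n d)
      (⟨x₀, z₀⟩ : FormBundle n d M)).target ↔ u.1 ∈ (extChartAt (𝓡 n) x₀).target := by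
  rw [target_eq]
  exact ⟨fun h => h.1, fun h => ⟨h, mem_univ _⟩⟩

theorem continuousAt_toField (x : M) (z : FormModel n (phaseDeg n q)) :
    ContinuousAt (toField : PhaseBundle n q M → FieldBundle n q M) ⟨x, z⟩ := by
  have hr : Continuous fun u : EuclideanSpace ℝ (Fin n) × FormModel n (phaseDeg n q) =>
      (u.1, resModel n q u.2) :=
    continuous_fst.prodMk ((resModel n q).continuous.comp continuous_snd)
  have h2 : ContinuousAt (fun P : PhaseBundle n q M =>
      ((extChartAt (bundleModel n (phaseDeg n q)) (⟨x, z⟩ : PhaseBundle n q M) P).1,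
        resModel n q (extChartAt (bundleModel n (phaseDeg n q)) (⟨x, z⟩ : PhaseBundle n q M) P).2))
      ⟨x, z⟩ :=
    ContinuousAt.comp hr.continuousAt (continuousAt_extChartAt (I := bundleModel n (phaseDeg n q))
      (⟨x, z⟩ : PhaseBundle n q M))
  have h3 : ContinuousAt (extChartAt (bundleModel n q) (⟨x, resModel n q z⟩ :
      FieldBundle n q M)).symm
      ((extChartAt (bundleModel n (phaseDeg n q)) (⟨x, z⟩ : PhaseBundle n q M) ⟨x, z⟩).1,
        resModel n q (extChartAt (bundleModel n (phaseDeg n q)) (⟨x, z⟩ : PhaseBundle n q M)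
          ⟨x, z⟩).2) := by
    refine (continuousOn_extChartAt_symm _).continuousAt
      ((isOpen_extChartAt_target _).mem_nhds (mem_target_mk.2 ?_))
    have hc : extChartAt (bundleModel n (phaseDeg n q)) (⟨x, z⟩ : PhaseBundle n q M) ⟨x, z⟩ =
      (extChartAt (𝓡 n) x x, z) := chart_fibre x z z
    have h6 : (extChartAt (𝓡 n) x x) ∈ (extChartAt (𝓡 n) x).target := mem_extChartAt_target x
    exact (congrArg Prod.fst hc).symm ▸ h6
  refine (ContinuousAt.comp (x := (⟨x, z⟩ : PhaseBundle n q M)) h3 h2).congr ?_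
  have h4 : ∀ P : PhaseBundle n q M, P.proj ∈ (extChartAt (𝓡 n) x).source →
      (extChartAt (bundleModel n q) (⟨x, resModel n q z⟩ : FieldBundle n q M)).symm
        ((extChartAt (bundleModel n (phaseDeg n q)) (⟨x, z⟩ : PhaseBundle n q M) P).1,
          resModel n q (extChartAt (bundleModel n (phaseDeg n q)) (⟨x, z⟩ : PhaseBundle n q M)
            P).2) = toField P := fun P h => by
    rw [← chart_toField (y₀ := resModel n q z) h]
    exact (extChartAt (bundleModel n q) (⟨x, resModel n q z⟩ : FieldBundle n q M)).left_inv
      (mem_source_iff.2 h)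
  have h5 : ∀ᶠ P : PhaseBundle n q M in 𝓝 ⟨x, z⟩, P.proj ∈ (extChartAt (𝓡 n) x).source :=
    contMDiff_proj.continuous.continuousAt.preimage_mem_nhds (extChartAt_source_mem_nhds x)
  exact h5.mono h4

theorem continuous_toField : Continuous (toField : PhaseBundle n q M → FieldBundle n q M) :=
  continuous_iff_continuousAt.2 fun P => continuousAt_toField P.proj P.2

/-- The inclusion `y ↦ (y, 0, 0)` of the model fibres. -/
def extModel (n : ℕ) (q : ι → ℕ) : FormModel n q →L[ℝ] FormModel n (phaseDeg n q) :=
  ContinuousLinearMap.pi (Sum.rec (fun A => ContinuousLinearMap.proj A) fun _ => 0)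

/-- The endomorphism `(y, p, h) ↦ (0, p, h)` of the model fibre. -/
def momModel (n : ℕ) (q : ι → ℕ) : FormModel n (phaseDeg n q) →L[ℝ] FormModel n (phaseDeg n q) :=
  ContinuousLinearMap.id ℝ _ - (extModel n q).comp (resModel n q)

omit [Fintype ι] in
theorem resModel_extModel (y : FormModel n q) : resModel n q (extModel n q y) = y := rfl

omit [Fintype ι] in
theorem extModel_add_momModel (z : FormModel n (phaseDeg n q)) :
    extModel n q (resModel n q z) + momModel n q z = z := by
  simp [momModel]

omit [Fintype ι] in
theorem resModel_momModel (z : FormModel n (phaseDeg n q)) :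
    resModel n q (momModel n q z) = 0 := by
  simp [momModel, resModel_extModel]

/-- The chart at a point over x identifies the fibre of F over x, as a subspace of the total space,
with a set in the model fibre; nonemptiness and connectedness pass along it. -/
theorem isPreconnected_fibre {F : Set (PhaseBundle n q M)} (x : M)
    [ContractibleSpace {P : PhaseBundle n q M // P ∈ F ∧ proj P = x}] :
    (∃ z : FormModel n (phaseDeg n q), (⟨x, z⟩ : PhaseBundle n q M) ∈ F) ∧
      IsPreconnected {z : FormModel n (phaseDeg n q) | (⟨x, z⟩ : PhaseBundle n q M) ∈ F} := by
  let T := {P : PhaseBundle n q M // P ∈ F ∧ proj P = x}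
  let g : T → FormModel n (phaseDeg n q) := fun P =>
    (extChartAt (bundleModel n (phaseDeg n q)) (⟨x, (0 : FormModel n (phaseDeg n q))⟩ :
      PhaseBundle n q M) P.1).2
  have hg : Continuous g := by
    refine continuous_snd.comp ((continuousOn_extChartAt _).comp_continuous
      continuous_subtype_val fun P => mem_source_iff.2 ?_)
    have : P.1.proj = x := P.2.2
    rw [this]
    exact mem_extChartAt_source x
  have hr : range g = {z : FormModel n (phaseDeg n q) | (⟨x, z⟩ : PhaseBundle n q M) ∈ F} := by
    ext z
    constructor
    · rintro ⟨⟨⟨x', z'⟩, hP, hx⟩, rfl⟩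
      obtain rfl : x' = x := hx
      have h : g ⟨⟨x', z'⟩, hP, rfl⟩ = z' := congrArg Prod.snd (chart_fibre x' 0 z')
      exact h.symm ▸ hP
    · intro hz
      refine ⟨⟨⟨x, z⟩, hz, rfl⟩, ?_⟩
      exact congrArg Prod.snd (chart_fibre x 0 z)
  rw [← hr]
  refine ⟨?_, isPreconnected_range hg⟩
  obtain ⟨P⟩ : Nonempty T := inferInstance
  have : g P ∈ range g := mem_range_self P
  rw [hr] at this
  exact ⟨_, this⟩

end FieldBundle


/-! ### Fibre contractions from local trivializations of Y. -/

section Trivial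

variable {n : ℕ} {ι : Type*} [Fintype ι] {q : ι → ℕ} {M : Type*} [TopologicalSpace M]
  [ChartedSpace (EuclideanSpace ℝ (Fin n)) M] [IsManifold (𝓡 n) ∞ M]

theorem mk_chart_snd {κ : Type*} [Fintype κ] {d : κ → ℕ} {x : M} (z₀ : FormModel n d)
    {y : FormBundle n d M} (hy : y.proj = x) :
    (⟨x, (extChartAt (bundleModel n d) (⟨x, z₀⟩ : FormBundle n d M) y).2⟩ : FormBundle n d M) =
      y := by
  obtain ⟨x', z⟩ := y
  obtain rfl : x' = x := hy
  have h : (extChartAt (bundleModel n d) (⟨x', z₀⟩ : FormBundle n d M)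
    (⟨x', z⟩ : FormBundle n d M)).2 = z := congrArg Prod.snd (chart_fibre x' z₀ z)
  exact congrArg (fun z' : FormModel n d => (⟨x', z'⟩ : FormBundle n d M)) h

variable {Y : Set (FieldBundle n q M)} {S : Set (FormModel n q)} {W : Set M}
  {Φ : FieldBundle n q M → FormModel n q} {Ψ : M × FormModel n q → FieldBundle n q M}

/-- S is a retract of the fibre of the dual jet bundle: include it with zero momenta and zero h, and
return by forgetting them and applying Φ. A retract of a contractible space is contractible. -/
theorem contractibleSpace_typicalFibre {x₀ : M} (hx₀ : x₀ ∈ W)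
    (hΦ : ContMDiffOn (bundleModel n q) 𝓘(ℝ, FormModel n q) ∞ Φ (Y ∩ proj ⁻¹' W))
    (hΨ : ContMDiffOn (bundleModel n q) (bundleModel n q) ∞ Ψ (W ×ˢ S))
    (hl : ∀ y ∈ Y, proj y ∈ W → Φ y ∈ S ∧ Ψ (proj y, Φ y) = y)
    (hr : ∀ z ∈ W ×ˢ S, Ψ z ∈ Y ∧ proj (Ψ z) = z.1 ∧ Φ (Ψ z) = z.2)
    [ContractibleSpace {P : PhaseBundle n q M // P ∈ jetDual Y ∧ proj P = x₀}] :
    ContractibleSpace S := by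
  let T := {P : PhaseBundle n q M // P ∈ jetDual Y ∧ proj P = x₀}
  let g : S → FormModel n q := fun s =>
    (extChartAt (bundleModel n q) (⟨x₀, (0 : FormModel n q)⟩ : FieldBundle n q M)
      (Ψ (x₀, s.1))).2
  have hg : Continuous g := by
    have h1 : Continuous fun s : S => Ψ (x₀, s.1) :=
      hΨ.continuousOn.comp_continuous (continuous_const.prodMk continuous_subtype_val)
        fun s => ⟨hx₀, s.2⟩
    refine continuous_snd.comp ((continuousOn_extChartAt _).comp_continuous h1 fun s => ?_)
    refine mem_source_iff.2 ?_
    have h2 : (Ψ (x₀, s.1)).proj = x₀ := (hr (x₀, s.1) ⟨hx₀, s.2⟩).2.1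
    rw [h2]
    exact mem_extChartAt_source x₀
  have hgΨ : ∀ s : S, (⟨x₀, g s⟩ : FieldBundle n q M) = Ψ (x₀, s.1) := fun s =>
    mk_chart_snd 0 (hr (x₀, s.1) ⟨hx₀, s.2⟩).2.1
  have hT : ∀ s : S, (⟨x₀, extModel n q (g s)⟩ : PhaseBundle n q M) ∈ jetDual Y := fun s => by
    have h : toField (⟨x₀, extModel n q (g s)⟩ : PhaseBundle n q M) = Ψ (x₀, s.1) := hgΨ s
    have h1 := (hr (x₀, s.1) ⟨hx₀, s.2⟩).1
    rwa [← h] at h1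
  let i : C(S, T) := ⟨fun s => ⟨⟨x₀, extModel n q (g s)⟩, hT s, rfl⟩,
    ((continuous_fibre x₀).comp ((extModel n q).continuous.comp hg)).subtype_mk _⟩
  have hTW : ∀ P : T, proj (toField P.1) ∈ W := fun P => by
    have : proj (toField P.1) = x₀ := P.2.2
    rw [this]
    exact hx₀
  let r : C(T, S) := ⟨fun P => ⟨Φ (toField P.1), (hl _ P.2.1 (hTW P)).1⟩,
    (hΦ.continuousOn.comp_continuous (continuous_toField.comp continuous_subtype_val)
      fun P => ⟨P.2.1, hTW P⟩).subtype_mk _⟩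
  have hri : (r.comp (ContinuousMap.id T)).comp i = ContinuousMap.id S := by
    ext1 s
    refine Subtype.ext ?_
    have h : toField (⟨x₀, extModel n q (g s)⟩ : PhaseBundle n q M) = Ψ (x₀, s.1) := hgΨ s
    exact (congrArg Φ h).trans (hr (x₀, s.1) ⟨hx₀, s.2⟩).2.2
  rw [contractible_iff_id_nullhomotopic, ← hri]
  exact ((id_nullhomotopic T).comp_right r).comp_left i

/-- A smooth contraction of the typical fibre contracts the fibres of the dual jet bundle. -/
theorem exists_isFibreContraction (hY : IsOpen Y) (hW : IsOpen W) {x₀ : M}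
    (hWs : W ⊆ (extChartAt (𝓡 n) x₀).source)
    (hΦ : ContMDiffOn (bundleModel n q) 𝓘(ℝ, FormModel n q) ∞ Φ (Y ∩ proj ⁻¹' W))
    (hΨ : ContMDiffOn (bundleModel n q) (bundleModel n q) ∞ Ψ (W ×ˢ S))
    (hl : ∀ y ∈ Y, proj y ∈ W → Φ y ∈ S ∧ Ψ (proj y, Φ y) = y)
    (hr : ∀ z ∈ W ×ˢ S, Ψ z ∈ Y ∧ proj (Ψ z) = z.1 ∧ Φ (Ψ z) = z.2)
    {c : ℝ × FormModel n q → FormModel n q} {s₀ : FormModel n q}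
    (hc : ContDiffOn ℝ ∞ c (univ ×ˢ S)) (hcS : ∀ t, ∀ s ∈ S, c (t, s) ∈ S)
    (hc1 : ∀ s ∈ S, c (1, s) = s) (hc0 : ∀ s ∈ S, c (0, s) = s₀) :
    ∃ H, IsFibreContraction ((extChartAt (bundleModel n (phaseDeg n q))
        (⟨x₀, (0 : FormModel n (phaseDeg n q))⟩ : PhaseBundle n q M)).target ∩
      (extChartAt (bundleModel n (phaseDeg n q))
        (⟨x₀, (0 : FormModel n (phaseDeg n q))⟩ : PhaseBundle n q M)).symm ⁻¹'
        (jetDual Y ∩ proj ⁻¹' W)) H := by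
  set CF := extChartAt (bundleModel n (phaseDeg n q))
    (⟨x₀, (0 : FormModel n (phaseDeg n q))⟩ : PhaseBundle n q M) with hCF
  set CY := extChartAt (bundleModel n q) (⟨x₀, (0 : FormModel n q)⟩ : FieldBundle n q M) with hCY
  set Ω := CF.target ∩ CF.symm ⁻¹' (jetDual Y ∩ proj ⁻¹' W) with hΩ
  let r : EuclideanSpace ℝ (Fin n) × FormModel n (phaseDeg n q) →
    EuclideanSpace ℝ (Fin n) × FormModel n q := fun u => (u.1, resModel n q u.2)
  -- the point of `M × S` reached at time `t`
  let s : ℝ × (EuclideanSpace ℝ (Fin n) × FormModel n (phaseDeg n q)) → M × FormModel n q :=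
    fun p => ((extChartAt (𝓡 n) x₀).symm p.2.1, c (p.1, Φ (CY.symm (r p.2))))
  -- The field part follows c in the trivialization, while (p, h) is multiplied by t. The latter
  -- components are unconstrained, so every real t is allowed, and at t = 0 only the base point is
  -- remembered.
  let H : ℝ × (EuclideanSpace ℝ (Fin n) × FormModel n (phaseDeg n q)) →
      EuclideanSpace ℝ (Fin n) × FormModel n (phaseDeg n q) := fun p =>
    (p.2.1, extModel n q (CY (Ψ (s p))).2 + p.1 • momModel n q p.2.2)
  -- Membership in Ω restricts only the base point and y, never the momenta or h.
  have hmem : ∀ {u : EuclideanSpace ℝ (Fin n) × FormModel n (phaseDeg n q)},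
      u ∈ Ω ↔ u.1 ∈ (extChartAt (𝓡 n) x₀).target ∧ CY.symm (r u) ∈ Y ∧
        (extChartAt (𝓡 n) x₀).symm u.1 ∈ W := by
    intro u
    have h1 : u ∈ CF.target → toField (CF.symm u) = CY.symm (r u) := fun hu => toField_symm hu
    have h2 : u ∈ CF.target → (CF.symm u).proj = (extChartAt (𝓡 n) x₀).symm u.1 := fun hu =>
      proj_symm (⟨x₀, (0 : FormModel n (phaseDeg n q))⟩ : PhaseBundle n q M) hu
    have h3 : u ∈ CF.target ↔ u.1 ∈ (extChartAt (𝓡 n) x₀).target := mem_target_mk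
    constructor
    · rintro ⟨hu, hu1, hu2⟩
      refine ⟨h3.1 hu, h1 hu ▸ hu1, ?_⟩
      rw [← h2 hu]
      exact hu2
    · rintro ⟨hu, hu1, hu2⟩
      have hu' := h3.2 hu
      rw [← h1 hu'] at hu1
      rw [← h2 hu'] at hu2
      exact ⟨hu', hu1, hu2⟩
  have hrt : ∀ u ∈ Ω, r u ∈ CY.target := fun u hu => mem_target_mk.2 (hmem.1 hu).1
  have hpr : ∀ u ∈ Ω, proj (CY.symm (r u)) = (extChartAt (𝓡 n) x₀).symm u.1 := fun u hu =>
    proj_symm (⟨x₀, (0 : FormModel n q)⟩ : FieldBundle n q M) (hrt u hu)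
  have hΦS : ∀ u ∈ Ω, Φ (CY.symm (r u)) ∈ S ∧
      Ψ ((extChartAt (𝓡 n) x₀).symm u.1, Φ (CY.symm (r u))) = CY.symm (r u) := fun u hu => by
    have h := hmem.1 hu
    have := hl _ h.2.1 (by rw [hpr u hu]; exact h.2.2)
    rwa [hpr u hu] at this
  have hs : ∀ t, ∀ u ∈ Ω, s (t, u) ∈ W ×ˢ S := fun t u hu =>
    ⟨(hmem.1 hu).2.2, hcS t _ (hΦS u hu).1⟩
  have hΨs : ∀ t, ∀ u ∈ Ω, Ψ (s (t, u)) ∈ CY.source := fun t u hu => by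
    refine mem_source_iff.2 ?_
    have h : (Ψ (s (t, u))).proj = (extChartAt (𝓡 n) x₀).symm u.1 := (hr _ (hs t u hu)).2.1
    rw [h]
    exact hWs (hmem.1 hu).2.2
  have hCΨ : ∀ t, ∀ u ∈ Ω, (CY (Ψ (s (t, u)))).1 = u.1 := fun t u hu => by
    have h : (Ψ (s (t, u))).proj = (extChartAt (𝓡 n) x₀).symm u.1 := (hr _ (hs t u hu)).2.1
    rw [hCY, chart_fst, h]
    exact (extChartAt (𝓡 n) x₀).right_inv (hmem.1 hu).1
  have hrH : ∀ t, ∀ u ∈ Ω, r (H (t, u)) = CY (Ψ (s (t, u))) := fun t u hu => by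
    refine Prod.ext (hCΨ t u hu).symm ?_
    change resModel n q (extModel n q _ + t • momModel n q u.2) = _
    rw [map_add, map_smul, resModel_momModel, smul_zero, add_zero, resModel_extModel]
  refine ⟨H, isOpen_overlap _ ?_, ?_, fun t u hu => ?_, fun t u hu => rfl, fun u hu => ?_,
    fun u hu u' hu' he => ?_⟩
  · exact (hY.preimage continuous_toField).inter (hW.preimage contMDiff_proj.continuous)
  · have hY1 : ContMDiffOn 𝓘(ℝ, ℝ × (EuclideanSpace ℝ (Fin n) × FormModel n (phaseDeg n q)))
        (bundleModel n q) ∞ (fun p => CY.symm (r p.2)) (Prod.snd ⁻¹' Ω) :=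
      (contMDiffOn_extChartAt_symm (⟨x₀, (0 : FormModel n q)⟩ : FieldBundle n q M)).comp
        ((contDiff_fst.prodMk ((resModel n q).contDiff.comp contDiff_snd)).comp
          contDiff_snd).contMDiff.contMDiffOn fun p hp => hrt p.2 hp
    have hΦ1 : ContMDiffOn 𝓘(ℝ, ℝ × (EuclideanSpace ℝ (Fin n) × FormModel n (phaseDeg n q)))
        𝓘(ℝ, FormModel n q) ∞ (fun p => Φ (CY.symm (r p.2))) (Prod.snd ⁻¹' Ω) :=
      hΦ.comp hY1 fun p hp => ⟨(hmem.1 hp).2.1, by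
        rw [mem_preimage, hpr p.2 hp]
        exact (hmem.1 hp).2.2⟩
    have hc' : ContDiffOn ℝ ∞ (fun p : ℝ × (EuclideanSpace ℝ (Fin n) × FormModel n (phaseDeg n q)) =>
        c (p.1, Φ (CY.symm (r p.2)))) (Prod.snd ⁻¹' Ω) :=
      hc.comp (contDiff_fst.contDiffOn.prodMk hΦ1.contDiffOn) fun p hp =>
        ⟨mem_univ _, (hΦS p.2 hp).1⟩
    have hb0 : ContMDiffOn 𝓘(ℝ, ℝ × (EuclideanSpace ℝ (Fin n) × FormModel n (phaseDeg n q)))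
        𝓘(ℝ, EuclideanSpace ℝ (Fin n)) ∞ (fun p => p.2.1) (Prod.snd ⁻¹' Ω) :=
      (contDiff_fst.comp contDiff_snd).contMDiff.contMDiffOn
    have hb : ContMDiffOn 𝓘(ℝ, ℝ × (EuclideanSpace ℝ (Fin n) × FormModel n (phaseDeg n q)))
        (𝓡 n) ∞ (fun p => (extChartAt (𝓡 n) x₀).symm p.2.1) (Prod.snd ⁻¹' Ω) :=
      ContMDiffOn.comp (f := fun p : ℝ × (EuclideanSpace ℝ (Fin n) × FormModel n (phaseDeg n q)) =>
        p.2.1) (contMDiffOn_extChartAt_symm (I := 𝓡 n) x₀) hb0 fun p hp => (hmem.1 hp).1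
    have hs1 : ContMDiffOn 𝓘(ℝ, ℝ × (EuclideanSpace ℝ (Fin n) × FormModel n (phaseDeg n q)))
        (bundleModel n q) ∞ s (Prod.snd ⁻¹' Ω) := hb.prodMk hc'.contMDiffOn
    have hΨ1 := hΨ.comp hs1 fun p hp => hs p.1 p.2 hp
    have hC1 := ContMDiffOn.comp (contMDiffOn_extChartAt (n := ∞) (I := bundleModel n q)
      (x := (⟨x₀, (0 : FormModel n q)⟩ : FieldBundle n q M))) hΨ1 fun p hp => by
        have h := hΨs p.1 p.2 hp
        rwa [hCY, extChartAt_source] at h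
    have hC2 : ContDiffOn ℝ ∞ (fun p => (CY (Ψ (s p))).2) (Prod.snd ⁻¹' Ω) :=
      contDiff_snd.comp_contDiffOn hC1.contDiffOn
    exact (contDiff_fst.comp contDiff_snd).contDiffOn.prodMk
      (((extModel n q).contDiff.comp_contDiffOn hC2).add (contDiff_fst.smul
        ((momModel n q).contDiff.comp (contDiff_snd.comp contDiff_snd))).contDiffOn)
  · refine hmem.2 ⟨(hmem.1 hu).1, ?_, (hmem.1 hu).2.2⟩
    rw [hrH t u hu, CY.left_inv (hΨs t u hu)]
    exact (hr _ (hs t u hu)).1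
  · refine Prod.ext rfl ?_
    have h1 : s (1, u) = ((extChartAt (𝓡 n) x₀).symm u.1, Φ (CY.symm (r u))) :=
      Prod.ext rfl (hc1 _ (hΦS u hu).1)
    change extModel n q (CY (Ψ (s (1, u)))).2 + (1 : ℝ) • momModel n q u.2 = u.2
    rw [h1, (hΦS u hu).2, CY.right_inv (hrt u hu), one_smul]
    exact extModel_add_momModel u.2
  · have h1 : ∀ u ∈ Ω, s (0, u) = ((extChartAt (𝓡 n) x₀).symm u.1, s₀) := fun u hu =>
      Prod.ext rfl (hc0 _ (hΦS u hu).1)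
    refine Prod.ext he ?_
    change extModel n q (CY (Ψ (s (0, u)))).2 + (0 : ℝ) • momModel n q u.2 =
      extModel n q (CY (Ψ (s (0, u')))).2 + (0 : ℝ) • momModel n q u'.2
    rw [h1 u hu, h1 u' hu', he, zero_smul, zero_smul]

end Trivial


/-- A product of balls contracts along straight lines. -/
theorem isFibreContraction_ball {E G : Type*} [NormedAddCommGroup E] [NormedSpace ℝ E]
    [NormedAddCommGroup G] [NormedSpace ℝ G] [FiniteDimensional ℝ E] [FiniteDimensional ℝ G]
    (e₀ : E) (z₀ : G) {r : ℝ} (hr : 0 < r) :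
    IsFibreContraction (Metric.ball e₀ r ×ˢ Metric.ball z₀ r)
      fun p => (p.2.1, z₀ + Real.smoothTransition p.1 • (p.2.2 - z₀)) where
  isOpen := Metric.isOpen_ball.prod Metric.isOpen_ball
  contDiffOn := by
    have h1 : ContDiff ℝ ∞ fun p : ℝ × (E × G) => Real.smoothTransition p.1 :=
      Real.smoothTransition.contDiff.comp contDiff_fst
    exact ((contDiff_fst.comp contDiff_snd).prodMk (contDiff_const.add
      (h1.smul ((contDiff_snd.comp contDiff_snd).sub contDiff_const)))).contDiffOn
  -- `Real.smoothTransition` takes values in [0, 1], so the contraction stays in the ball even for t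
  -- outside the unit interval.
  mapsTo t u hu := ⟨hu.1, (convex_ball z₀ r).add_smul_sub_mem (Metric.mem_ball_self hr) hu.2
    ⟨Real.smoothTransition.nonneg t, Real.smoothTransition.le_one t⟩⟩
  fst _ _ _ := rfl
  one u _ := by simp
  zero u _ u' _ h := by simp [h]

/-! ### The local and the global decomposition. -/

section Main

variable {m : ℕ} {ι : Type*} [Fintype ι] {q : ι → ℕ} {M : Type*} [TopologicalSpace M]
  [ChartedSpace (EuclideanSpace ℝ (Fin (m + 2))) M] [IsManifold (𝓡 (m + 2)) ∞ M]
  {f : DForm (phaseI m q) (PhaseBundle (m + 2) q M) (m + 1)}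
  {v : (P : PhaseBundle (m + 2) q M) → TangentSpace (phaseI m q) P}
  {F U : Set (PhaseBundle (m + 2) q M)}

/-- The differential is i_b ω with b vertical, and one further vertical contraction already makes it
horizontal. This is the closedness hypothesis of the relative Poincaré lemma. -/
theorem vertFiltAt_extD_sub_noether (hU : IsOpen U) (hf : SmoothFormOn f U)
    (h : ∀ P ∈ U, interior (v P) (omega (m + 2) q M P) = extD f P)
    {ξ : (x : M) → TangentSpace (𝓡 (m + 2)) x} [IsManifold (𝓡 (m + 2)) 1 M]
    (hξ : SmoothFieldOn ξ univ) (hv : ∀ P ∈ U, baseField v P = ξ P.proj) :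
    ∀ P ∈ U, VertFiltAt 2 (extD fun P => f P - noether ξ P) P := fun P hP => by
  have hs : SmoothFormOn (fun P => f P - noether ξ P) U :=
    hf.sub ((smoothFormOn_noether hξ).mono (subset_univ U))
  have huU : (extChartAt (phaseI m q) P).symm (extChartAt (phaseI m q) P P) ∈ U := by
    rwa [extChartAt_to_inv]
  obtain ⟨b, hb⟩ := extDeriv_localRep_sub_noether hU hf h hξ (mem_extChartAt_target P) huU
    (hv _ huU)
  rw [VertFiltAt, extD_eq_extDeriv hU hs hP]
  exact hb ▸ vertFilt_interior_omegaLoc (pProj m q) (yProj m q) (hProj m q) b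

/-- An observable decomposes near every point. -/
theorem exists_decomposesOn [T2Space M] (hfields : 2 ≤ ∑ A, (m + 1).choose (q A)) (hF : IsOpen F)
    (hf : IsObservableOn f F) {x : M} {z₀ : PhaseModel m q}
    (hP : (⟨x, z₀⟩ : PhaseBundle (m + 2) q M) ∈ F) :
    ∃ U : Set (PhaseBundle (m + 2) q M), IsOpen U ∧
      (⟨x, z₀⟩ : PhaseBundle (m + 2) q M) ∈ U ∧ U ⊆ F ∧ DecomposesOn f U := by
  have := isManifold_one (𝓡 (m + 2)) M
  obtain ⟨hfs, v, hv, h⟩ := hf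
  obtain ⟨ξ, hξ, r, hr, hbox⟩ := exists_field_of_mem (z₀ := z₀) hfields hF hfs hv h hP
  set C := extChartAt (phaseI m q) (⟨x, z₀⟩ : PhaseBundle (m + 2) q M) with hC
  set B := Metric.ball (extChartAt (𝓡 (m + 2)) x x) r ×ˢ Metric.ball (z₀ : PhaseModel m q) r
  -- A product of balls in the chart on which v projects to ξ; its convex fibres provide both the
  -- contraction and the segments in h.
  let U : Set (PhaseBundle (m + 2) q M) := C.source ∩ C ⁻¹' B
  have hU : IsOpen U := (continuousOn_extChartAt _).isOpen_inter_preimage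
    (isOpen_extChartAt_source _) (Metric.isOpen_ball.prod Metric.isOpen_ball)
  have hUB : C.target ∩ C.symm ⁻¹' U = B := by
    ext u
    constructor
    · rintro ⟨hu, -, hu2⟩
      rwa [mem_preimage, C.right_inv hu] at hu2
    · intro hu
      refine ⟨(hbox u hu).1, C.map_target (hbox u hu).1, ?_⟩
      rwa [mem_preimage, C.right_inv (hbox u hu).1]
  have hUF : ∀ P ∈ U, P ∈ F ∧ baseField v P = ξ P.proj := fun P hP => by
    have := (hbox _ hP.2).2
    rwa [C.left_inv hP.1] at this
  have hPU : (⟨x, z₀⟩ : PhaseBundle (m + 2) q M) ∈ U := by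
    refine ⟨mem_extChartAt_source (I := phaseI m q) _, ?_⟩
    have : C ⟨x, z₀⟩ = (extChartAt (𝓡 (m + 2)) x x, z₀) := chart_fibre x z₀ z₀
    rw [mem_preimage, this]
    exact ⟨Metric.mem_ball_self hr, Metric.mem_ball_self hr⟩
  have hUsub : U ⊆ F := fun P hP => (hUF P hP).1
  have hfU := hfs.mono hUsub
  have hU' : ∀ P ∈ U, _ := fun P hP => h P (hUsub hP)
  have hvU : ∀ P ∈ U, _ := fun P hP => (hUF P hP).2
  -- With p = m + 1 the filtration requirement is step m + 2, which every (m + 1)-form satisfies.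
  obtain ⟨α, hα, hα'⟩ := exists_primitive_of_chart (p := m + 1) hU inter_subset_left
    (by rw [hUB]; exact isFibreContraction_ball (extChartAt (𝓡 (m + 2)) x x) z₀ hr)
    (hfU.sub ((smoothFormOn_noether hξ).mono (subset_univ U)))
    (vertFiltAt_extD_sub_noether hU hfU hU' hξ hvU) fun P _ => vertFilt_top _
  refine ⟨U, hU, hPU, hUsub, decomposesOn_of_vertFilt hU hfU hU' hξ hvU hα
    (fun P hP => (hα' P hP).2) fun x' z z' hz hz' _ _ t ht => ?_⟩
  have hx' : x' ∈ (extChartAt (𝓡 (m + 2)) x).source := mem_source_iff.1 hz.1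
  have e : ∀ z : PhaseModel m q, C ⟨x', z⟩ = (extChartAt (𝓡 (m + 2)) x x',
    pullModel (m + 2) (phaseDeg (m + 2) q) (frame x x') z) := fun z => chart_mk hx' z₀ z
  have hz2 := hz.2
  have hz2' := hz'.2
  rw [mem_preimage, e] at hz2 hz2'
  refine ⟨mem_source_iff.2 hx', ?_⟩
  rw [mem_preimage, e]
  refine ⟨hz2.1, ?_⟩
  -- The bundle chart is linear on each fibre, so the segment is mapped to a segment inside the
  -- ball.
  rw [map_add, map_smul, map_sub]
  exact (convex_ball _ r).add_smul_sub_mem hz2.2 hz2'.2 ht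

/-- If the fibres are contractible, an observable decomposes globally. -/
theorem decomposesOn_of_contractible [T2Space M] [SecondCountableTopology M]
    (hfields : 2 ≤ ∑ A, (m + 1).choose (q A)) {Y : Set (FieldBundle (m + 2) q M)}
    (hY : IsGradedBundle Y) (hf : IsObservableOn f (jetDual Y))
    (hcon : ∀ x : M, ContractibleSpace
      {P : PhaseBundle (m + 2) q M // P ∈ jetDual Y ∧ proj P = x}) :
    DecomposesOn f (jetDual Y) := by
  have := isManifold_one (𝓡 (m + 2)) M
  have : LocallyCompactSpace M := ChartedSpace.locallyCompactSpace (EuclideanSpace ℝ (Fin (m + 2))) M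
  obtain ⟨hfs, v, hv, h⟩ := hf
  obtain ⟨hYo, S, hS, hYt⟩ := hY
  have hF : IsOpen (jetDual Y) := hYo.preimage continuous_toField
  obtain ⟨ξ, hξ, hvξ⟩ := exists_field_of_preconnected hfields hF hfs hv h
    (fun x => (isPreconnected_fibre x).1) fun x => (isPreconnected_fibre x).2
  obtain ⟨α, hα, hα'⟩ := exists_primitive_of_contraction hF (fun x₀ => by
    obtain ⟨W, hW, hx₀, Φ, Ψ, hΦ, hΨ, hl, hr⟩ := hYt x₀
    have hSc := contractibleSpace_typicalFibre hx₀ hΦ hΨ hl hr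
    obtain ⟨c, s₀, -, hc, hcS, hc1, hc0⟩ := exists_contDiffOn_contraction hS
    have hsub : W ∩ (extChartAt (𝓡 (m + 2)) x₀).source ⊆ W := inter_subset_left
    refine ⟨W ∩ (extChartAt (𝓡 (m + 2)) x₀).source, hW.inter (isOpen_extChartAt_source x₀),
      ⟨hx₀, mem_extChartAt_source x₀⟩, _, ?_, exists_isFibreContraction hYo
      (hW.inter (isOpen_extChartAt_source x₀)) inter_subset_right
      (hΦ.mono (inter_subset_inter_right _ (preimage_mono hsub)))
      (hΨ.mono (prod_mono hsub le_rfl)) (fun y hy hyW => hl y hy hyW.1)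
      (fun z hz => hr z ⟨hz.1.1, hz.2⟩) hc hcS hc1 hc0⟩
    -- Here the requirement is step p + 2, so p = m already imposes nothing on an (m + 1)-form.
    exact inter_subset_right) m
    (hfs.sub ((smoothFormOn_noether hξ).mono (subset_univ _)))
    (vertFiltAt_extD_sub_noether hF hfs h hξ hvξ) fun P _ => vertFilt_top _
  -- Membership in the dual jet bundle depends on (x, y) alone, and y is constant along a segment in
  -- the h-direction.
  refine decomposesOn_of_vertFilt hF hfs h hξ hvξ hα hα' fun x z z' hz _ hy _ t _ => ?_
  have e : toField (⟨x, z + t • (z' - z)⟩ : PhaseBundle (m + 2) q M) =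
      toField (⟨x, z⟩ : PhaseBundle (m + 2) q M) := by
    have e1 : resModel (m + 2) q (z + t • (z' - z)) = resModel (m + 2) q z := by
      have e2 : resModel (m + 2) q z = resModel (m + 2) q z' := funext hy
      rw [map_add, map_smul, map_sub, e2, sub_self, smul_zero, add_zero]
    exact congrArg (fun y : FormModel (m + 2) q => (⟨x, y⟩ : FieldBundle (m + 2) q M)) e1
  have hz1 : toField (⟨x, z⟩ : PhaseBundle (m + 2) q M) ∈ Y := hz
  rwa [← e] at hz1

end Main

end DJet

end

theorem mainTheorem2 {m : ℕ} {ι : Type*} [Fintype ι] (q : ι → ℕ) (hq : ∀ A, q A ≤ m + 2)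
    (hfields : 2 ≤ ∑ A, (m + 1).choose (q A))
    {M : Type*} [TopologicalSpace M] [T2Space M] [SecondCountableTopology M]
    [ChartedSpace (EuclideanSpace ℝ (Fin (m + 2))) M] [IsManifold (𝓡 (m + 2)) ∞ M]
    (Y : Set (DJet.FieldBundle (m + 2) q M)) (hY : DJet.IsGradedBundle Y)
    (f : DJet.DForm (DJet.bundleModel (m + 2) (DJet.phaseDeg (m + 2) q))
      (DJet.PhaseBundle (m + 2) q M) (m + 1))
    (hf : DJet.IsObservableOn f (DJet.jetDual Y)) :
    (∀ P ∈ DJet.jetDual Y, ∃ U : Set (DJet.PhaseBundle (m + 2) q M),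
      IsOpen U ∧ P ∈ U ∧ U ⊆ DJet.jetDual Y ∧ DJet.DecomposesOn f U) ∧
    ((∀ x : M, ContractibleSpace
        {P : DJet.PhaseBundle (m + 2) q M // P ∈ DJet.jetDual Y ∧ DJet.proj P = x}) →
      DJet.DecomposesOn f (DJet.jetDual Y)) := by
  refine ⟨fun P hP => ?_, fun hcon => DJet.decomposesOn_of_contractible hfields hY hf hcon⟩
  exact DJet.exists_decomposesOn (x := P.proj) (z₀ := P.2) hfields
    (hY.1.preimage DJet.continuous_toField) hf hP
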